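/- **Setting.** Let $d\in\{2,3\}$ and let $\Omega\subset\mathbb R^d$ be a bounded, connected, nonempty open set with $\Omega=\operatorname{int}\overline\Omega$ (e.g. a bounded polyhedral Lipschitz domain). Let $\partial\Omega=\Gamma_1\cup\Gamma_2\cup\Gamma_3$ be a disjoint decomposition with $\Gamma_3$ closed. Data: $K=K^\top\in L^\infty(\Omega)^{d\times d}$ with $\xi\cdot K(x)\xi\ge k_0|\xi|^2$ for a.e. $x$ and all $\xi$ ($k_0>0$); $c\in L^\infty(\Omega)^d$ with weak derivatives $\partial_jc_j\in L^{3/2}(\Omega)$; $r\in L^\infty(\Omega)$, $f\in L^2(\Omega)$, $\alpha\in L^\infty(\Gamma_2)$, $g_j\in L^2(\Gamma_j)$ ($j=1,2,3$). $\|K\|_\infty$ is the essential supremum of the spectral norm of $K(x)$. Let $(\mathcal T_h)_h$ be a shape-regular family (for some $\rho>0$ independent of $h$, each $T\in\mathcal T_h$ contains a ball of radius $\rho\operatorname{diam}T$) of consistent partitions of $\Omega$ into finitely many closed convex polytopes with disjoint interiors: every face of an element lies in $\partial\Omega$ or is also a face of another element. Let $\overline{\mathcal F}$ be the set of all faces,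 $\mathcal F$ the interior faces. The boundary faces split into $\mathcal F_1,\mathcal F_2,\mathcal F_3$, where $F\in\mathcal F_j$ means that $F\subset\Gamma_j$ up to a surface null set, and $\overline{\Gamma_j}=\bigcup_{F\in\mathcal F_j}F$; moreover $\mathcal F_2=\mathcal F_{2,1}\cup\mathcal F_{2,2}$, where $\alpha=c\cdot\nu$ a.e. on each $F\in\mathcal F_{2,1}$ and $\alpha\ne c\cdot\nu$ a.e. on each $F\in\mathcal F_{2,2}$. Fix $k\ge0$ and one of two cases for the whole family: (P) all elements have $N:=d+1$ faces (simplices) and $\mathbb P_k=\mathcal P_k$ (total degree $\le k$), or (Q) all elements have $N:=2d$ faces and $\mathbb P_k=\mathcal Q_k$ (degree $\le k$ in each variable). $V_h$ is the space of functions whose restriction to every $T\in\mathcal T_h$ is in $\mathbb P_k$. $K$ is continuous on each element $T$ (i.e. $K|_{\operatorname{int}T}$ extends continuously to $T$; traces of $K$ from $T$ are those of this extension). The values of $c\cdot\nu_T$ on the faces are the (bounded) normal traces of $c$: $\int_T (c\cdot\nabla\varphi+(\nabla\cdot c)\varphi)=\sum_{F\subset\partial T}\int_F (c\cdot\nu_T)\varphi$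 for all smooth $\varphi$. Assume, almost everywhere, $$r+\tfrac12\nabla\cdot c\ge0\text{ in }\Omega,\quad c\cdot\nu\ge0\text{ on }\mathcal F_{2,1},\quad \alpha-\tfrac12c\cdot\nu\ge0\text{ on }\mathcal F_{2,2},\quad c\cdot\nu\le0\text{ on }\mathcal F_1\cup\mathcal F_3 .$$ Jumps and averages: $[\![v]\!]=v|_T\nu_T+v|_{T'}\nu_{T'}$, $\{p\}=\frac12(p|_T+p|_{T'})$ on an interior face $F\subset T\cap T'$, and $[\![v]\!]=v|_T\nu_T$, $\{p\}=p|_T$ on boundary faces. $c_{up}(w)$ is $c\,w|_T$ for the element $T$ with $c\cdot\nu_T>0$ on interior faces, and on boundary faces it is $c\,w|_T$ where $c\cdot\nu_T>0$ and $0$ elsewhere. With $h_F=\operatorname{diam}F$, $\theta\in\{0,1,-1\}$ and $\eta\in\mathbb R$, the interior penalty Galerkin (IPG) forms are $$\begin{aligned}a_h(u,v)={}&\sum_{T}\big[(K\nabla u-cu,\nabla v)_T+(ru,v)_T\big]+\sum_{F\in\mathcal F\cup\mathcal F_3}\Big[\theta(\{K\nabla v\},[\![u]\!])_F-\big(\{K\nabla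 u\}-\tfrac{\eta}{h_F}[\![u]\!],[\![v]\!]\big)_F\Big]\\&+\sum_{F\in\mathcal F\cup\mathcal F_{2,1}}(c_{up}(u),[\![v]\!])_F+\sum_{F\in\mathcal F_{2,2}}(\alpha u,v)_F,\\ \ell_h(v)={}&(f,v)+\sum_{F\in\mathcal F_1}(g_1,v)_F+\sum_{F\in\mathcal F_2}(g_2,v)_F+\sum_{F\in\mathcal F_3}\Big[\tfrac{\eta}{h_F}(g_3,v)_F+(\theta K\nabla v-cv,\nu g_3)_F\Big],\end{aligned}$$ and the energy norm is $$\begin{aligned}\|v\|_{V_h}^2={}&\sum_T\|K^{1/2}\nabla v\|_{0,T}^2+\sum_{F\in\mathcal F\cup\mathcal F_3}\tfrac{\eta}{h_F}\|[\![v]\!]\|_{0,F}^2+\tfrac12(2r+\nabla\cdot c,v^2)\\&+\tfrac12\sum_{F\in\overline{\mathcal F}\setminus\mathcal F_{2,2}}(|c\cdot\nu|,[\![v]\!]^2)_F+\tfrac12\sum_{F\in\mathcal F_{2,2}}(2\alpha-c\cdot\nu,v^2)_F .\end{aligned}$$ **Trace constants.** $C$ is a *discrete trace constant* if $h_F^{1/2}\|p\|_{0,F}\le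 C\|p\|_{0,T}$, and a *$K$-weighted discrete trace constant* if $h_F^{1/2}\|K^{1/2}\nabla p\|_{0,F}\le C\|K^{1/2}\nabla p\|_{0,T}$ ($K$ on $F$ taken from within $T$), for all $h$, $T\in\mathcal T_h$, faces $F$ of $T$ and $p\in\mathbb P_k$. (If $K$ is elementwise constant, every discrete trace constant is a $K$-weighted one.) **Penalty condition** for $C$: $$4\eta>(1-\theta)^2\,N\,C^2\,\|K\|_\infty ,$$ or, if $\Gamma_3=\emptyset$, only $4\eta>(1-\theta)\,N\,C^2\,\|K\|_\infty$. **Lemma.** 1. Suppose that $\Gamma_3$ has positive surface measure or that $r+\frac12\nabla\cdot c\ge r_0$ a.e. in $\Omega$ for a constant $r_0>0$. Then for all $\eta>0$ and $\theta\in\{0,1,-1\}$, $\ell_h$ and $a_h$ are bounded on $V_h$ with respect to $\|\cdot\|_{V_h}$, with constants that may depend on $h$. 2. Discrete trace constants $C>0$ and $K$-weighted discrete trace constants $C>0$ (independent of $h$) exist. 3. If $C_{tr}$ is a $K$-weighted discrete trace constant and the penalty condition holds for $C_{tr}$, then there is $a>0$ independent of $h$ with $a_h(v,v)\ge a\|v\|_{V_h}^2$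 for all $h$ and all $v\in V_h$. 4. If $C_{tr}$ is a discrete trace constant and the penalty condition holds for $C_{tr}$, then there are $a>0$ and $h_0>0$ such that $a_h(v,v)\ge a\|v\|_{V_h}^2$ for all $v\in V_h$ and all $h$ for which all elements of $\mathcal T_h$ have diameter at most $h_0$ or $K$ is constant in the interior of each element of $\mathcal T_h$. 5. For $\theta=1$ (NIPG) and every $\eta>0$, $a_h(v,v)\ge\|v\|_{V_h}^2$ for all $h$ and all $v\in V_h$. -/

import Mathlib

open MeasureTheory Set
open scoped ContDiff ENNReal

noncomputable section

namespace IPG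

/-- Points (and vectors) of `ℝ^d` with the Euclidean norm. -/
abbrev Pt (d : ℕ) : Type := EuclideanSpace ℝ (Fin d)

/-- The `(d-1)`-dimensional surface measure (normalised Hausdorff measure). -/
abbrev surf (d : ℕ) : Measure (Pt d) := Measure.euclideanHausdorffMeasure (d - 1)

/-! ### Polytopes and their faces -/

/-- A closed convex polytope with nonempty interior. -/
def IsPolytope {d : ℕ} (T : Set (Pt d)) : Prop :=
  (∃ s : Finset (Pt d), T = convexHull ℝ (s : Set (Pt d))) ∧ (interior T).Nonempty

/-- `n` is a unit vector and `F` is the set where `⟪n, ·⟫` attains its maximum over `T`. -/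
def IsOuterNormal {d : ℕ} (T F : Set (Pt d)) (n : Pt d) : Prop :=
  ‖n‖ = 1 ∧ F = {x | x ∈ T ∧ ∀ y ∈ T, inner ℝ n y ≤ inner ℝ n x}

/-- `F` is a (closed, `(d-1)`-dimensional) face of the polytope `T`. -/
def IsFacet {d : ℕ} (T F : Set (Pt d)) : Prop :=
  (∃ n, IsOuterNormal T F n) ∧ Module.finrank ℝ (vectorSpan ℝ F) + 1 = d

open scoped Classical in
/-- The unit outer normal of `T` on its face `F` (it is unique). -/
def outerNormal {d : ℕ} (T F : Set (Pt d)) : Pt d :=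
  if h : ∃ n, IsOuterNormal T F n then h.choose else 0

/-! ### Consistent partitions -/

/-- A consistent partition of `Ω` into convex polytopes. The finset `faces` collects all faces of
all elements. -/
structure Mesh (d : ℕ) (Ω : Set (Pt d)) where
  cells : Finset (Set (Pt d))
  faces : Finset (Set (Pt d))
  isPolytope : ∀ T ∈ cells, IsPolytope T
  covers : closure Ω = ⋃ T ∈ cells, T
  disjoint_interiors : ∀ T ∈ cells, ∀ T' ∈ cells, T ≠ T' → Disjoint (interior T) (interior T')
  mem_faces : ∀ F, F ∈ faces ↔ ∃ T ∈ cells, IsFacet T F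
  consistent : ∀ T ∈ cells, ∀ F, IsFacet T F →
    F ⊆ frontier Ω ∨ ∃ T' ∈ cells, T' ≠ T ∧ IsFacet T' F

/-- The two choices of local polynomial spaces: total degree, or degree in each variable. -/
inductive PolyKind
  | P
  | Q

/-- The number `|𝓕_K|` of faces of an element: `d + 1` for `𝒫_k`, `2 d` for `𝒬_k`. -/
def PolyKind.numFaces (κ : PolyKind) (d : ℕ) : ℕ :=
  match κ with
  | .P => d + 1
  | .Q => 2 * d

/-- `𝒫_k` (total degree at most `k`) or `𝒬_k` (degree at most `k` in each variable). -/
def PolyKind.space (κ : PolyKind) (d k : ℕ) : Submodule ℝ (MvPolynomial (Fin d) ℝ) :=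
  match κ with
  | .P => MvPolynomial.restrictTotalDegree (Fin d) ℝ k
  | .Q => MvPolynomial.restrictDegree (Fin d) ℝ k

/-- The value of a polynomial at a point. -/
def pval {d : ℕ} (p : MvPolynomial (Fin d) ℝ) (x : Pt d) : ℝ :=
  MvPolynomial.eval (fun i => x i) p

/-- The gradient of a polynomial at a point. -/
def pgrad {d : ℕ} (p : MvPolynomial (Fin d) ℝ) (x : Pt d) : Pt d :=
  WithLp.toLp 2 fun i => MvPolynomial.eval (fun j => x j) (MvPolynomial.pderiv i p)

namespace Mesh

variable {d : ℕ} {Ω : Set (Pt d)} (M : Mesh d Ω)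

open scoped Classical in
/-- Every element has exactly `|𝓕_K|` faces. A `d`-polytope with `d + 1` faces is a simplex; with
`2 d` faces one gets convex quadrilaterals (`d = 2`) and convex hexahedra (`d = 3`). -/
def HasElementsOf (κ : PolyKind) : Prop :=
  ∀ T ∈ M.cells, (M.faces.filter fun F => IsFacet T F).card = κ.numFaces d

/-- Piecewise polynomial functions: one polynomial for each element. -/
abbrev Fn : Type := M.cells → MvPolynomial (Fin d) ℝ

/-- The broken polynomial space `ℙ_k(𝒯)`. -/
def brokenPoly (κ : PolyKind) (k : ℕ) : Submodule ℝ M.Fn :=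
  Submodule.pi Set.univ fun _ => κ.space d k

open scoped Classical in
/-- The elements that have `F` as a face: two for an interior face, one for a boundary face. -/
def adj (F : Set (Pt d)) : Finset M.cells :=
  Finset.univ.filter fun T => IsFacet T.1 F

open scoped Classical in
/-- Faces lying on the boundary of `Ω`. -/
def bdryFaces : Finset (Set (Pt d)) := M.faces.filter fun F => F ⊆ frontier Ω

open scoped Classical in
/-- Interior faces. -/
def intFaces : Finset (Set (Pt d)) := M.faces.filter fun F => ¬ F ⊆ frontier Ω

open scoped Classical in
/-- A unit normal of the face `F`; on a boundary face it is the outer normal of `Ω`. -/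
def normal (F : Set (Pt d)) : Pt d :=
  if h : ∃ T ∈ M.cells, IsFacet T F then outerNormal h.choose F else 0

/-- The jump: `v|_K ν_K + v|_{K'} ν_{K'}` on interior faces, `v|_K ν_K` on boundary faces. -/
def jump (v : M.Fn) (F : Set (Pt d)) (x : Pt d) : Pt d :=
  ∑ T ∈ M.adj F, pval (v T) x • outerNormal T.1 F

/-- The average: `(v|_K + v|_{K'}) / 2` on interior faces, `v|_K` on boundary faces. -/
def avg (v : M.Fn) (F : Set (Pt d)) (x : Pt d) : ℝ :=
  ((M.adj F).card : ℝ)⁻¹ * ∑ T ∈ M.adj F, pval (v T) x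

end Mesh

/-- Shape-regularity of a family of partitions: each element contains a ball whose radius is
comparable to the diameter of the element. -/
def ShapeRegular {d : ℕ} {Ω : Set (Pt d)} {ι : Type*} (M : ι → Mesh d Ω) : Prop :=
  ∃ ρ : ℝ, 0 < ρ ∧ ∀ i, ∀ T ∈ (M i).cells, ∃ x, Metric.closedBall x (ρ * Metric.diam T) ⊆ T

/-! ### The boundary value problem -/

/-- The data of the diffusion-convection-reaction problem
`-∇·(K∇u - c u) + r u = f` with mixed boundary conditions on `Γ₁, Γ₂, Γ₃`.
`dc j` stands for the weak derivative `∂_j c_j`. -/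
structure Problem (d : ℕ) where
  Ω : Set (Pt d)
  Γ₁ : Set (Pt d)
  Γ₂ : Set (Pt d)
  Γ₃ : Set (Pt d)
  K : Pt d → (Pt d →L[ℝ] Pt d)
  c : Pt d → Pt d
  dc : Fin d → Pt d → ℝ
  r : Pt d → ℝ
  f : Pt d → ℝ
  α : Pt d → ℝ
  g₁ : Pt d → ℝ
  g₂ : Pt d → ℝ
  g₃ : Pt d → ℝ

/-- `g` is the weak partial derivative `∂_j f` on the open set `Ω`. -/
def IsWeakPartialDeriv {d : ℕ} (Ω : Set (Pt d)) (j : Fin d) (f g : Pt d → ℝ) : Prop :=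
  ∀ φ : Pt d → ℝ, ContDiff ℝ ∞ φ → HasCompactSupport φ → tsupport φ ⊆ Ω →
    ∫ x in Ω, f x * fderiv ℝ φ x (EuclideanSpace.single j 1) = - ∫ x in Ω, g x * φ x

namespace Problem

variable {d : ℕ} (P : Problem d)

/-- The divergence of the convection field. -/
def divc (x : Pt d) : ℝ := ∑ j, P.dc j x

/-- `‖K‖_∞`: the essential supremum over `Ω` of the spectral norm of `K(x)`. -/
def normK : ℝ := (eLpNorm P.K ∞ (volume.restrict P.Ω)).toReal

/-- The standing assumptions on the domain, the boundary parts and the data.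
A bounded Lipschitz domain is equal to the interior of its closure. -/
structure Admissible : Prop where
  isOpen : IsOpen P.Ω
  isConnected : IsConnected P.Ω
  isBounded : Bornology.IsBounded P.Ω
  regular : interior (closure P.Ω) = P.Ω
  boundary : P.Γ₁ ∪ P.Γ₂ ∪ P.Γ₃ = frontier P.Ω
  disjoint₁₂ : Disjoint P.Γ₁ P.Γ₂
  disjoint₁₃ : Disjoint P.Γ₁ P.Γ₃
  disjoint₂₃ : Disjoint P.Γ₂ P.Γ₃
  isClosed₃ : IsClosed P.Γ₃
  K_mem : MemLp P.K ∞ (volume.restrict P.Ω)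
  K_symm : ∀ᵐ x ∂(volume.restrict P.Ω), ∀ ξ ζ : Pt d, inner ℝ (P.K x ξ) ζ = inner ℝ ξ (P.K x ζ)
  K_pos : ∃ k₀ : ℝ, 0 < k₀ ∧
    ∀ᵐ x ∂(volume.restrict P.Ω), ∀ ξ : Pt d, k₀ * ‖ξ‖ ^ 2 ≤ inner ℝ ξ (P.K x ξ)
  c_mem : MemLp P.c ∞ (volume.restrict P.Ω)
  dc_mem : ∀ j, MemLp (P.dc j) (3 / 2) (volume.restrict P.Ω)
  dc_weak : ∀ j, IsWeakPartialDeriv P.Ω j (fun x => P.c x j) (P.dc j)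
  r_mem : MemLp P.r ∞ (volume.restrict P.Ω)
  f_mem : MemLp P.f 2 (volume.restrict P.Ω)
  α_mem : MemLp P.α ∞ ((surf d).restrict P.Γ₂)
  g₁_mem : MemLp P.g₁ 2 ((surf d).restrict P.Γ₁)
  g₂_mem : MemLp P.g₂ 2 ((surf d).restrict P.Γ₂)
  g₃_mem : MemLp P.g₃ 2 ((surf d).restrict P.Γ₃)

variable (M : Mesh d P.Ω)

open scoped Classical in
/-- The boundary faces contained (up to a set of surface measure zero) in `Γ`. -/
def facesIn (Γ : Set (Pt d)) : Finset (Set (Pt d)) :=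
  M.bdryFaces.filter fun F => surf d (F \ Γ) = 0

/-- The boundary faces `𝓕₁`. -/
abbrev faces₁ : Finset (Set (Pt d)) := P.facesIn M P.Γ₁
/-- The boundary faces `𝓕₂`. -/
abbrev faces₂ : Finset (Set (Pt d)) := P.facesIn M P.Γ₂
/-- The (Dirichlet) boundary faces `𝓕₃`. -/
abbrev faces₃ : Finset (Set (Pt d)) := P.facesIn M P.Γ₃

open scoped Classical in
/-- The faces `𝓕_{2,1}` making up `Γ_{2,1} = {x ∈ Γ₂ | α = ν·c}`. -/
def faces₂₁ : Finset (Set (Pt d)) :=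
  (P.faces₂ M).filter fun F => ∀ᵐ x ∂((surf d).restrict F), P.α x = inner ℝ (M.normal F) (P.c x)

open scoped Classical in
/-- The faces `𝓕_{2,2}` making up `Γ₂ \ Γ_{2,1}`. -/
def faces₂₂ : Finset (Set (Pt d)) :=
  (P.faces₂ M).filter fun F => ∀ᵐ x ∂((surf d).restrict F), P.α x ≠ inner ℝ (M.normal F) (P.c x)

/-- The partition is compatible with the decomposition of the boundary into `Γ₁, Γ₂, Γ₃` and of
`Γ₂` into `Γ_{2,1}` and its complement. -/
structure BoundaryCompatible : Prop where
  closure₁ : closure P.Γ₁ = ⋃ F ∈ P.faces₁ M, F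
  closure₂ : closure P.Γ₂ = ⋃ F ∈ P.faces₂ M, F
  closure₃ : closure P.Γ₃ = ⋃ F ∈ P.faces₃ M, F
  exhaust : ∀ F ∈ M.bdryFaces, F ∈ P.faces₁ M ∨ F ∈ P.faces₂ M ∨ F ∈ P.faces₃ M
  split₂ : ∀ F ∈ P.faces₂ M, F ∈ P.faces₂₁ M ∨ F ∈ P.faces₂₂ M

/-- The values of `c` on the faces of the partition represent the normal traces of the field `c`
(which has bounded components and a weak divergence): for each element `T`, `c·ν_T` is an
essentially bounded function on each face for which Green's formula on `T` holds. -/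
structure HasNormalTraces : Prop where
  mem : ∀ T ∈ M.cells, ∀ F, IsFacet T F →
    MemLp (fun x => (inner ℝ (outerNormal T F) (P.c x) : ℝ)) ∞ ((surf d).restrict F)
  green : ∀ T : M.cells, ∀ φ : Pt d → ℝ, ContDiff ℝ ∞ φ →
    ∫ x in T.1, (inner ℝ (P.c x) (gradient φ x) + P.divc x * φ x) =
      ∑ F ∈ M.faces with T ∈ M.adj F,
        ∫ x in F, inner ℝ (outerNormal T.1 F) (P.c x) * φ x ∂(surf d)

/-- The sign conditions on the coefficients that make the bilinear form positive semidefinite. -/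
structure SignConditions : Prop where
  reaction : ∀ᵐ x ∂(volume.restrict P.Ω), 0 ≤ P.r x + P.divc x / 2
  on₂₁ : ∀ F ∈ P.faces₂₁ M, ∀ᵐ x ∂((surf d).restrict F), 0 ≤ inner ℝ (M.normal F) (P.c x)
  on₂₂ : ∀ F ∈ P.faces₂₂ M, ∀ᵐ x ∂((surf d).restrict F),
    0 ≤ P.α x - inner ℝ (M.normal F) (P.c x) / 2
  on₁ : ∀ F ∈ P.faces₁ M, ∀ᵐ x ∂((surf d).restrict F), inner ℝ (M.normal F) (P.c x) ≤ 0
  on₃ : ∀ F ∈ P.faces₃ M, ∀ᵐ x ∂((surf d).restrict F), inner ℝ (M.normal F) (P.c x) ≤ 0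

/-- `K` is continuous on each (closed) element: its restriction to the interior of each element
extends continuously to the element. -/
def PiecewiseContinuousK : Prop :=
  ∀ T ∈ M.cells, ∃ g : Pt d → (Pt d →L[ℝ] Pt d), ContinuousOn g T ∧ EqOn P.K g (interior T)

/-- The continuous extension of `K` from the interior of the element `T` to all of `T`. -/
def Kon (T : Set (Pt d)) : Pt d → (Pt d →L[ℝ] Pt d) := extendFrom (interior T) P.K

variable {M}

/-- The average of the diffusive flux `K∇v` on a face. -/
def avgFlux (v : M.Fn) (F : Set (Pt d)) (x : Pt d) : Pt d :=
  ((M.adj F).card : ℝ)⁻¹ • ∑ T ∈ M.adj F, P.Kon T.1 x (pgrad (v T) x)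

open scoped Classical in
/-- The upwind evaluation of `c w`: on an interior face it is `c w|_K` for the element `K` with
`c·ν_K > 0`; on a boundary face it is `c w|_K` if `c·ν_K > 0` and zero otherwise.
(Where `c·ν = 0` on an interior face the chosen value is irrelevant, as only the normal component
of the upwind value enters the method.) -/
def upwind (w : M.Fn) (F : Set (Pt d)) (x : Pt d) : Pt d :=
  ∑ T ∈ M.adj F, if 0 < (inner ℝ (P.c x) (outerNormal T.1 F) : ℝ) then pval (w T) x • P.c x else 0

open scoped Classical in
/-- The bilinear form `a_h` of the interior penalty Galerkin method with symmetrization parameter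
`θ` and penalty parameter `η`; `h_F` is the diameter of `F`. -/
def aForm (θ η : ℝ) (u v : M.Fn) : ℝ :=
  (∑ T : M.cells,
    ((∫ x in T.1, inner ℝ (P.K x (pgrad (u T) x) - pval (u T) x • P.c x) (pgrad (v T) x)) +
      ∫ x in T.1, P.r x * pval (u T) x * pval (v T) x)) +
  (∑ F ∈ M.intFaces ∪ P.faces₃ M,
    (θ * (∫ x in F, inner ℝ (P.avgFlux v F x) (M.jump u F x) ∂(surf d)) -
      ∫ x in F, inner ℝ (P.avgFlux u F x - (η / Metric.diam F) • M.jump u F x)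
        (M.jump v F x) ∂(surf d))) +
  (∑ F ∈ M.intFaces ∪ P.faces₂₁ M,
    ∫ x in F, inner ℝ (P.upwind u F x) (M.jump v F x) ∂(surf d)) +
  ∑ F ∈ P.faces₂₂ M, ∫ x in F, P.α x * M.avg u F x * M.avg v F x ∂(surf d)

/-- The linear form `ℓ_h` of the interior penalty Galerkin method. -/
def lForm (θ η : ℝ) (v : M.Fn) : ℝ :=
  (∑ T : M.cells, ∫ x in T.1, P.f x * pval (v T) x) +
  (∑ F ∈ P.faces₁ M, ∫ x in F, P.g₁ x * M.avg v F x ∂(surf d)) +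
  (∑ F ∈ P.faces₂ M, ∫ x in F, P.g₂ x * M.avg v F x ∂(surf d)) +
  ∑ F ∈ P.faces₃ M,
    (η / Metric.diam F * (∫ x in F, P.g₃ x * M.avg v F x ∂(surf d)) +
      ∫ x in F, inner ℝ (θ • P.avgFlux v F x - M.avg v F x • P.c x)
        (P.g₃ x • M.normal F) ∂(surf d))

open scoped Classical in
/-- The square of the DG energy norm (note `|K^{1/2}ξ|² = ξ·Kξ`). -/
def energySq (η : ℝ) (v : M.Fn) : ℝ :=
  (∑ T : M.cells, ∫ x in T.1, inner ℝ (pgrad (v T) x) (P.K x (pgrad (v T) x))) +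
  (∑ F ∈ M.intFaces ∪ P.faces₃ M,
    η / Metric.diam F * ∫ x in F, ‖M.jump v F x‖ ^ 2 ∂(surf d)) +
  1 / 2 * (∑ T : M.cells, ∫ x in T.1, (2 * P.r x + P.divc x) * pval (v T) x ^ 2) +
  1 / 2 * (∑ F ∈ M.faces \ P.faces₂₂ M,
    ∫ x in F, |inner ℝ (P.c x) (M.normal F)| * ‖M.jump v F x‖ ^ 2 ∂(surf d)) +
  1 / 2 * ∑ F ∈ P.faces₂₂ M,
    ∫ x in F, (2 * P.α x - inner ℝ (M.normal F) (P.c x)) * M.avg v F x ^ 2 ∂(surf d)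

/-- The DG energy norm `‖v‖_{V_h}`. -/
def energyNorm (η : ℝ) (v : M.Fn) : ℝ := Real.sqrt (P.energySq η v)

variable {ι : Type*}

/-- `C` is admissible in the `K`-weighted discrete trace inequality
`h_F^{1/2} ‖K^{1/2}∇v‖_{0,F} ≤ C ‖K^{1/2}∇v‖_{0,T}` for polynomials, uniformly for a family of
partitions. On `F`, the values of `K` are taken from within `T`. -/
def IsWeightedTraceConst (M : ι → Mesh d P.Ω) (κ : PolyKind) (k : ℕ) (C : ℝ) : Prop :=
  ∀ i, ∀ T ∈ (M i).cells, ∀ F, IsFacet T F → ∀ p ∈ κ.space d k,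
    Metric.diam F * ∫ x in F, inner ℝ (pgrad p x) (P.Kon T x (pgrad p x)) ∂(surf d) ≤
      C ^ 2 * ∫ x in T, inner ℝ (pgrad p x) (P.K x (pgrad p x))

/-- The penalty parameter is large enough, relative to a trace constant `C`. -/
def PenaltyCondition (κ : PolyKind) (C θ η : ℝ) : Prop :=
  (1 - θ) ^ 2 * κ.numFaces d * C ^ 2 * P.normK < 4 * η ∨
    (P.Γ₃ = ∅ ∧ (1 - θ) * κ.numFaces d * C ^ 2 * P.normK < 4 * η)

end Problem

/-- `C` is admissible in the discrete trace inequality `h_F^{1/2} ‖v‖_{0,F} ≤ C ‖v‖_{0,T}` for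
polynomials, uniformly for a family of partitions. -/
def IsTraceConst {d : ℕ} {Ω : Set (Pt d)} {ι : Type*} (M : ι → Mesh d Ω) (κ : PolyKind) (k : ℕ)
    (C : ℝ) : Prop :=
  ∀ i, ∀ T ∈ (M i).cells, ∀ F, IsFacet T F → ∀ p ∈ κ.space d k,
    Metric.diam F * ∫ x in F, pval p x ^ 2 ∂(surf d) ≤ C ^ 2 * ∫ x in T, pval p x ^ 2

end IPG

end

/-! The core is an energy identity (`aForm_self`). Green's formula on an element, tested with
`v²/2`, turns the convective volume term into half the divergence term minus half the normal fluxes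
through the faces. Regrouped by faces, these fluxes complete the upwind terms to squares of jumps,
give the weight `|c·ν|/2` on inflow and outflow faces by the sign conditions, and combine with `α`
on the Robin faces. So `a_h(v,v)` is the squared energy norm minus `1 - θ` times the sum of the
consistency terms `({K∇v}, [v])_F`; for `θ = 1` nothing is subtracted.

For coercivity, Young's inequality with weight proportional to `δ h_F` and a `K`-weighted trace
inequality with squared constant `D` bound the consistency sum by `δ/2 · W N` times the diffusive
energy plus `‖K‖ D / (2δ)` times the sum of `h_F⁻¹ ‖[v]‖²` (`consistency_le`). Here `N` counts the
faces of an element and `W` bounds the averaging weight, which is `1/2` on interior faces and `1` on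
Dirichlet faces; this is the origin of the two penalty conditions. A suitable `δ` exists once
`(1-θ)² W N D ‖K‖ < 4η` (`exists_young_parameters`).

The trace inequality comes from the segments joining the centre of an inscribed ball to the points
of a face: a one-dimensional inverse inequality on each segment is integrated over the cone they
fill (`lintegral_cone_le`, `exists_trace_bound`). For a constant weight one diagonalises the matrix;
a variable `K` is compared with a constant one. On small elements the frozen value of `K` costs only
a factor close to one, absorbed by the strictness of the penalty condition. The oscillation is
controlled uniformly in the family through the finitely many elements of one reference partition
(`exists_oscillation_bound`).

Boundedness is a finite-dimensional statement once the energy is known to be definite. Zero energy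
makes `v` constant on each element and continuous across interior faces, so it remains to know that
elements of a connected domain are linked through faces (`cells_connected`). That proof follows a
generic segment which misses the codimension-two skeletons of all elements. The same genericity
(`exists_skeleton`) shows that at most two elements share a face, with opposite normals. -/

noncomputable section

namespace IPG

/-! ### Comparison of forms on finite-dimensional spaces -/

/-- A positive definite form on a finite-dimensional space is bounded below on coordinates. -/
theorem exists_coord_bound {V : Type*} [AddCommGroup V] [Module ℝ V] [FiniteDimensional ℝ V]
    (b : V →ₗ[ℝ] V →ₗ[ℝ] ℝ) (hb : ∀ v, v ≠ 0 → 0 < b v v) :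
    ∃ (φ : V ≃ₗ[ℝ] EuclideanSpace ℝ (Fin (Module.finrank ℝ V))) (A : ℝ), 0 < A ∧
      ∀ v, ‖φ v‖ ≤ A * Real.sqrt (b v v) := by
  obtain ⟨φ⟩ : Nonempty (V ≃ₗ[ℝ] EuclideanSpace ℝ (Fin (Module.finrank ℝ V))) :=
    FiniteDimensional.nonempty_linearEquiv_of_finrank_eq (by simp)
  let E := EuclideanSpace ℝ (Fin (Module.finrank ℝ V))
  let b' : E →ₗ[ℝ] E →ₗ[ℝ] ℝ := b.compl₁₂ φ.symm.toLinearMap φ.symm.toLinearMap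
  have hb' : ∀ x y, b' x y = b (φ.symm x) (φ.symm y) := fun x y => rfl
  have hcont : Continuous fun x : E => b' x x := by
    have : (fun x : E => b' x x) = fun x : E => b'.toContinuousBilinearMap x x := rfl
    rw [this]
    fun_prop
  have hpos : ∀ x : E, x ≠ 0 → 0 < b' x x := fun x hx => by
    rw [hb']
    exact hb _ (by simpa using hx)
  -- `c` is the minimum of the form on the compact unit sphere; the sphere is empty in dimension
  -- zero, where any `c` serves. Homogeneity then gives `A = 1/√c`.
  obtain ⟨c, hc, hcb⟩ : ∃ c : ℝ, 0 < c ∧ ∀ x : E, ‖x‖ = 1 → c ≤ b' x x := by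
    by_cases hne : (Metric.sphere (0 : E) 1).Nonempty
    · obtain ⟨x, hx, hmin⟩ := (isCompact_sphere (0 : E) 1).exists_isMinOn hne hcont.continuousOn
      refine ⟨b' x x, hpos x ?_, fun y hy => hmin (by simpa using hy)⟩
      rintro rfl
      simp at hx
    · refine ⟨1, one_pos, fun x hx => ?_⟩
      exact absurd ⟨x, by simpa using hx⟩ hne
  refine ⟨φ, (Real.sqrt c)⁻¹, by positivity, fun v => ?_⟩
  rw [← div_eq_inv_mul, le_div_iff₀ (by positivity)]
  apply Real.le_sqrt_of_sq_le
  rw [mul_pow, Real.sq_sqrt hc.le]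
  by_cases hv : φ v = 0
  · have : v = 0 := by simpa using hv
    simp [this]
  · have hn : ‖φ v‖ ≠ 0 := by simpa using hv
    have h1 := hcb (‖φ v‖⁻¹ • φ v) (by rw [norm_smul, norm_inv, norm_norm, inv_mul_cancel₀ hn])
    rw [hb'] at h1
    simp only [map_smul, LinearEquiv.symm_apply_apply, LinearMap.smul_apply, smul_eq_mul] at h1
    calc ‖φ v‖ ^ 2 * c ≤ ‖φ v‖ ^ 2 * (‖φ v‖⁻¹ * (‖φ v‖⁻¹ * b v v)) := by gcongr
      _ = b v v := by field_simp

/-- In finite dimension every linear form is continuous, and the coordinate norm is controlled by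
`√(b v v)`. Used for the one-dimensional inverse inequality and for the boundedness of `ℓ_h`. -/
theorem exists_linear_bound {V : Type*} [AddCommGroup V] [Module ℝ V] [FiniteDimensional ℝ V]
    (b : V →ₗ[ℝ] V →ₗ[ℝ] ℝ) (hb : ∀ v, v ≠ 0 → 0 < b v v) (l : V →ₗ[ℝ] ℝ) :
    ∃ L : ℝ, ∀ v, |l v| ≤ L * Real.sqrt (b v v) := by
  obtain ⟨φ, A, hA, h⟩ := exists_coord_bound b hb
  let l' := LinearMap.toContinuousLinearMap (l ∘ₗ φ.symm.toLinearMap)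
  refine ⟨‖l'‖ * A, fun v => ?_⟩
  have h1 := l'.le_opNorm (φ v)
  have h2 : l' (φ v) = l v := by simp [l']
  rw [h2, Real.norm_eq_abs] at h1
  refine h1.trans ?_
  rw [mul_assoc]
  gcongr
  exact h v

theorem exists_bilinear_bound {V : Type*} [AddCommGroup V] [Module ℝ V] [FiniteDimensional ℝ V]
    (b : V →ₗ[ℝ] V →ₗ[ℝ] ℝ) (hb : ∀ v, v ≠ 0 → 0 < b v v) (l : V →ₗ[ℝ] V →ₗ[ℝ] ℝ) :
    ∃ L : ℝ, ∀ u v, |l u v| ≤ L * Real.sqrt (b u u) * Real.sqrt (b v v) := by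
  obtain ⟨φ, A, hA, h⟩ := exists_coord_bound b hb
  let l' := (l.compl₁₂ φ.symm.toLinearMap φ.symm.toLinearMap).toContinuousBilinearMap
  refine ⟨‖l'‖ * A * A, fun u v => ?_⟩
  have h1 := l'.le_opNorm₂ (φ u) (φ v)
  have h2 : l' (φ u) (φ v) = l u v := by simp [l']
  rw [h2, Real.norm_eq_abs] at h1
  refine h1.trans ?_
  calc ‖l'‖ * ‖φ u‖ * ‖φ v‖ ≤ ‖l'‖ * (A * Real.sqrt (b u u)) * (A * Real.sqrt (b v v)) := by
        gcongr
        · exact h u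
        · exact h v
    _ = _ := by ring

/-! ### A one-dimensional inverse inequality -/

/-- Evaluation at `1` is a linear form on a finite-dimensional space on which the weighted `L²` form
is positive definite. The weight `t ^ j` is the Jacobian of the cone parametrization in the trace
inequality. -/
theorem exists_eval_one_sq_le (m j : ℕ) : ∃ C : ℝ, 0 < C ∧ ∀ q : Polynomial ℝ, q.natDegree ≤ m →
    q.eval 1 ^ 2 ≤ C * ∫ t in (0 : ℝ)..1, t ^ j * q.eval t ^ 2 := by
  let b : Polynomial.degreeLT ℝ (m + 1) →ₗ[ℝ] Polynomial.degreeLT ℝ (m + 1) →ₗ[ℝ] ℝ :=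
    LinearMap.mk₂ ℝ (fun p q => ∫ t in (0 : ℝ)..1, t ^ j * (p.1.eval t * q.1.eval t))
      (fun p p' q => by
        rw [← intervalIntegral.integral_add
          (Continuous.intervalIntegrable (by fun_prop) _ _)
          (Continuous.intervalIntegrable (by fun_prop) _ _)]
        congr 1; ext t; simp; ring)
      (fun c p q => by
        rw [smul_eq_mul, ← intervalIntegral.integral_const_mul]
        congr 1; ext t; simp; ring)
      (fun p q q' => by
        rw [← intervalIntegral.integral_add
          (Continuous.intervalIntegrable (by fun_prop) _ _)
          (Continuous.intervalIntegrable (by fun_prop) _ _)]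
        congr 1; ext t; simp; ring)
      (fun c p q => by
        rw [smul_eq_mul, ← intervalIntegral.integral_const_mul]
        congr 1; ext t; simp; ring)
  have hb : ∀ q, b q q = ∫ t in (0 : ℝ)..1, t ^ j * q.1.eval t ^ 2 := fun q => by
    simp only [b, LinearMap.mk₂_apply]
    congr 1; ext t; ring
  have hpos : ∀ q, q ≠ 0 → 0 < b q q := by
    intro q hq
    rw [hb]
    apply intervalIntegral.integral_pos one_pos
    · exact Continuous.continuousOn (by fun_prop)
    · intro x hx
      have := hx.1.le
      positivity
    -- If the integrand is nowhere positive, the polynomial vanishes on the infinite set `(0, 1]`.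
    · by_contra! hcon
      apply hq
      apply Subtype.ext
      apply Polynomial.eq_zero_of_infinite_isRoot
      refine (Ioc_infinite (zero_lt_one (α := ℝ))).mono fun x hx => ?_
      have h1 := hcon x ⟨hx.1.le, hx.2⟩
      have h2 : 0 < x ^ j := pow_pos hx.1 j
      have h3 : q.1.eval x ^ 2 ≤ 0 := by
        by_contra! h4
        exact absurd h1 (not_le.2 (mul_pos h2 h4))
      exact pow_eq_zero_iff (two_ne_zero) |>.1 (le_antisymm h3 (sq_nonneg _))
  obtain ⟨L, hL⟩ := exists_linear_bound b hpos
    ((Polynomial.leval (1 : ℝ)) ∘ₗ (Polynomial.degreeLT ℝ (m + 1)).subtype)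
  -- The summand `1` only makes the constant positive.
  refine ⟨L ^ 2 + 1, by positivity, fun q hq => ?_⟩
  have hmem : q ∈ Polynomial.degreeLT ℝ (m + 1) := by
    rw [Polynomial.mem_degreeLT]
    exact Polynomial.degree_le_natDegree.trans_lt (by exact_mod_cast Nat.lt_succ_of_le hq)
  have h := hL ⟨q, hmem⟩
  rw [hb] at h
  simp only [LinearMap.comp_apply, Submodule.subtype_apply, Polynomial.leval_apply] at h
  have hI : 0 ≤ ∫ t in (0 : ℝ)..1, t ^ j * q.eval t ^ 2 :=
    intervalIntegral.integral_nonneg zero_le_one fun t ht => by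
      have := ht.1
      positivity
  calc q.eval 1 ^ 2 = |q.eval 1| ^ 2 := (sq_abs _).symm
    _ ≤ (L * Real.sqrt (∫ t in (0 : ℝ)..1, t ^ j * q.eval t ^ 2)) ^ 2 := by gcongr
    _ = L ^ 2 * ∫ t in (0 : ℝ)..1, t ^ j * q.eval t ^ 2 := by rw [mul_pow, Real.sq_sqrt hI]
    _ ≤ _ := by gcongr; simp

/-! ### Polynomials -/

section Polynomials

variable {d : ℕ}

@[fun_prop]
theorem contDiff_pval (p : MvPolynomial (Fin d) ℝ) {n : WithTop ℕ∞} :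
    ContDiff ℝ n (pval p) := by
  unfold pval
  induction p using MvPolynomial.induction_on with
  | C a => simpa using contDiff_const
  | add p q hp hq => simpa using hp.add hq
  | mul_X p i hp => simpa using hp.mul (by fun_prop)

@[fun_prop]
theorem continuous_pval (p : MvPolynomial (Fin d) ℝ) : Continuous (pval p) :=
  (contDiff_pval p (n := 0)).continuous

theorem pgrad_apply (p : MvPolynomial (Fin d) ℝ) (x : Pt d) (i : Fin d) :
    pgrad p x i = pval (MvPolynomial.pderiv i p) x := rfl

@[fun_prop]
theorem continuous_pgrad (p : MvPolynomial (Fin d) ℝ) : Continuous (pgrad p) := by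
  unfold pgrad
  apply (PiLp.continuous_toLp 2 _).comp
  exact continuous_pi fun i => continuous_pval (MvPolynomial.pderiv i p)

@[simp] theorem pval_add (p q : MvPolynomial (Fin d) ℝ) (x : Pt d) :
    pval (p + q) x = pval p x + pval q x := by simp [pval]

@[simp] theorem pval_smul (a : ℝ) (p : MvPolynomial (Fin d) ℝ) (x : Pt d) :
    pval (a • p) x = a * pval p x := by simp [pval, MvPolynomial.smul_eval]

@[simp] theorem pval_sum {ι : Type*} (s : Finset ι) (p : ι → MvPolynomial (Fin d) ℝ) (x : Pt d) :
    pval (∑ i ∈ s, p i) x = ∑ i ∈ s, pval (p i) x := by simp [pval]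

@[simp] theorem pval_C (a : ℝ) (x : Pt d) : pval (MvPolynomial.C a) x = a := by simp [pval]

@[simp] theorem pgrad_add (p q : MvPolynomial (Fin d) ℝ) (x : Pt d) :
    pgrad (p + q) x = pgrad p x + pgrad q x := by
  ext i; simp [pgrad]

@[simp] theorem pgrad_smul (a : ℝ) (p : MvPolynomial (Fin d) ℝ) (x : Pt d) :
    pgrad (a • p) x = a • pgrad p x := by
  ext i; simp [pgrad]

theorem hasGradientAt_pval (p : MvPolynomial (Fin d) ℝ) (x : Pt d) :
    HasGradientAt (pval p) (pgrad p x) x := by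
  rw [hasGradientAt_iff_hasFDerivAt]
  induction p using MvPolynomial.induction_on with
  | C a =>
    have h1 : pval (MvPolynomial.C a : MvPolynomial (Fin d) ℝ) = fun _ => a := by
      ext y; simp
    have h2 : pgrad (MvPolynomial.C a : MvPolynomial (Fin d) ℝ) x = 0 := by
      ext i; simp [pgrad]
    rw [h1, h2, map_zero]
    exact hasFDerivAt_const a x
  | add p q hp hq =>
    have h1 : pval (p + q) = fun y => pval p y + pval q y := by ext y; simp
    rw [h1, pgrad_add, map_add]
    exact hp.add hq
  | mul_X p i hp =>
    have h1 : pval (p * MvPolynomial.X i) = fun y => pval p y * y i := by ext y; simp [pval]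
    rw [h1]
    have hx : HasFDerivAt (fun y : Pt d => y i) (EuclideanSpace.proj (𝕜 := ℝ) i : Pt d →L[ℝ] ℝ) x :=
      (EuclideanSpace.proj (𝕜 := ℝ) i : Pt d →L[ℝ] ℝ).hasFDerivAt
    refine (hp.mul hx).congr_fderiv ?_
    ext j
    simp [pgrad, pval, MvPolynomial.pderiv_X, PiLp.inner_apply]
    rw [Finset.mul_sum]
    simp only [mul_add, Finset.sum_add_distrib]
    congr 1
    · rw [Finset.sum_eq_single i]
      · simp [mul_comm]
      · intro b _ hb
        simp [hb.symm]
      · simp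
    · exact Finset.sum_congr rfl fun b _ => by ring

/-- The function `p²/2` is the test function in Green's formula: its gradient reproduces the
convective term `c p · ∇p`. -/
theorem gradient_half_sq (p : MvPolynomial (Fin d) ℝ) (x : Pt d) :
    gradient (fun y => pval p y ^ 2 / 2) x = pval p x • pgrad p x := by
  apply HasGradientAt.gradient
  have h := (hasGradientAt_iff_hasFDerivAt.1 (hasGradientAt_pval p x)).pow 2
  rw [hasGradientAt_iff_hasFDerivAt]
  have h' := (h.mul_const (1 / 2 : ℝ)).congr_fderiv
    (g' := InnerProductSpace.toDual ℝ (Pt d) (pval p x • pgrad p x)) (by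
      ext j
      simp
      ring)
  simpa [div_eq_mul_inv] using h'

/-- A monomial `m` of `∂ᵢp` comes from the monomial `m + eᵢ` of `p`, which is at least as large in
every exponent. Consequently the trace inequality for values also applies to components of
gradients. -/
theorem pderiv_mem_space {κ : PolyKind} {k : ℕ} {p : MvPolynomial (Fin d) ℝ}
    (hp : p ∈ κ.space d k) (i : Fin d) : MvPolynomial.pderiv i p ∈ κ.space d k := by
  have key : ∀ m ∈ (MvPolynomial.pderiv i p).support, m + Finsupp.single i 1 ∈ p.support := by
    intro m hm
    rw [MvPolynomial.mem_support_iff] at hm ⊢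
    rw [MvPolynomial.coeff_pderiv] at hm
    exact left_ne_zero_of_mul hm
  cases κ with
  | P =>
    simp only [PolyKind.space, MvPolynomial.mem_restrictTotalDegree] at hp ⊢
    refine Finset.sup_le fun m hm => ?_
    refine le_trans ?_ ((MvPolynomial.le_totalDegree (key m hm)).trans hp)
    rw [Finsupp.sum_fintype _ _ (by simp), Finsupp.sum_fintype _ _ (by simp)]
    exact Finset.sum_le_sum fun j _ => by simp
  | Q =>
    simp only [PolyKind.space, MvPolynomial.mem_restrictDegree] at hp ⊢
    intro m hm j
    refine le_trans ?_ (hp _ (key m hm) j)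
    simp

theorem totalDegree_le_of_mem_space {κ : PolyKind} {k : ℕ} {p : MvPolynomial (Fin d) ℝ}
    (hp : p ∈ κ.space d k) : p.totalDegree ≤ (d + 1) * k := by
  cases κ with
  | P =>
    simp only [PolyKind.space, MvPolynomial.mem_restrictTotalDegree] at hp
    nlinarith
  | Q =>
    simp only [PolyKind.space, MvPolynomial.mem_restrictDegree] at hp
    rw [MvPolynomial.totalDegree]
    apply Finset.sup_le
    intro m hm
    rw [Finsupp.sum_fintype _ _ (by simp)]
    calc ∑ i, m i ≤ ∑ _i : Fin d, k := Finset.sum_le_sum fun i _ => hp m hm i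
      _ ≤ _ := by simp; nlinarith

/-- The restriction of a polynomial to the line `t ↦ x + t (y - x)`. -/
theorem exists_line_restriction {κ : PolyKind} {k : ℕ} {p : MvPolynomial (Fin d) ℝ}
    (hp : p ∈ κ.space d k) (x y : Pt d) :
    ∃ q : Polynomial ℝ, q.natDegree ≤ (d + 1) * k ∧ ∀ t, q.eval t = pval p (x + t • (y - x)) := by
  refine ⟨MvPolynomial.aeval (fun i => Polynomial.C (y i - x i) * Polynomial.X +
    Polynomial.C (x i)) p, ?_, fun t => ?_⟩
  · simpa using MvPolynomial.aeval_natDegree_le p (totalDegree_le_of_mem_space hp)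
      (fun i => Polynomial.C (y i - x i) * Polynomial.X + Polynomial.C (x i)) (n := 1)
      (fun i => Polynomial.natDegree_linear_le)
  · rw [← Polynomial.coe_aeval_eq_eval]
    refine (DFunLike.congr_fun (MvPolynomial.comp_aeval (R := ℝ) (fun i =>
      Polynomial.C (y i - x i) * Polynomial.X + Polynomial.C (x i)) (Polynomial.aeval t)) p).trans ?_
    rw [← RingHom.coe_coe, MvPolynomial.coe_aeval_eq_eval]
    simp only [pval]
    congr 2
    ext i
    simp
    ring

/-- An open set contains a product of intervals, and a polynomial vanishing on a product of infinite
sets is zero. -/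
theorem eq_zero_of_pval_eq_zero {p : MvPolynomial (Fin d) ℝ} {U : Set (Pt d)} (hU : IsOpen U)
    (hne : U.Nonempty) (h : ∀ x ∈ U, pval p x = 0) : p = 0 := by
  obtain ⟨x, hx⟩ := hne
  have hV : IsOpen ((WithLp.toLp 2 : (Fin d → ℝ) → Pt d) ⁻¹' U) :=
    hU.preimage (PiLp.continuous_toLp 2 _)
  obtain ⟨ε, hε, hball⟩ := Metric.isOpen_iff.1 hV (WithLp.ofLp x) (by simpa using hx)
  refine MvPolynomial.funext_set (fun i => Metric.ball (x i) ε) (fun i => ?_) fun y hy => ?_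
  · rw [Real.ball_eq_Ioo]
    exact Ioo_infinite (by linarith)
  · rw [map_zero]
    have : y ∈ Metric.ball (WithLp.ofLp x) ε := by
      rw [ball_pi _ hε]
      exact hy
    exact h _ (hball this)

theorem eq_C_of_pgrad_eq_zero {p : MvPolynomial (Fin d) ℝ} {U : Set (Pt d)} (hU : IsOpen U)
    (hne : U.Nonempty) (h : ∀ x ∈ U, pgrad p x = 0) : ∃ a, p = MvPolynomial.C a := by
  have h0 : ∀ i, MvPolynomial.pderiv i p = 0 := fun i =>
    eq_zero_of_pval_eq_zero hU hne fun x hx => by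
      rw [← pgrad_apply, h x hx]; rfl
  refine ⟨MvPolynomial.coeff 0 p, ?_⟩
  ext m
  by_cases hm : m = 0
  · simp [hm]
  · obtain ⟨i, hi⟩ : ∃ i, m i ≠ 0 := by
      by_contra! hcon
      exact hm (Finsupp.ext hcon)
    have hmi : m - Finsupp.single i 1 + Finsupp.single i 1 = m := by
      apply tsub_add_cancel_of_le
      simpa [Nat.one_le_iff_ne_zero] using hi
    -- The coefficient of `∂ᵢp` at `m - eᵢ` is a nonzero multiple of the coefficient of `p` at `m`.
    have h1 := MvPolynomial.coeff_pderiv (i := i) p (m - Finsupp.single i 1)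
    rw [h0 i, MvPolynomial.coeff_zero, hmi] at h1
    have h2 : (((m - Finsupp.single i 1 : Fin d →₀ ℕ) i : ℕ) : ℝ) + 1 ≠ 0 := by positivity
    have h3 : MvPolynomial.coeff m p = 0 := by
      rcases mul_eq_zero.1 h1.symm with h | h
      · exact h
      · exact absurd h h2
    rw [h3, MvPolynomial.coeff_C, if_neg (Ne.symm hm)]

end Polynomials

/-! ### Hyperplanes -/

section Hyperplanes

variable {m : ℕ}

/-- Cartesian coordinates adapted to a unit vector `n`. -/
theorem exists_normal_coords (n : Pt (m + 1)) (hn : ‖n‖ = 1) :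
    ∃ ψ : Pt m →ₗᵢ[ℝ] Pt (m + 1), (∀ y, inner ℝ n (ψ y) = 0) ∧
      (∀ x, inner ℝ n x = 0 → ∃ y, ψ y = x) ∧
      MeasurePreserving (fun p : ℝ × Pt m => p.1 • n + ψ p.2) (volume.prod volume) volume := by
  have horth : Orthonormal ℝ (({0} : Set (Fin (m + 1))).domRestrict fun _ => n) := by
    refine ⟨fun _ => hn, fun i j hij => ?_⟩
    exact absurd (Subtype.ext ((mem_singleton_iff.1 i.2).trans (mem_singleton_iff.1 j.2).symm)) hij
  obtain ⟨B, hB⟩ := horth.exists_orthonormalBasis_extension_of_card_eq (by simp)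
  have hB0 : B 0 = n := hB 0 rfl
  let L : Pt m →ₗ[ℝ] Pt (m + 1) :=
    { toFun := fun y => WithLp.toLp 2 (Fin.cons 0 (WithLp.ofLp y))
      map_add' := fun x y => by
        ext i; refine Fin.cases ?_ (fun j => ?_) i <;> simp
      map_smul' := fun c y => by
        ext i; refine Fin.cases ?_ (fun j => ?_) i <;> simp }
  let ψ₀ : Pt m →ₗᵢ[ℝ] Pt (m + 1) :=
    { toLinearMap := L
      norm_map' := fun y => by
        simp [L, EuclideanSpace.norm_eq, Fin.sum_univ_succ] }
  let ψ := B.repr.symm.toLinearIsometry.comp ψ₀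
  have hψ : ∀ y, ψ y = B.repr.symm (WithLp.toLp 2 (Fin.cons 0 (WithLp.ofLp y))) := fun y => rfl
  have hn0 : n = B.repr.symm (EuclideanSpace.single 0 1) := by
    rw [← hB0, B.repr_symm_single]
  refine ⟨ψ, fun y => ?_, fun x hx => ?_, ?_⟩
  · rw [hψ, hn0, LinearIsometryEquiv.inner_map_map]
    simp [EuclideanSpace.inner_single_left]
  · refine ⟨WithLp.toLp 2 fun i => B.repr x i.succ, ?_⟩
    rw [hψ, LinearIsometryEquiv.symm_apply_eq]
    ext i
    refine Fin.cases ?_ (fun j => ?_) i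
    · simp [B.repr_apply_apply, hB0, hx]
    · simp
  -- The map is a composition of volume-preserving maps: prepend the first coordinate, pass to the
  -- Euclidean space, apply the isometry sending the standard basis to one whose zeroth vector is
  -- `n`.
  · have h1 : MeasurePreserving (Prod.map id WithLp.ofLp : ℝ × Pt m → ℝ × (Fin m → ℝ))
        (volume.prod volume) (volume.prod volume) :=
      (MeasurePreserving.id _).prod (PiLp.volume_preserving_ofLp (Fin m))
    have h2 := (volume_preserving_piFinSuccAbove (fun _ : Fin (m + 1) => ℝ) 0).symm
    have h3 := PiLp.volume_preserving_toLp (Fin (m + 1))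
    have h4 := B.repr.symm.measurePreserving
    have h := h4.comp (h3.comp (h2.comp h1))
    refine (congrArg (fun f => MeasurePreserving f (volume.prod volume) volume)
      (funext fun p => ?_)).mpr h
    change p.1 • n + ψ p.2 = B.repr.symm (WithLp.toLp 2
      ((MeasurableEquiv.piFinSuccAbove (fun _ : Fin (m + 1) => ℝ) 0).symm (p.1, WithLp.ofLp p.2)))
    rw [hψ, hn0, ← map_smul, ← map_add]
    congr 1
    ext i
    refine Fin.cases ?_ (fun j => ?_) i
    · simp [MeasurableEquiv.piFinSuccAbove]
    · simp [MeasurableEquiv.piFinSuccAbove]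

/-- The isometric parametrization of a hyperplane transports the Lebesgue measure to the surface
measure. -/
theorem restrict_surf_eq_map {n : Pt (m + 1)} (hn : ‖n‖ = 1) {ψ : Pt m →ₗᵢ[ℝ] Pt (m + 1)}
    (h₁ : ∀ y, inner ℝ n (ψ y) = 0) (h₂ : ∀ x, inner ℝ n x = 0 → ∃ y, ψ y = x) (b : ℝ) :
    Measure.map (fun y => b • n + ψ y) volume =
      (surf (m + 1)).restrict {x | inner ℝ n x = b} := by
  have hiso : Isometry fun y => b • n + ψ y := (isometry_add_left (b • n)).comp ψ.isometry
  have hr : Set.range (fun y => b • n + ψ y) = {x | inner ℝ n x = b} := by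
    ext x
    simp only [Set.mem_range, Set.mem_ofPred_eq]
    constructor
    · rintro ⟨y, rfl⟩
      rw [inner_add_right, h₁, inner_smul_right, real_inner_self_eq_norm_sq, hn]
      simp
    · intro hx
      obtain ⟨y, hy⟩ := h₂ (x - b • n) (by
        rw [inner_sub_right, inner_smul_right, real_inner_self_eq_norm_sq, hn, hx]; simp)
      exact ⟨y, by rw [hy]; abel⟩
  have h := hiso.map_euclideanHausdorffMeasure (d := m)
  rw [EuclideanSpace.euclideanHausdorffMeasure_eq_volume, hr] at h
  exact h

end Hyperplanes

/-! ### Polytopes -/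

section Polytopes

variable {d : ℕ} {T F : Set (Pt d)} {n : Pt d}

theorem IsPolytope.isCompact (hT : IsPolytope T) : IsCompact T := by
  obtain ⟨⟨s, rfl⟩, -⟩ := hT
  exact s.finite_toSet.isCompact_convexHull (𝕜 := ℝ)

theorem IsPolytope.convex (hT : IsPolytope T) : Convex ℝ T := by
  obtain ⟨⟨s, rfl⟩, -⟩ := hT
  exact convex_convexHull ℝ _

theorem IsPolytope.isClosed (hT : IsPolytope T) : IsClosed T := hT.isCompact.isClosed

theorem IsPolytope.closure_interior (hT : IsPolytope T) : closure (interior T) = T := by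
  rw [hT.convex.closure_interior_eq_closure_of_nonempty_interior hT.2, hT.isClosed.closure_eq]

theorem IsPolytope.interior_ae_eq (hT : IsPolytope T) :
    (interior T : Set (Pt d)) =ᵐ[volume] T :=
  interior_ae_eq_of_null_frontier (hT.convex.addHaar_frontier volume)

theorem IsOuterNormal.subset (h : IsOuterNormal T F n) : F ⊆ T := by
  rw [h.2]; exact fun x hx => hx.1

theorem IsOuterNormal.inner_le (h : IsOuterNormal T F n) {x y : Pt d} (hx : x ∈ F) (hy : y ∈ T) :
    inner ℝ n y ≤ inner ℝ n x := by
  rw [h.2] at hx; exact hx.2 y hy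

theorem IsOuterNormal.inner_eq (h : IsOuterNormal T F n) {x y : Pt d} (hx : x ∈ F) (hy : y ∈ F) :
    (inner ℝ n x : ℝ) = inner ℝ n y :=
  le_antisymm (h.inner_le hy (h.subset hx)) (h.inner_le hx (h.subset hy))

theorem IsOuterNormal.mem_iff (h : IsOuterNormal T F n) {x y : Pt d} (hx : x ∈ F) :
    y ∈ F ↔ y ∈ T ∧ (inner ℝ n y : ℝ) = inner ℝ n x := by
  refine ⟨fun hy => ⟨h.subset hy, h.inner_eq hy hx⟩, fun hy => ?_⟩
  rw [h.2]
  exact ⟨hy.1, fun z hz => by rw [hy.2]; exact h.inner_le hx hz⟩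

theorem isOuterNormal_outerNormal (hF : IsFacet T F) : IsOuterNormal T F (outerNormal T F) := by
  rw [outerNormal, dif_pos hF.1]
  exact hF.1.choose_spec

theorem norm_outerNormal (hF : IsFacet T F) : ‖outerNormal T F‖ = 1 :=
  (isOuterNormal_outerNormal hF).1

theorem IsFacet.subset (hF : IsFacet T F) : F ⊆ T := (isOuterNormal_outerNormal hF).subset

theorem IsFacet.nontrivial (hd : 2 ≤ d) (hF : IsFacet T F) : F.Nontrivial := by
  rw [← Set.not_subsingleton_iff]
  intro hs
  have h := hF.2
  rw [vectorSpan_of_subsingleton ℝ hs, finrank_bot] at h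
  omega

theorem IsFacet.nonempty (hd : 2 ≤ d) (hF : IsFacet T F) : F.Nonempty := (hF.nontrivial hd).nonempty

theorem IsFacet.isClosed (hd : 2 ≤ d) (hT : IsPolytope T) (hF : IsFacet T F) : IsClosed F := by
  obtain ⟨x, hx⟩ := hF.nonempty hd
  have h : F = T ∩ {y | (inner ℝ (outerNormal T F) y : ℝ) = inner ℝ (outerNormal T F) x} := by
    ext y
    exact (isOuterNormal_outerNormal hF).mem_iff hx
  rw [h]
  exact hT.isClosed.inter (isClosed_eq (by fun_prop) (by fun_prop))

theorem IsFacet.isCompact (hd : 2 ≤ d) (hT : IsPolytope T) (hF : IsFacet T F) : IsCompact F :=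
  hT.isCompact.of_isClosed_subset (hF.isClosed hd hT) hF.subset

theorem IsFacet.convex (hd : 2 ≤ d) (hT : IsPolytope T) (hF : IsFacet T F) : Convex ℝ F := by
  obtain ⟨x, hx⟩ := hF.nonempty hd
  have h : F = T ∩ {y | (inner ℝ (outerNormal T F) y : ℝ) = inner ℝ (outerNormal T F) x} := by
    ext y
    exact (isOuterNormal_outerNormal hF).mem_iff hx
  rw [h]
  refine hT.convex.inter ?_
  exact convex_hyperplane (innerSL ℝ (outerNormal T F)).toLinearMap.isLinear _

theorem IsFacet.diam_pos (hd : 2 ≤ d) (hT : IsPolytope T) (hF : IsFacet T F) :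
    0 < Metric.diam F :=
  Metric.diam_pos (hF.nontrivial hd) (hF.isCompact hd hT).isBounded

theorem IsFacet.diam_le (hT : IsPolytope T) (hF : IsFacet T F) :
    Metric.diam F ≤ Metric.diam T := Metric.diam_mono hF.subset hT.isCompact.isBounded

/-- From an interior point one can still move a little in the direction `n`, which strictly
increases the functional. -/
theorem IsOuterNormal.inner_lt_of_mem_interior (h : IsOuterNormal T F n) {x y : Pt d} (hx : x ∈ F)
    (hy : y ∈ interior T) : (inner ℝ n y : ℝ) < inner ℝ n x := by
  have hc : ContinuousAt (fun t : ℝ => y + t • n) 0 := by fun_prop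
  have hev : ∀ᶠ t : ℝ in nhds 0, y + t • n ∈ T := by
    apply hc.eventually
    simpa using mem_interior_iff_mem_nhds.1 hy
  obtain ⟨ε, hε, hball⟩ := Metric.eventually_nhds_iff.1 hev
  have hmem := hball (y := ε / 2) (by
    rw [Real.dist_eq, sub_zero, abs_of_pos (by positivity)]; linarith)
  have h1 := h.inner_le hx hmem
  rw [inner_add_right, inner_smul_right, real_inner_self_eq_norm_sq, h.1] at h1
  linarith

/-- A point of an exposed face of the hull of a finite set is a positive combination of affinely
independent generators lying on that face. -/
theorem exists_pos_combination_of_mem_exposed {s : Set (Pt d)}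
    (h : IsOuterNormal (convexHull ℝ s) F n) {q : Pt d} (hq : q ∈ F) :
    ∃ (ι : Type) (_ : Fintype ι) (z : ι → Pt d) (w : ι → ℝ), Set.range z ⊆ s ∩ F ∧
      AffineIndependent ℝ z ∧ (∀ i, 0 < w i) ∧ ∑ i, w i = 1 ∧ ∑ i, w i • z i = q := by
  obtain ⟨ι, hι, z, w, hz, hind, hw, hw1, hq'⟩ :=
    eq_pos_convex_span_of_mem_convexHull (h.subset hq)
  have hzT : ∀ i, z i ∈ convexHull ℝ s := fun i => subset_convexHull ℝ s (hz ⟨i, rfl⟩)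
  have hle : ∀ i ∈ Finset.univ, w i * (inner ℝ n (z i) : ℝ) ≤ w i * inner ℝ n q := fun i _ =>
    mul_le_mul_of_nonneg_left (h.inner_le hq (hzT i)) (hw i).le
  -- `q` maximizes the functional and is a combination with positive weights, so each generator
  -- involved must be a maximizer too.
  have hsum : ∑ i, w i * (inner ℝ n (z i) : ℝ) = ∑ i, w i * inner ℝ n q := by
    rw [← Finset.sum_mul, hw1, one_mul]
    conv_rhs => rw [← hq', inner_sum]
    simp [inner_smul_right]
  have heq := (Finset.sum_eq_sum_iff_of_le hle).1 hsum
  have hF : ∀ i, z i ∈ F := fun i =>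
    (h.mem_iff hq).2 ⟨hzT i, mul_left_cancel₀ (hw i).ne' (heq i (Finset.mem_univ i))⟩
  let e := Fintype.equivFin ι
  refine ⟨Fin (Fintype.card ι), inferInstance, z ∘ e.symm, w ∘ e.symm, ?_, ?_, fun i => hw _, ?_, ?_⟩
  · rintro _ ⟨i, rfl⟩
    exact ⟨hz ⟨_, rfl⟩, hF _⟩
  · exact hind.comp_embedding e.symm.toEmbedding
  · rw [← hw1]; exact e.symm.sum_comp w
  · rw [← hq']; exact e.symm.sum_comp fun i => w i • z i

theorem vectorSpan_le_orthogonal (h : IsOuterNormal T F n) : vectorSpan ℝ F ≤ (ℝ ∙ n)ᗮ := by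
  rw [vectorSpan_def, Submodule.span_le]
  rintro _ ⟨x, hx, y, hy, rfl⟩
  rw [SetLike.mem_coe, Submodule.mem_orthogonal_singleton_iff_inner_right]
  change inner ℝ n (x - y) = 0
  rw [inner_sub_right, h.inner_eq hx hy, sub_self]

theorem finrank_orthogonal_add_one (hn : ‖n‖ = 1) :
    Module.finrank ℝ (ℝ ∙ n)ᗮ + 1 = d := by
  have h := Submodule.finrank_add_finrank_orthogonal (ℝ ∙ n)
  rw [finrank_span_singleton (by rintro rfl; simp at hn), finrank_euclideanSpace_fin] at h
  omega

/-- Near a relatively interior point of a simplex spanning a face, the polytope fills the half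
space below the face. -/
theorem eventually_mem_of_card_le (hT : IsPolytope T) (h : IsOuterNormal T F n) {ι : Type}
    [Fintype ι] {z : ι → Pt d} {w : ι → ℝ} (hz : ∀ i, z i ∈ F) (hind : AffineIndependent ℝ z)
    (hw : ∀ i, 0 < w i) (hw1 : ∑ i, w i = 1) (hcard : d ≤ Fintype.card ι) :
    ∀ᶠ x in nhds (∑ i, w i • z i), (inner ℝ n x : ℝ) ≤ inner ℝ n (∑ i, w i • z i) → x ∈ T := by
  classical
  have : Nonempty ι := by
    by_contra hne
    rw [not_nonempty_iff] at hne
    simp at hw1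
  obtain ⟨i₀⟩ := this
  obtain ⟨v, hv⟩ := hT.2
  have hvlt : ∀ i, (inner ℝ n v : ℝ) < inner ℝ n (z i) := fun i =>
    h.inner_lt_of_mem_interior (hz i) hv
  have hzb : ∀ i, (inner ℝ n (z i) : ℝ) = inner ℝ n (z i₀) := fun i => h.inner_eq (hz i) (hz i₀)
  -- The interior point `v` lies off the hyperplane of the face, so adding it to the `z i` gives an
  -- affine basis of the whole space.
  let z' : Option ι → Pt d := fun o => o.elim v z
  have hspan : affineSpan ℝ (z' '' {x | x ≠ none}) ≤
      AffineSubspace.mk' (z i₀) (ℝ ∙ n)ᗮ := by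
    rw [affineSpan_le]
    rintro _ ⟨o, ho, rfl⟩
    obtain ⟨i, rfl⟩ := Option.ne_none_iff_exists'.1 ho
    rw [SetLike.mem_coe, AffineSubspace.mem_mk', Submodule.mem_orthogonal_singleton_iff_inner_right,
      vsub_eq_sub, inner_sub_right]
    simp [z', hzb i]
  have hind' : AffineIndependent ℝ z' := by
    apply AffineIndependent.affineIndependent_of_notMem_span (i := none)
    · let e : {y : Option ι // y ≠ none} ↪ ι :=
        ⟨fun y => y.1.get (Option.isSome_iff_ne_none.2 y.2), fun x y hxy => by
          exact Subtype.ext (Option.get_inj.1 hxy)⟩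
      refine (congrArg (AffineIndependent ℝ) (funext fun y => ?_)).mpr (hind.comp_embedding e)
      obtain ⟨o, ho⟩ := y
      obtain ⟨i, rfl⟩ := Option.ne_none_iff_exists'.1 ho
      rfl
    · intro hmem
      have h2 := hspan hmem
      rw [AffineSubspace.mem_mk', Submodule.mem_orthogonal_singleton_iff_inner_right,
        vsub_eq_sub, inner_sub_right] at h2
      have := hvlt i₀
      simp only [z', Option.elim] at h2
      linarith
  have htot : affineSpan ℝ (Set.range z') = ⊤ := by
    rw [hind'.affineSpan_eq_top_iff_card_eq_finrank_add_one]
    have h1 := hind'.card_le_finrank_succ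
    have h2 := Submodule.finrank_le (vectorSpan ℝ (Set.range z'))
    rw [finrank_euclideanSpace_fin] at h2 ⊢
    rw [Fintype.card_option] at h1 ⊢
    omega
  let B : AffineBasis (Option ι) ℝ (Pt d) := ⟨z', hind', htot⟩
  have hBs : ∀ i, B (some i) = z i := fun i => rfl
  have hBn : B none = v := rfl
  set q := ∑ i, w i • z i with hq
  have hcoord : ∀ i, B.coord (some i) q = w i := by
    intro i
    have h1 : ∑ o : Option ι, (o.elim 0 w : ℝ) = 1 := by simpa using hw1
    have h2 := B.coord_apply_combination_of_mem (Finset.mem_univ (some i)) h1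
    rw [Finset.affineCombination_eq_linear_combination _ _ _ h1] at h2
    simpa [hBs, hq] using h2
  have hqb : (inner ℝ n q : ℝ) = inner ℝ n (z i₀) := by
    rw [hq, inner_sum]
    simp only [inner_smul_right, hzb, ← Finset.sum_mul, hw1, one_mul]
  -- At `q` the coordinates along the `z i` are the positive `w i`, hence they stay positive nearby.
  -- The remaining coordinate, along `v`, is nonnegative as soon as `x` is not above the hyperplane,
  -- because `v` lies strictly below it.
  have hev : ∀ᶠ x in nhds q, ∀ i, 0 < B.coord (some i) x := by
    rw [Filter.eventually_all]
    intro i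
    have hc : ContinuousAt (B.coord (some i)) q := (continuous_barycentric_coord B _).continuousAt
    exact hc.eventually (lt_mem_nhds (by rw [hcoord]; exact hw i))
  filter_upwards [hev] with x hx hle
  have hx1 := B.sum_coord_apply_eq_one x
  have hx2 := B.linear_combination_coord_eq_self x
  rw [Fintype.sum_option] at hx1 hx2
  have hx3 : (inner ℝ n x : ℝ) = B.coord none x * inner ℝ n v +
      ∑ i, B.coord (some i) x * inner ℝ n (z i₀) := by
    conv_lhs => rw [← hx2]
    rw [inner_add_right, inner_sum]
    simp only [inner_smul_right, hBs, hBn, hzb]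
  rw [← Finset.sum_mul, eq_sub_iff_add_eq'.2 hx1] at hx3
  have hnone : 0 ≤ B.coord none x := by
    have h1 := hvlt i₀
    rw [hqb, hx3] at hle
    by_contra! hneg
    nlinarith
  have hmem := hT.convex.sum_mem (t := Finset.univ) (w := fun o => B.coord o x) (z := B)
    (fun o _ => by
      cases o with
      | none => exact hnone
      | some i => exact (hx i).le)
    (B.sum_coord_apply_eq_one x)
    (fun o _ => by
      cases o with
      | none => exact interior_subset hv
      | some i => exact h.subset (hz i))
  rwa [B.linear_combination_coord_eq_self x] at hmem

/-- Outside of finitely many affine subspaces of codimension two, a point of a polytope is in the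
interior or on a facet, and near a point of a facet the polytope is a half space. -/
theorem IsPolytope.exists_skeleton (hT : IsPolytope T) :
    ∃ 𝒲 : Set (AffineSubspace ℝ (Pt d)), 𝒲.Finite ∧
      (∀ W ∈ 𝒲, Module.finrank ℝ W.direction + 2 ≤ d) ∧
      ∀ q ∈ T, (∀ W ∈ 𝒲, q ∉ W) →
        (q ∈ interior T ∨ ∃ F, IsFacet T F ∧ q ∈ F) ∧
        ∀ F, IsFacet T F → q ∈ F → ∀ᶠ x in nhds q,
          (inner ℝ (outerNormal T F) x : ℝ) ≤ inner ℝ (outerNormal T F) q → x ∈ T := by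
  obtain ⟨s, hs⟩ := hT.1
  -- The exceptional subspaces are the spans of those sets of generators whose span has dimension at
  -- most `d - 2`.
  refine ⟨(fun s' : Set (Pt d) => affineSpan ℝ s') ''
    {s' | s' ⊆ s ∧ Module.finrank ℝ (vectorSpan ℝ s') + 2 ≤ d}, ?_, ?_, ?_⟩
  · exact (s.finite_toSet.finite_subsets.subset fun s' hs' => hs'.1).image _
  · rintro _ ⟨s', hs', rfl⟩
    rw [direction_affineSpan]
    exact hs'.2
  · intro q hq hW
    have hW' : ∀ s' : Set (Pt d), s' ⊆ s → Module.finrank ℝ (vectorSpan ℝ s') + 2 ≤ d →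
        q ∉ affineSpan ℝ s' := fun s' h1 h2 => hW _ ⟨s', ⟨h1, h2⟩, rfl⟩
    have hcomb : ∀ {ι : Type} [Fintype ι] {z : ι → Pt d} {w : ι → ℝ} , ∑ i, w i = 1 →
        ∑ i, w i • z i ∈ affineSpan ℝ (Set.range z) := by
      intro ι _ z w hw1
      rw [← Finset.affineCombination_eq_linear_combination _ _ _ hw1]
      exact affineCombination_mem_affineSpan hw1 z
    constructor
    -- A non-interior point lies on a supporting hyperplane. If the exposed set `G` there is not a
    -- facet, its dimension is at most `d - 2`, and `q` lies in the span of the generators in `G`.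
    · by_contra! hcon
      obtain ⟨f, hf⟩ := geometric_hahn_banach_open_point hT.convex.interior isOpen_interior hcon.1
      have hf' : ∀ y ∈ T, f y ≤ f q := by
        intro y hy
        have : closure (interior T) ⊆ {y | f y ≤ f q} :=
          closure_minimal (fun y hy => (hf y hy).le) (isClosed_le (by fun_prop) (by fun_prop))
        rw [hT.closure_interior] at this
        exact this hy
      set n₀ := (InnerProductSpace.toDual ℝ (Pt d)).symm f with hn₀
      have hfn : ∀ y, f y = inner ℝ n₀ y := fun y => by
        rw [hn₀, InnerProductSpace.toDual_symm_apply]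
      have hne : n₀ ≠ 0 := by
        intro h0
        obtain ⟨y, hy⟩ := hT.2
        have := hf y hy
        rw [hfn, hfn, h0] at this
        simp at this
      have hpos : 0 < ‖n₀‖⁻¹ := by positivity
      set G := {x | x ∈ T ∧ ∀ y ∈ T, (inner ℝ (‖n₀‖⁻¹ • n₀) y : ℝ) ≤ inner ℝ (‖n₀‖⁻¹ • n₀) x}
        with hG
      have hout : IsOuterNormal T G (‖n₀‖⁻¹ • n₀) :=
        ⟨by rw [norm_smul, norm_inv, norm_norm, inv_mul_cancel₀ (by simpa using hne)], rfl⟩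
      have hqG : q ∈ G := ⟨hq, fun y hy => by
        rw [real_inner_smul_left, real_inner_smul_left, ← hfn, ← hfn]
        exact mul_le_mul_of_nonneg_left (hf' y hy) hpos.le⟩
      have hfin : Module.finrank ℝ (vectorSpan ℝ G) + 2 ≤ d := by
        have h1 := Submodule.finrank_mono (vectorSpan_le_orthogonal hout)
        have h2 := finrank_orthogonal_add_one hout.1
        have h3 : Module.finrank ℝ (vectorSpan ℝ G) + 1 ≠ d := fun h =>
          hcon.2 G ⟨⟨_, hout⟩, h⟩ hqG
        omega
      rw [hs] at hout
      obtain ⟨ι, _, z, w, hz, -, -, hw1, hqz⟩ := exists_pos_combination_of_mem_exposed hout hqG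
      refine hW' (Set.range z) (fun x hx => (hz hx).1) ?_ (hqz ▸ hcomb hw1)
      have := Submodule.finrank_mono (vectorSpan_mono ℝ (fun x hx => (hz hx).2 : Set.range z ⊆ G))
      omega
    · intro F hF hqF
      have hout := isOuterNormal_outerNormal hF
      have hout' := hout
      rw [hs] at hout'
      obtain ⟨ι, _, z, w, hz, hind, hw, hw1, hqz⟩ :=
        exists_pos_combination_of_mem_exposed hout' hqF
      -- Fewer than `d` generators would place `q` in an exceptional subspace.
      have hcard : d ≤ Fintype.card ι := by
        by_contra! hlt
        refine hW' (Set.range z) (fun x hx => (hz hx).1) ?_ (hqz ▸ hcomb hw1)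
        obtain ⟨c, hc⟩ : ∃ c, Fintype.card ι = c + 1 := by
          refine Nat.exists_eq_succ_of_ne_zero fun h0 => ?_
          rw [Fintype.card_eq_zero_iff] at h0
          simp at hw1
        rw [hind.finrank_vectorSpan hc]
        omega
      rw [← hqz, ← hs] at *
      exact eventually_mem_of_card_le hT hout (fun i => (hz ⟨i, rfl⟩).2) hind hw hw1 hcard

end Polytopes

/-! ### Surface measure of facets -/

section Facets

variable {d : ℕ} {T F : Set (Pt d)}

/-- An isometric parametrization of a hyperplane containing a facet. -/
theorem surf_apply_eq_volume {m : ℕ} {n : Pt (m + 1)} (hn : ‖n‖ = 1)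
    {ψ : Pt m →ₗᵢ[ℝ] Pt (m + 1)} (h₁ : ∀ y, inner ℝ n (ψ y) = 0)
    (h₂ : ∀ x, inner ℝ n x = 0 → ∃ y, ψ y = x) {b : ℝ} {A : Set (Pt (m + 1))}
    (hA : MeasurableSet A) (hb : ∀ x ∈ A, inner ℝ n x = b) :
    surf (m + 1) A = volume ((fun y => b • n + ψ y) ⁻¹' A) := by
  have hm : Measurable fun y => b • n + ψ y := by fun_prop
  rw [← Measure.map_apply hm hA, restrict_surf_eq_map hn h₁ h₂, Measure.restrict_apply hA,
    inter_eq_self_of_subset_left (show A ⊆ {x | (inner ℝ n x : ℝ) = b} from hb)]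

/-- Reduces statements on the surface measure of a facet to Lebesgue measure on `ℝ^m`; the last
clause provides the slicing by parallel hyperplanes. -/
theorem exists_facet_coords {m : ℕ} {T F : Set (Pt (m + 1))} (hm : 1 ≤ m) (hF : IsFacet T F) :
    ∃ (ψ : Pt m →ₗᵢ[ℝ] Pt (m + 1)) (b : ℝ),
      (∀ y, inner ℝ (outerNormal T F) (ψ y) = 0) ∧
      (∀ x, inner ℝ (outerNormal T F) x = 0 → ∃ y, ψ y = x) ∧
      (∀ x ∈ F, inner ℝ (outerNormal T F) x = b) ∧
      (fun y => b • outerNormal T F + ψ y) '' ((fun y => b • outerNormal T F + ψ y) ⁻¹' F) = F ∧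
      MeasurePreserving (fun p : ℝ × Pt m => p.1 • outerNormal T F + ψ p.2)
        (volume.prod volume) volume := by
  have hn := norm_outerNormal hF
  obtain ⟨ψ, h₁, h₂, h₃⟩ := exists_normal_coords (outerNormal T F) hn
  obtain ⟨x, hx⟩ := hF.nonempty (by omega)
  have hout := isOuterNormal_outerNormal hF
  refine ⟨ψ, inner ℝ (outerNormal T F) x, h₁, h₂, fun y hy => hout.inner_eq hy hx, ?_, h₃⟩
  rw [image_preimage_eq_iff]
  intro y hy
  obtain ⟨z, hz⟩ := h₂ (y - (inner ℝ (outerNormal T F) x : ℝ) • outerNormal T F) (by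
    rw [inner_sub_right, inner_smul_right, real_inner_self_eq_norm_sq, hn, hout.inner_eq hy hx]
    simp)
  refine ⟨z, ?_⟩
  change _ + ψ z = y
  rw [hz]; abel

/-- In hyperplane coordinates the facet is a convex set spanning the whole space, hence one with
nonempty interior. -/
theorem IsFacet.surf_pos (hd : 2 ≤ d) (hT : IsPolytope T) (hF : IsFacet T F) : 0 < surf d F := by
  obtain ⟨m, rfl⟩ : ∃ m, d = m + 1 := ⟨d - 1, by omega⟩
  obtain ⟨ψ, b, h₁, h₂, hb, him, -⟩ := exists_facet_coords (by omega) hF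
  rw [surf_apply_eq_volume (norm_outerNormal hF) h₁ h₂ (hF.isClosed hd hT).measurableSet hb]
  let Ψ : Pt m →ᵃ[ℝ] Pt (m + 1) :=
    ψ.toLinearMap.toAffineMap + AffineMap.const ℝ (Pt m) (b • outerNormal T F)
  have hΨ : ⇑Ψ = fun y => b • outerNormal T F + ψ y := by
    ext1 y
    simp [Ψ, add_comm]
  rw [← hΨ] at him ⊢
  have hlin : Ψ.linear = ψ.toLinearMap := by simp [Ψ]
  set F₀ := Ψ ⁻¹' F with hF₀
  have hconv : Convex ℝ F₀ := (hF.convex hd hT).affine_preimage Ψ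
  have hne : F₀.Nonempty := by
    rw [← image_nonempty (f := Ψ), him]; exact hF.nonempty hd
  have hspan : vectorSpan ℝ F₀ = ⊤ := by
    apply Submodule.eq_top_of_finrank_eq
    have h3 := Ψ.map_vectorSpan (s := F₀)
    rw [him, hlin] at h3
    have h2 := hF.2
    rw [← h3, (Submodule.equivMapOfInjective ψ.toLinearMap ψ.injective _).finrank_eq.symm] at h2
    rw [finrank_euclideanSpace_fin]
    omega
  have hint : (interior F₀).Nonempty := by
    rw [hconv.interior_nonempty_iff_affineSpan_eq_top,
      AffineSubspace.affineSpan_eq_top_iff_vectorSpan_eq_top_of_nonempty _ _ _ hne]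
    exact hspan
  exact (isOpen_interior.measure_pos volume hint).trans_le (measure_mono interior_subset)

theorem IsFacet.surf_lt_top (hd : 2 ≤ d) (hT : IsPolytope T) (hF : IsFacet T F) :
    surf d F < ⊤ := by
  obtain ⟨m, rfl⟩ : ∃ m, d = m + 1 := ⟨d - 1, by omega⟩
  obtain ⟨ψ, b, h₁, h₂, hb, him, -⟩ := exists_facet_coords (by omega) hF
  rw [surf_apply_eq_volume (norm_outerNormal hF) h₁ h₂ (hF.isClosed hd hT).measurableSet hb]
  have hiso : Isometry fun y => b • outerNormal T F + ψ y :=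
    (isometry_add_left (b • outerNormal T F)).comp ψ.isometry
  exact (hiso.isClosedEmbedding.isCompact_preimage (hF.isCompact hd hT)).measure_lt_top

/-- In hyperplane coordinates `W` becomes a proper affine subspace, for otherwise its direction
would contain all `d - 1` directions of the hyperplane. -/
theorem IsFacet.surf_inter_affineSubspace (hd : 2 ≤ d) (hT : IsPolytope T) (hF : IsFacet T F)
    {W : AffineSubspace ℝ (Pt d)} (hW : Module.finrank ℝ W.direction + 2 ≤ d) :
    surf d (F ∩ W) = 0 := by
  obtain ⟨m, rfl⟩ : ∃ m, d = m + 1 := ⟨d - 1, by omega⟩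
  obtain ⟨ψ, b, h₁, h₂, hb, him, -⟩ := exists_facet_coords (by omega) hF
  have hWc : IsClosed (W : Set (Pt (m + 1))) := W.closed_of_finiteDimensional
  rw [surf_apply_eq_volume (norm_outerNormal hF) h₁ h₂
    ((hF.isClosed hd hT).inter hWc).measurableSet fun x hx => hb x hx.1]
  let Ψ : Pt m →ᵃ[ℝ] Pt (m + 1) :=
    ψ.toLinearMap.toAffineMap + AffineMap.const ℝ (Pt m) (b • outerNormal T F)
  have hΨ : ⇑Ψ = fun y => b • outerNormal T F + ψ y := by
    ext1 y
    simp [Ψ, add_comm]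
  have hlin : Ψ.linear = ψ.toLinearMap := by simp [Ψ]
  rw [← hΨ]
  refine measure_mono_null (t := (W.comap Ψ : Set (Pt m))) (fun y hy => hy.2)
    (Measure.addHaar_affineSubspace volume _ fun htop => ?_)
  have hmem : ∀ y, Ψ y ∈ W := fun y => by
    have : y ∈ W.comap Ψ := by rw [htop]; trivial
    exact this
  have hle : LinearMap.range ψ.toLinearMap ≤ W.direction := by
    rintro _ ⟨y, rfl⟩
    have := AffineSubspace.vsub_mem_direction (hmem y) (hmem 0)
    rwa [← AffineMap.linearMap_vsub, hlin, vsub_eq_sub, sub_zero] at this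
  have h3 := Submodule.finrank_mono hle
  rw [LinearMap.finrank_range_of_inj ψ.injective, finrank_euclideanSpace_fin] at h3
  omega

/-- A facet is not covered by finitely many affine subspaces of codimension two. -/
theorem IsFacet.exists_notMem (hd : 2 ≤ d) (hT : IsPolytope T) (hF : IsFacet T F)
    {𝒲 : Set (AffineSubspace ℝ (Pt d))} (hfin : 𝒲.Finite)
    (hW : ∀ W ∈ 𝒲, Module.finrank ℝ W.direction + 2 ≤ d) : ∃ q ∈ F, ∀ W ∈ 𝒲, q ∉ W := by
  by_contra! hcon
  have h0 : surf d (⋃ W ∈ 𝒲, F ∩ W) = 0 :=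
    (measure_biUnion_null_iff hfin.countable).2 fun W h =>
      hF.surf_inter_affineSubspace hd hT (hW W h)
  refine (hF.surf_pos hd hT).ne' (measure_mono_null (fun q hq => ?_) h0)
  obtain ⟨W, hW, hq'⟩ := hcon q hq
  simp only [mem_iUnion]
  exact ⟨W, hW, hq, hq'⟩

theorem IsFacet.integrableOn {E : Type*} [NormedAddCommGroup E] (hd : 2 ≤ d)
    (hT : IsPolytope T) (hF : IsFacet T F) {g : Pt d → E} (hg : ContinuousOn g F) :
    IntegrableOn g F (surf d) := by
  have hc := hF.isCompact hd hT
  obtain ⟨A, hA⟩ := hc.exists_bound_of_continuousOn hg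
  have : IsFiniteMeasure ((surf d).restrict F) :=
    ⟨by rw [Measure.restrict_apply_univ]; exact hF.surf_lt_top hd hT⟩
  exact Integrable.of_bound (hg.aestronglyMeasurable_of_isCompact hc hc.measurableSet) A
    ((ae_restrict_mem hc.measurableSet).mono fun x hx => hA x hx)

end Facets

/-! ### The trace inequality -/

theorem lintegral_eq_mul_lintegral_affine {E : Type*} [NormedAddCommGroup E] [NormedSpace ℝ E]
    [FiniteDimensional ℝ E] [MeasurableSpace E] [BorelSpace E] (μ : Measure E)
    [μ.IsAddHaarMeasure] {f : E → ℝ≥0∞} (hf : Measurable f) (a : E) {r : ℝ} (hr : 0 < r) :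
    ∫⁻ x, f x ∂μ = ENNReal.ofReal (r ^ Module.finrank ℝ E) * ∫⁻ x, f (a + r • x) ∂μ := by
  have h1 : ∫⁻ x, f (a + r • x) ∂μ = ∫⁻ x, f (a + x) ∂(Measure.map (r • ·) μ) :=
    (lintegral_map (hf.comp (measurable_const_add a)) (measurable_const_smul r)).symm
  rw [h1, Measure.map_addHaar_smul μ hr.ne', lintegral_smul_measure, lintegral_add_left_eq_self,
    abs_of_pos (by positivity), smul_eq_mul, ← mul_assoc, ← ENNReal.ofReal_mul (by positivity),
    mul_inv_cancel₀ (by positivity), ENNReal.ofReal_one, one_mul]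

/-- Integration over the cone with apex `x₀` spanned by a facet. -/
theorem lintegral_cone_le {m : ℕ} {T F : Set (Pt (m + 1))} (hm : 1 ≤ m) (hT : IsPolytope T)
    (hF : IsFacet T F) {x₀ : Pt (m + 1)} (hx₀ : x₀ ∈ T) {δ : ℝ} (hδ : 0 < δ)
    (hb : ∀ x ∈ F, inner ℝ (outerNormal T F) x = inner ℝ (outerNormal T F) x₀ + δ)
    {g : Pt (m + 1) → ℝ≥0∞} (hg : Measurable g) :
    ENNReal.ofReal δ * ∫⁻ x in F, (∫⁻ t in Ioc (0 : ℝ) 1,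
      ENNReal.ofReal (t ^ m) * g (x₀ + t • (x - x₀))) ∂(surf (m + 1)) ≤ ∫⁻ x in T, g x := by
  have hn := norm_outerNormal hF
  obtain ⟨ψ, b, h₁, h₂, hb', him, hmp⟩ := exists_facet_coords hm hF
  set n := outerNormal T F
  set s₀ : ℝ := inner ℝ n x₀
  have hbs : b = s₀ + δ := by
    obtain ⟨x, hx⟩ := hF.nonempty (by omega)
    rw [← hb' x hx, hb x hx]
  obtain ⟨y₀, hy₀⟩ := h₂ (x₀ - s₀ • n) (by
    rw [inner_sub_right, inner_smul_right, real_inner_self_eq_norm_sq, hn]; simp [s₀])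
  have hx₀' : x₀ = s₀ • n + ψ y₀ := by rw [hy₀]; abel
  have hTm : MeasurableSet T := hT.isClosed.measurableSet
  have hFm : MeasurableSet F := (hF.isClosed (by omega) hT).measurableSet
  have hgT : Measurable (T.indicator g) := hg.indicator hTm
  have hΨm : Measurable fun y => b • n + ψ y := by fun_prop
  set F₀ := (fun y => b • n + ψ y) ⁻¹' F
  have hF₀ : MeasurableSet F₀ := hΨm hFm
  have hrestr : (surf (m + 1)).restrict F =
      Measure.map (fun y => b • n + ψ y) (volume.restrict F₀) := by
    rw [← Measure.restrict_map hΨm hFm, restrict_surf_eq_map hn h₁ h₂,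
      Measure.restrict_restrict hFm,
      inter_eq_self_of_subset_left (show F ⊆ {x | (inner ℝ n x : ℝ) = b} from hb')]
  have hmG : Measurable fun p : Pt (m + 1) × ℝ =>
      ENNReal.ofReal (p.2 ^ m) * g (x₀ + p.2 • (p.1 - x₀)) := by
    have h3 : Measurable fun p : Pt (m + 1) × ℝ => x₀ + p.2 • (p.1 - x₀) := by fun_prop
    exact (by fun_prop : Measurable fun p : Pt (m + 1) × ℝ => ENNReal.ofReal (p.2 ^ m)).mul
      (hg.comp h3)
  have hlhs : ∫⁻ x in F, (∫⁻ t in Ioc (0 : ℝ) 1,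
      ENNReal.ofReal (t ^ m) * g (x₀ + t • (x - x₀))) ∂(surf (m + 1)) =
      ∫⁻ t in Ioc (0 : ℝ) 1, ∫⁻ z in F₀,
        ENNReal.ofReal (t ^ m) * g (x₀ + t • ((b • n + ψ z) - x₀)) := by
    rw [hrestr, lintegral_map (Measurable.lintegral_prod_right' hmG) hΨm]
    apply lintegral_lintegral_swap
    apply Measurable.aemeasurable
    exact hmG.comp ((hΨm.comp measurable_fst).prodMk measurable_snd)
  have hmprod : Measurable fun p : ℝ × Pt m => T.indicator g (p.1 • n + ψ p.2) :=
    hgT.comp hmp.measurable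
  -- Slicing along the normal at height `s₀ + δ t`: `t = 0` is the level of the apex, `t = 1` that
  -- of the facet.
  have hrhs : ∫⁻ x in T, g x = ENNReal.ofReal δ *
      ∫⁻ t, ∫⁻ y, T.indicator g ((s₀ + δ * t) • n + ψ y) := by
    rw [← lintegral_indicator hTm, ← hmp.lintegral_comp hgT, lintegral_prod _ hmprod.aemeasurable,
      lintegral_eq_mul_lintegral_affine volume (Measurable.lintegral_prod_right' hmprod) s₀ hδ]
    simp
  rw [hlhs, hrhs]
  gcongr ENNReal.ofReal δ * ?_
  refine le_trans (lintegral_mono_ae ?_) (setLIntegral_le_lintegral (Ioc (0 : ℝ) 1) _)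
  filter_upwards [ae_restrict_mem measurableSet_Ioc] with t ht
  have hmt : Measurable fun y => T.indicator g ((s₀ + δ * t) • n + ψ y) :=
    hgT.comp (by fun_prop)
  -- Within the slice at `t` the cone is the facet contracted by `t` towards the apex, with Jacobian
  -- `t ^ m`. By convexity it stays in `T`; the rest of the slice is discarded.
  rw [lintegral_eq_mul_lintegral_affine volume hmt (y₀ - t • y₀) ht.1, finrank_euclideanSpace_fin,
    lintegral_const_mul]
  swap
  · exact hg.comp (by fun_prop)
  gcongr ENNReal.ofReal (t ^ m) * ?_
  refine le_trans (lintegral_mono_ae ?_) (setLIntegral_le_lintegral F₀ _)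
  filter_upwards [ae_restrict_mem hF₀] with z hz
  have heq : x₀ + t • ((b • n + ψ z) - x₀) = (s₀ + δ * t) • n + ψ (y₀ - t • y₀ + t • z) := by
    rw [hbs]
    conv_lhs => rw [hx₀']
    simp only [map_add, map_sub, map_smul]
    module
  have hmem : x₀ + t • ((b • n + ψ z) - x₀) ∈ T :=
    hT.convex.add_smul_sub_mem hx₀ (hF.subset hz) ⟨ht.1.le, ht.2⟩
  rw [← heq, indicator_of_mem hmem]

theorem IsPolytope.integrableOn {d : ℕ} {E : Type*} [NormedAddCommGroup E] {T : Set (Pt d)}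
    (hT : IsPolytope T) {g : Pt d → E} (hg : ContinuousOn g T) : IntegrableOn g T :=
  hg.integrableOn_compact hT.isCompact

/-- The discrete trace inequality on an element containing a ball. -/
theorem exists_trace_bound (d : ℕ) (hd : 2 ≤ d) (κ : PolyKind) (k : ℕ) :
    ∃ C : ℝ, 0 < C ∧ ∀ (T F : Set (Pt d)), IsPolytope T → IsFacet T F →
      ∀ (x₀ : Pt d) (r : ℝ), 0 < r → Metric.closedBall x₀ r ⊆ T → ∀ p ∈ κ.space d k,
        r * ∫ x in F, pval p x ^ 2 ∂(surf d) ≤ C * ∫ x in T, pval p x ^ 2 := by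
  obtain ⟨m, rfl⟩ : ∃ m, d = m + 1 := ⟨d - 1, by omega⟩
  obtain ⟨C, hC, hCq⟩ := exists_eval_one_sq_le ((m + 1 + 1) * k) m
  refine ⟨C, hC, fun T F hT hF x₀ r hr hball p hp => ?_⟩
  have hn := norm_outerNormal hF
  have hout := isOuterNormal_outerNormal hF
  obtain ⟨y, hy⟩ := hF.nonempty hd
  set n := outerNormal T F
  set δ : ℝ := inner ℝ n y - inner ℝ n x₀ with hδ
  -- The point `x₀ + r n` is in the ball, so the facet lies at distance at least `r` from the
  -- centre.
  have hrδ : r ≤ δ := by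
    have h1 := hout.inner_le hy (hball (by
      rw [Metric.mem_closedBall, dist_eq_norm, add_sub_cancel_left, norm_smul, hn, mul_one,
        Real.norm_of_nonneg hr.le] : x₀ + r • n ∈ Metric.closedBall x₀ r))
    rw [inner_add_right, inner_smul_right, real_inner_self_eq_norm_sq, hn] at h1
    rw [hδ]; linarith
  have hx₀ : x₀ ∈ T := hball (Metric.mem_closedBall_self hr.le)
  have hcone := lintegral_cone_le (by omega) hT hF hx₀ (hr.trans_le hrδ)
    (fun x hx => by rw [hout.inner_eq hx hy, hδ]; ring)
    (g := fun x => ENNReal.ofReal (pval p x ^ 2)) (by fun_prop)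
  -- The one-dimensional inequality on the segment from `x₀` to `x`, whose endpoint `t = 1` is `x`.
  have hpt : ∀ x, ENNReal.ofReal (pval p x ^ 2) ≤ ENNReal.ofReal C *
      ∫⁻ t in Ioc (0 : ℝ) 1, ENNReal.ofReal (t ^ m) *
        ENNReal.ofReal (pval p (x₀ + t • (x - x₀)) ^ 2) := by
    intro x
    obtain ⟨q, hq, hqe⟩ := exists_line_restriction hp x₀ x
    have h1 := hCq q hq
    rw [hqe, one_smul, add_sub_cancel, intervalIntegral.integral_of_le zero_le_one] at h1
    have h2 : ∫⁻ t in Ioc (0 : ℝ) 1, ENNReal.ofReal (t ^ m) *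
        ENNReal.ofReal (pval p (x₀ + t • (x - x₀)) ^ 2) =
        ENNReal.ofReal (∫ t in Ioc (0 : ℝ) 1, t ^ m * q.eval t ^ 2) := by
      rw [ofReal_integral_eq_lintegral_ofReal]
      · refine setLIntegral_congr_fun measurableSet_Ioc fun t ht => ?_
        rw [← ENNReal.ofReal_mul (pow_nonneg ht.1.le _), hqe]
      · exact (Continuous.integrableOn_Icc (by fun_prop)).mono_set Ioc_subset_Icc_self
      · filter_upwards [ae_restrict_mem measurableSet_Ioc] with t ht
        exact mul_nonneg (pow_nonneg ht.1.le _) (sq_nonneg _)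
    rw [h2, ← ENNReal.ofReal_mul hC.le]
    exact ENNReal.ofReal_le_ofReal h1
  have hIF : Integrable (fun x => pval p x ^ 2) ((surf (m + 1)).restrict F) :=
    hF.integrableOn hd hT (by fun_prop)
  have hIT : Integrable (fun x => pval p x ^ 2) (volume.restrict T) :=
    hT.integrableOn (by fun_prop)
  have hIF0 : 0 ≤ ∫ x in F, pval p x ^ 2 ∂(surf (m + 1)) :=
    integral_nonneg fun x => sq_nonneg _
  have hIT0 : 0 ≤ ∫ x in T, pval p x ^ 2 := integral_nonneg fun x => sq_nonneg _
  refine (mul_le_mul_of_nonneg_right hrδ hIF0).trans ?_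
  rw [← ENNReal.ofReal_le_ofReal_iff (by positivity), ENNReal.ofReal_mul (hr.le.trans hrδ),
    ENNReal.ofReal_mul hC.le,
    ofReal_integral_eq_lintegral_ofReal hIF (Filter.Eventually.of_forall fun x => sq_nonneg _),
    ofReal_integral_eq_lintegral_ofReal hIT (Filter.Eventually.of_forall fun x => sq_nonneg _)]
  calc ENNReal.ofReal δ * ∫⁻ x in F, ENNReal.ofReal (pval p x ^ 2) ∂(surf (m + 1))
      ≤ ENNReal.ofReal δ * ∫⁻ x in F, ENNReal.ofReal C *
        (∫⁻ t in Ioc (0 : ℝ) 1, ENNReal.ofReal (t ^ m) *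
          ENNReal.ofReal (pval p (x₀ + t • (x - x₀)) ^ 2)) ∂(surf (m + 1)) := by
        gcongr with x
        exact hpt x
    _ = ENNReal.ofReal C * (ENNReal.ofReal δ * ∫⁻ x in F,
        (∫⁻ t in Ioc (0 : ℝ) 1, ENNReal.ofReal (t ^ m) *
          ENNReal.ofReal (pval p (x₀ + t • (x - x₀)) ^ 2)) ∂(surf (m + 1))) := by
        rw [lintegral_const_mul' _ _ ENNReal.ofReal_ne_top]
        ring
    _ ≤ _ := by gcongr

/-- With an inscribed radius `ρ diam T` and `h_F ≤ diam T`, the diameters cancel; what is left is `C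
/ ρ`, independent of the element. -/
theorem exists_isTraceConst {d : ℕ} (hd : 2 ≤ d) {Ω : Set (Pt d)} {ι : Type*} {M : ι → Mesh d Ω}
    (hreg : ShapeRegular M) (κ : PolyKind) (k : ℕ) : ∃ C : ℝ, 0 < C ∧ IsTraceConst M κ k C := by
  obtain ⟨C, hC, hCb⟩ := exists_trace_bound d hd κ k
  obtain ⟨ρ, hρ, hball⟩ := hreg
  refine ⟨Real.sqrt (C / ρ), by positivity, fun i T hTc F hF p hp => ?_⟩
  have hT := (M i).isPolytope T hTc
  obtain ⟨x₀, hx₀⟩ := hball i T hTc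
  have hdF := hF.diam_pos hd hT
  have hdT := hdF.trans_le (hF.diam_le hT)
  have h := hCb T F hT hF x₀ _ (mul_pos hρ hdT) hx₀ p hp
  have hIF0 : 0 ≤ ∫ x in F, pval p x ^ 2 ∂(surf d) := integral_nonneg fun x => sq_nonneg _
  rw [Real.sq_sqrt (by positivity)]
  calc Metric.diam F * ∫ x in F, pval p x ^ 2 ∂(surf d)
      ≤ Metric.diam T * ∫ x in F, pval p x ^ 2 ∂(surf d) := by
        gcongr
        exact hF.diam_le hT
    _ = (ρ * Metric.diam T * ∫ x in F, pval p x ^ 2 ∂(surf d)) / ρ := by field_simp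
    _ ≤ (C * ∫ x in T, pval p x ^ 2) / ρ := by gcongr
    _ = _ := by ring

/-! ### Adjacent elements -/

section Adjacency

variable {d : ℕ} {Ω : Set (Pt d)} {T T' F : Set (Pt d)}

/-- Both normals are unit vectors in the orthogonal complement of the direction space of `F`, which
is a line. -/
theorem outerNormal_eq_or_eq_neg (hF : IsFacet T F) (hF' : IsFacet T' F) :
    outerNormal T' F = outerNormal T F ∨ outerNormal T' F = -outerNormal T F := by
  have key : ∀ {S : Set (Pt d)}, IsFacet S F →
      vectorSpan ℝ F = (ℝ ∙ outerNormal S F)ᗮ := fun h => by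
    apply Submodule.eq_of_le_of_finrank_eq (vectorSpan_le_orthogonal (isOuterNormal_outerNormal h))
    have h1 := h.2
    have h2 := finrank_orthogonal_add_one (norm_outerNormal h)
    omega
  have h1 : (ℝ ∙ outerNormal T' F) = ℝ ∙ outerNormal T F := by
    rw [← Submodule.orthogonal_orthogonal (ℝ ∙ outerNormal T' F), ← key hF', key hF,
      Submodule.orthogonal_orthogonal]
  have h2 : outerNormal T' F ∈ ℝ ∙ outerNormal T F := by
    rw [← h1]; exact Submodule.mem_span_singleton_self _
  obtain ⟨c, hc⟩ := Submodule.mem_span_singleton.1 h2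
  have h3 := norm_outerNormal hF'
  rw [← hc, norm_smul, norm_outerNormal hF, mul_one, Real.norm_eq_abs] at h3
  rcases eq_or_eq_neg_of_abs_eq h3 with h | h
  · left; rw [← hc, h, one_smul]
  · right; rw [← hc, h, neg_one_smul]

/-- Two polytopes on the same side of a common facet overlap. -/
theorem interiors_meet_of_outerNormal_eq (hd : 2 ≤ d) (hT : IsPolytope T) (hT' : IsPolytope T')
    (hF : IsFacet T F) (hF' : IsFacet T' F) (h : outerNormal T' F = outerNormal T F) :
    ¬ Disjoint (interior T) (interior T') := by
  obtain ⟨𝒲, hfin, hdim, hsk⟩ := hT.exists_skeleton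
  obtain ⟨𝒲', hfin', hdim', hsk'⟩ := hT'.exists_skeleton
  obtain ⟨q, hqF, hq⟩ := hF.exists_notMem hd hT (hfin.union hfin')
    (fun W hW => hW.elim (hdim W) (hdim' W))
  have h1 := (hsk q (hF.subset hqF) fun W hW => hq W (Or.inl hW)).2 F hF hqF
  have h2 := (hsk' q (hF'.subset hqF) fun W hW => hq W (Or.inr hW)).2 F hF' hqF
  rw [h] at h2
  set n := outerNormal T F
  obtain ⟨U, hU, hUo, hqU⟩ := eventually_nhds_iff.1 (h1.and h2)
  have hV : IsOpen (U ∩ {x | (inner ℝ n x : ℝ) < inner ℝ n q}) :=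
    hUo.inter (isOpen_lt (by fun_prop) (by fun_prop))
  -- Moving from the generic point `q` slightly against the common normal leads into both interiors.
  have hc : ContinuousAt (fun t : ℝ => q - t • n) 0 := by fun_prop
  have hev : ∀ᶠ t : ℝ in nhds 0, q - t • n ∈ U :=
    hc.eventually (by simpa using hUo.mem_nhds hqU)
  obtain ⟨ε, hε, hball⟩ := Metric.eventually_nhds_iff.1 hev
  have hmem := hball (y := ε / 2) (by
    rw [Real.dist_eq, sub_zero, abs_of_pos (by positivity)]; linarith)
  have hx : q - (ε / 2) • n ∈ U ∩ {x | (inner ℝ n x : ℝ) < inner ℝ n q} := by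
    refine ⟨hmem, ?_⟩
    rw [Set.mem_ofPred_eq, inner_sub_right, inner_smul_right, real_inner_self_eq_norm_sq,
      norm_outerNormal hF]
    linarith
  rw [Set.not_disjoint_iff]
  exact ⟨_, interior_maximal (fun x hx => (hU x hx.1).1 (le_of_lt hx.2)) hV hx,
    interior_maximal (fun x hx => (hU x hx.1).2 (le_of_lt hx.2)) hV hx⟩

/-- A generic point of a facet shared by two polytopes on opposite sides is interior to their
union. -/
theorem eventually_mem_union {q : Pt d}
    (hn : outerNormal T' F = -outerNormal T F)
    (h₁ : ∀ᶠ x in nhds q,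
      (inner ℝ (outerNormal T F) x : ℝ) ≤ inner ℝ (outerNormal T F) q → x ∈ T)
    (h₂ : ∀ᶠ x in nhds q,
      (inner ℝ (outerNormal T' F) x : ℝ) ≤ inner ℝ (outerNormal T' F) q → x ∈ T') :
    ∀ᶠ x in nhds q, x ∈ T ∪ T' := by
  filter_upwards [h₁, h₂] with x hx1 hx2
  rcases le_total (inner ℝ (outerNormal T F) x : ℝ) (inner ℝ (outerNormal T F) q) with h | h
  · exact Or.inl (hx1 h)
  · refine Or.inr (hx2 ?_)
    rw [hn, inner_neg_left, inner_neg_left]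
    exact neg_le_neg h

namespace Mesh

variable (M : Mesh d Ω)

theorem subset_closure {T : Set (Pt d)} (hT : T ∈ M.cells) : T ⊆ closure Ω := by
  rw [M.covers]; exact subset_biUnion_of_mem (u := fun T => T) (Finset.mem_coe.2 hT)

theorem interior_subset_domain (hreg : interior (closure Ω) = Ω) {T : Set (Pt d)}
    (hT : T ∈ M.cells) : interior T ⊆ Ω :=
  (interior_mono (M.subset_closure hT)).trans hreg.subset

theorem mem_adj {F : Set (Pt d)} {T : M.cells} : T ∈ M.adj F ↔ IsFacet T.1 F := by
  simp [adj]

theorem outerNormal_eq_neg (hd : 2 ≤ d) (hT : T ∈ M.cells) (hT' : T' ∈ M.cells) (hne : T ≠ T')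
    (hF : IsFacet T F) (hF' : IsFacet T' F) : outerNormal T' F = -outerNormal T F := by
  rcases outerNormal_eq_or_eq_neg hF hF' with h | h
  · exact absurd (M.disjoint_interiors T hT T' hT' hne)
      (interiors_meet_of_outerNormal_eq hd (M.isPolytope T hT) (M.isPolytope T' hT') hF hF' h)
  · exact h

/-- A generic point of the common facet is interior to `T ∪ T' ⊆ closure Ω`, hence belongs to `Ω`
itself. The regularity of `Ω` is what excludes slits along faces. -/
theorem not_subset_frontier (hd : 2 ≤ d) (hreg : interior (closure Ω) = Ω) (hT : T ∈ M.cells)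
    (hT' : T' ∈ M.cells) (hne : T ≠ T') (hF : IsFacet T F) (hF' : IsFacet T' F) :
    ¬ F ⊆ frontier Ω := by
  intro hsub
  have hTp := M.isPolytope T hT
  have hTp' := M.isPolytope T' hT'
  obtain ⟨𝒲, hfin, hdim, hsk⟩ := hTp.exists_skeleton
  obtain ⟨𝒲', hfin', hdim', hsk'⟩ := hTp'.exists_skeleton
  obtain ⟨q, hqF, hq⟩ := hF.exists_notMem hd hTp (hfin.union hfin')
    (fun W hW => hW.elim (hdim W) (hdim' W))
  have h1 := (hsk q (hF.subset hqF) fun W hW => hq W (Or.inl hW)).2 F hF hqF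
  have h2 := (hsk' q (hF'.subset hqF) fun W hW => hq W (Or.inr hW)).2 F hF' hqF
  have h3 := eventually_mem_union (M.outerNormal_eq_neg hd hT hT' hne hF hF') h1 h2
  have h4 : q ∈ interior (closure Ω) := by
    rw [mem_interior_iff_mem_nhds]
    filter_upwards [h3] with x hx
    exact hx.elim (fun h => M.subset_closure hT h) (fun h => M.subset_closure hT' h)
  have h5 : q ∉ interior Ω := (hsub hqF).2
  rw [hreg] at h4
  apply h5
  rwa [← hreg, interior_interior, hreg]

/-- A third element would have the same normal on `F` as the second, so that their interiors would
meet. -/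
theorem eq_of_three (hd : 2 ≤ d) {T₁ T₂ T₃ : M.cells} (h₁₂ : T₁ ≠ T₂)
    (h₁ : IsFacet T₁.1 F) (h₂ : IsFacet T₂.1 F) (h₃ : IsFacet T₃.1 F) : T₃ = T₁ ∨ T₃ = T₂ := by
  by_contra! hcon
  have e1 := M.outerNormal_eq_neg hd T₁.2 T₂.2 (fun h => h₁₂ (Subtype.ext h)) h₁ h₂
  have e2 := M.outerNormal_eq_neg hd T₁.2 T₃.2 (fun h => hcon.1 (Subtype.ext h.symm)) h₁ h₃
  exact absurd (M.disjoint_interiors _ T₂.2 _ T₃.2 fun h => hcon.2 (Subtype.ext h.symm))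
    (interiors_meet_of_outerNormal_eq hd (M.isPolytope _ T₂.2) (M.isPolytope _ T₃.2) h₂ h₃
      (e2.trans e1.symm))

/-- The sum formula is stated for an arbitrary commutative monoid so that it serves vector-valued
jumps, real integrals and plain counting. -/
theorem exists_adj_of_mem_intFaces (hd : 2 ≤ d) (hF : F ∈ M.intFaces) :
    ∃ T T' : M.cells, T ≠ T' ∧ IsFacet T.1 F ∧ IsFacet T'.1 F ∧
      outerNormal T'.1 F = -outerNormal T.1 F ∧
      (∀ {E : Type} [AddCommMonoid E] (f : M.cells → E), ∑ S ∈ M.adj F, f S = f T + f T') ∧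
      (M.adj F).card = 2 := by
  classical
  rw [intFaces, Finset.mem_filter, M.mem_faces] at hF
  obtain ⟨⟨T, hT, hTF⟩, hnot⟩ := hF
  obtain ⟨T', hT', hne, hTF'⟩ := (M.consistent T hT F hTF).resolve_left hnot
  have hne' : (⟨T, hT⟩ : M.cells) ≠ ⟨T', hT'⟩ := fun h => hne (congrArg Subtype.val h).symm
  have hadj : M.adj F = {⟨T, hT⟩, ⟨T', hT'⟩} := by
    ext S
    rw [mem_adj, Finset.mem_insert, Finset.mem_singleton]
    constructor
    · intro h
      exact M.eq_of_three hd hne' hTF hTF' h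
    · rintro (rfl | rfl)
      · exact hTF
      · exact hTF'
  refine ⟨⟨T, hT⟩, ⟨T', hT'⟩, hne', hTF, hTF',
    M.outerNormal_eq_neg hd hT hT' hne.symm hTF hTF', fun f => ?_, ?_⟩
  · rw [hadj, Finset.sum_pair hne']
  · rw [hadj, Finset.card_pair hne']

theorem exists_adj_of_mem_bdryFaces (hd : 2 ≤ d) (hreg : interior (closure Ω) = Ω)
    (hF : F ∈ M.bdryFaces) :
    ∃ T : M.cells, IsFacet T.1 F ∧ M.adj F = {T} ∧ M.normal F = outerNormal T.1 F := by
  classical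
  rw [bdryFaces, Finset.mem_filter, M.mem_faces] at hF
  obtain ⟨⟨T, hT, hTF⟩, hsub⟩ := hF
  refine ⟨⟨T, hT⟩, hTF, ?_, ?_⟩
  · ext S
    rw [mem_adj, Finset.mem_singleton]
    constructor
    · intro h
      by_contra hne
      exact M.not_subset_frontier hd hreg S.2 hT (fun h' => hne (Subtype.ext h')) h hTF hsub
    · rintro rfl
      exact hTF
  · have hex : ∃ T ∈ M.cells, IsFacet T F := ⟨T, hT, hTF⟩
    rw [normal, dif_pos hex]
    have hspec := hex.choose_spec
    by_cases hne : hex.choose = T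
    · rw [hne]
    · exact absurd hsub (M.not_subset_frontier hd hreg hspec.1 hT hne hspec.2 hTF)

theorem exists_normal_eq (hF : F ∈ M.faces) :
    ∃ T : M.cells, IsFacet T.1 F ∧ M.normal F = outerNormal T.1 F := by
  have hex := (M.mem_faces F).1 hF
  rw [normal, dif_pos hex]
  exact ⟨⟨hex.choose, hex.choose_spec.1⟩, hex.choose_spec.2, rfl⟩

theorem mem_faces_of_mem_intFaces (hF : F ∈ M.intFaces) : F ∈ M.faces := by
  classical
  rw [intFaces, Finset.mem_filter] at hF
  exact hF.1

theorem mem_faces_of_mem_bdryFaces (hF : F ∈ M.bdryFaces) : F ∈ M.faces := by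
  classical
  rw [bdryFaces, Finset.mem_filter] at hF
  exact hF.1

/-- The elements of a partition of a connected domain are connected through their common faces. -/
theorem cells_connected (hd : 2 ≤ d) (hΩ : IsOpen Ω) (hconn : IsPreconnected Ω)
    (hreg : interior (closure Ω) = Ω) (S : Set M.cells) (hS : S.Nonempty)
    (hstep : ∀ T ∈ S, ∀ F, IsFacet T.1 F → ∀ T' : M.cells, IsFacet T'.1 F → T' ∈ S) :
    ∀ T, T ∈ S := by
  by_contra! hcon
  obtain ⟨T₀', hT₀'⟩ := hcon
  obtain ⟨T₀, hT₀⟩ := hS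
  have hclosed : ∀ R : Set M.cells, IsClosed (⋃ T ∈ R, T.1) := fun R =>
    R.toFinite.isClosed_biUnion fun T _ => (M.isPolytope T.1 T.2).isClosed
  have hcover : Ω ⊆ (⋃ T ∈ S, T.1) ∪ ⋃ T ∈ Sᶜ, T.1 := by
    intro x hx
    have h := _root_.subset_closure hx
    rw [M.covers] at h
    obtain ⟨T, hT, hxT⟩ := mem_iUnion₂.1 h
    by_cases hTS : (⟨T, hT⟩ : M.cells) ∈ S
    · exact Or.inl (mem_biUnion hTS hxT)
    · exact Or.inr (mem_biUnion (x := (⟨T, hT⟩ : M.cells)) hTS hxT)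
  have hne : ∀ (R : Set M.cells) (T : M.cells), T ∈ R → (Ω ∩ ⋃ T ∈ R, T.1).Nonempty := by
    intro R T hT
    obtain ⟨x, hx⟩ := (M.isPolytope T.1 T.2).2
    exact ⟨x, M.interior_subset_domain hreg T.2 hx, mem_biUnion hT (interior_subset hx)⟩
  obtain ⟨x, hxΩ, hxS, hxS'⟩ := isPreconnected_closed_iff.1 hconn _ _ (hclosed S) (hclosed Sᶜ)
    hcover (hne S T₀ hT₀) (hne Sᶜ T₀' hT₀')
  obtain ⟨T, hTS, hxT⟩ := mem_iUnion₂.1 hxS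
  obtain ⟨T', hTS', hxT'⟩ := mem_iUnion₂.1 hxS'
  obtain ⟨ε, hε, hball⟩ := Metric.isOpen_iff.1 hΩ x hxΩ
  have hmeet : ∀ R : M.cells, x ∈ R.1 → (interior R.1 ∩ Metric.ball x ε).Nonempty := by
    intro R hxR
    rw [← (M.isPolytope R.1 R.2).closure_interior] at hxR
    rw [inter_comm]
    exact mem_closure_iff.1 hxR _ Metric.isOpen_ball (Metric.mem_ball_self hε)
  obtain ⟨y, hyT, hyε⟩ := hmeet T hxT
  choose 𝒲 hfin hdim hsk using fun R : M.cells => (M.isPolytope R.1 R.2).exists_skeleton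
  -- The span of `y` and a subspace of dimension at most `d - 2` is null. Avoiding these spans
  -- ensures that the segment from `y` to `z` meets no skeleton after leaving `y`.
  obtain ⟨z, ⟨hzT', hzε⟩, hz⟩ : ∃ z ∈ interior T'.1 ∩ Metric.ball x ε,
      ∀ R, ∀ W ∈ 𝒲 R, z ∉ affineSpan ℝ (insert y (W : Set (Pt d))) := by
    by_contra! hcon
    have hnull : volume (⋃ R, ⋃ W ∈ 𝒲 R,
        (affineSpan ℝ (insert y (W : Set (Pt d))) : Set (Pt d))) = 0 := by
      rw [measure_iUnion_null_iff]
      intro R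
      rw [measure_biUnion_null_iff (hfin R).countable]
      intro W hW
      apply Measure.addHaar_affineSubspace
      intro htop
      have h1 := finrank_vectorSpan_insert_le W y
      have h2 : vectorSpan ℝ (insert y (W : Set (Pt d))) = ⊤ := by
        rw [← direction_affineSpan, htop, AffineSubspace.direction_top]
      rw [h2, finrank_top, finrank_euclideanSpace_fin] at h1
      have := hdim R W hW
      omega
    have hpos := (isOpen_interior.inter Metric.isOpen_ball).measure_pos volume (hmeet T' hxT')
    refine hpos.ne' (measure_mono_null (fun z hz => ?_) hnull)
    obtain ⟨R, W, hW, hzW⟩ := hcon z hz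
    simp only [mem_iUnion]
    exact ⟨R, W, hW, hzW⟩
  set A := ⋃ T ∈ S, T.1
  have hcγ : Continuous fun t : ℝ => y + t • (z - y) := by fun_prop
  have hzA : z ∉ A := by
    intro hzA
    obtain ⟨R, hRS, hzR⟩ := mem_iUnion₂.1 hzA
    rw [← (M.isPolytope R.1 R.2).closure_interior] at hzR
    obtain ⟨u, hu1, hu2⟩ := mem_closure_iff.1 hzR _ isOpen_interior hzT'
    have hne : T'.1 ≠ R.1 := fun h => hTS' (by rwa [Subtype.ext h])
    exact (M.disjoint_interiors _ T'.2 _ R.2 hne).le_bot ⟨hu1, hu2⟩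
  have hcomp : IsCompact (Icc (0 : ℝ) 1 ∩ (fun t : ℝ => y + t • (z - y)) ⁻¹' A) :=
    isCompact_Icc.inter_right ((hclosed S).preimage hcγ)
  have hyA : y ∈ A := mem_biUnion hTS (interior_subset hyT)
  -- `t` is the last time at which the segment is in the union `A` of the elements of `S`. No
  -- neighbourhood of that exit point can lie in `A`.
  obtain ⟨t, ⟨ht01, htA⟩, htmax⟩ := hcomp.exists_isGreatest ⟨0, by simp, by simpa using hyA⟩
  have hlt1 : t < 1 := by
    refine lt_of_le_of_ne ht01.2 fun h => hzA ?_
    rw [h] at htA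
    simpa using htA
  have hnotev : ∀ q, q = y + t • (z - y) → ¬ ∀ᶠ u in nhds q, u ∈ A := by
    rintro q rfl hev
    have h1 : ∀ᶠ s in nhds t, y + s • (z - y) ∈ A := hcγ.continuousAt.eventually hev
    obtain ⟨s, hs, hts, hs1⟩ := ((h1.filter_mono nhdsWithin_le_nhds).and
      (Ioo_mem_nhdsGT hlt1)).exists
    exact absurd (htmax ⟨⟨ht01.1.trans hts.le, hs1.le⟩, hs⟩) (not_le.2 hts)
  obtain ⟨R, hRS, hqR⟩ := mem_iUnion₂.1 htA
  have ht0 : 0 < t := by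
    refine lt_of_le_of_ne ht01.1 fun h => hnotev y (by rw [← h]; simp) ?_
    filter_upwards [mem_interior_iff_mem_nhds.1 hyT] with u hu
    exact mem_biUnion hTS hu
  set q := y + t • (z - y) with hq
  have hqΩ : q ∈ Ω := hball ((convex_ball x ε).add_smul_sub_mem hyε hzε ht01)
  have hgen : ∀ R, ∀ W ∈ 𝒲 R, q ∉ W := by
    intro R W hW hqW
    refine hz R W hW ?_
    have h1 : q ∈ affineSpan ℝ (insert y (W : Set (Pt d))) :=
      subset_affineSpan ℝ _ (mem_insert_of_mem _ hqW)
    have h2 : y ∈ affineSpan ℝ (insert y (W : Set (Pt d))) :=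
      subset_affineSpan ℝ _ (mem_insert _ _)
    have h3 : z = AffineMap.lineMap y q t⁻¹ := by
      rw [AffineMap.lineMap_apply, hq, vsub_eq_sub, vadd_eq_add, add_sub_cancel_left, smul_smul,
        inv_mul_cancel₀ ht0.ne', one_smul, sub_add_cancel]
    rw [h3]
    exact AffineMap.lineMap_mem _ h2 h1
  -- The exit point is interior to an element of `S` or a generic point of one of its facets. As it
  -- lies in `Ω`, such a facet is shared with a second element, again in `S`; either way a
  -- neighbourhood lies in `A`.
  obtain ⟨hcases, hnear⟩ := hsk R q hqR (hgen R)
  rcases hcases with hint | ⟨F, hF, hqF⟩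
  · refine hnotev q rfl ?_
    filter_upwards [mem_interior_iff_mem_nhds.1 hint] with u hu
    exact mem_biUnion hRS hu
  · have hnot : ¬ F ⊆ frontier Ω := fun hsub => by
      have h := (hsub hqF).2
      rw [hΩ.interior_eq] at h
      exact h hqΩ
    obtain ⟨R', hR', hne, hF'⟩ := (M.consistent R.1 R.2 F hF).resolve_left hnot
    have hRS' : (⟨R', hR'⟩ : M.cells) ∈ S := hstep R hRS F hF ⟨R', hR'⟩ hF'
    have hnear' := (hsk ⟨R', hR'⟩ q (hF'.subset hqF) (hgen _)).2 F hF' hqF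
    refine hnotev q rfl ?_
    filter_upwards [eventually_mem_union (M.outerNormal_eq_neg hd R.2 hR' hne.symm hF hF')
      (hnear F hF hqF) hnear'] with u hu
    exact hu.elim (fun h => mem_biUnion hRS h) (fun h => mem_biUnion hRS' h)

end Mesh

end Adjacency

/-! ### The data on the elements and faces -/

/-- The hypotheses on a partition and on the data that do not involve the family. -/
structure Setting {d : ℕ} (P : Problem d) (M : Mesh d P.Ω) : Prop where
  two_le : 2 ≤ d
  adm : P.Admissible
  bdry : P.BoundaryCompatible M
  traces : P.HasNormalTraces M
  sign : P.SignConditions M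
  contK : P.PiecewiseContinuousK M

/-! ### Cauchy–Schwarz and Young inequalities for a positive semidefinite operator. -/

theorem sq_inner_le_of_posSemidef {E : Type*} [NormedAddCommGroup E] [InnerProductSpace ℝ E]
    {A : E →L[ℝ] E} (hs : ∀ ξ ζ, inner ℝ (A ξ) ζ = inner ℝ ξ (A ζ))
    (hp : ∀ ξ, 0 ≤ (inner ℝ ξ (A ξ) : ℝ)) (ξ ζ : E) :
    (inner ℝ (A ξ) ζ : ℝ) ^ 2 ≤ inner ℝ ξ (A ξ) * inner ℝ ζ (A ζ) := by
  have h : ∀ t : ℝ, 0 ≤ (inner ℝ ζ (A ζ) : ℝ) * (t * t) + 2 * inner ℝ (A ξ) ζ * t +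
      inner ℝ ξ (A ξ) := by
    intro t
    have h1 := hp (ξ + t • ζ)
    simp only [map_add, map_smul, inner_add_left, inner_add_right, real_inner_smul_left,
      real_inner_smul_right] at h1
    rw [← hs ξ ζ, real_inner_comm (A ξ) ζ] at h1
    linarith
  have h2 := discrim_le_zero h
  rw [discrim] at h2
  nlinarith

/-- Cauchy–Schwarz for the form of `A`, then the arithmetic-geometric mean inequality. The first
vector keeps its `A`-energy, and only the second pays the norm of `A`. -/
theorem abs_inner_le_young {E : Type*} [NormedAddCommGroup E] [InnerProductSpace ℝ E]
    {A : E →L[ℝ] E} (hs : ∀ ξ ζ, inner ℝ (A ξ) ζ = inner ℝ ξ (A ζ))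
    (hp : ∀ ξ, 0 ≤ (inner ℝ ξ (A ξ) : ℝ)) {B : ℝ} (hB : ‖A‖ ≤ B) {s : ℝ} (h_s : 0 < s) (ξ ζ : E) :
    |(inner ℝ (A ξ) ζ : ℝ)| ≤ s / 2 * inner ℝ ξ (A ξ) + B / (2 * s) * ‖ζ‖ ^ 2 := by
  have h1 := sq_inner_le_of_posSemidef hs hp ξ ζ
  have h2 : (inner ℝ ζ (A ζ) : ℝ) ≤ B * ‖ζ‖ ^ 2 := by
    calc (inner ℝ ζ (A ζ) : ℝ) ≤ ‖ζ‖ * ‖A ζ‖ := real_inner_le_norm _ _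
      _ ≤ ‖ζ‖ * (B * ‖ζ‖) := by gcongr; exact A.le_of_opNorm_le hB ζ
      _ = _ := by ring
  have hB0 : 0 ≤ B := (norm_nonneg A).trans hB
  have hx := hp ξ
  set q : ℝ := inner ℝ ξ (A ξ)
  set j := ‖ζ‖ ^ 2
  have hj : 0 ≤ j := sq_nonneg _
  have h3 : (inner ℝ (A ξ) ζ : ℝ) ^ 2 ≤ q * (B * j) :=
    h1.trans (mul_le_mul_of_nonneg_left h2 hx)
  apply abs_le_of_sq_le_sq _ (by positivity)
  have h4 : s / 2 * q * (B / (2 * s) * j) = q * (B * j) / 4 := by field_simp; ring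
  nlinarith [sq_nonneg (s / 2 * q - B / (2 * s) * j)]

/-! ### Elementwise extensions of the diffusion matrix, and restrictions of the data. -/

namespace Setting

variable {d : ℕ} {P : Problem d} {M : Mesh d P.Ω} {T F : Set (Pt d)}

theorem polytope (_S : Setting P M) (hT : T ∈ M.cells) : IsPolytope T := M.isPolytope T hT

variable (S : Setting P M)
include S

theorem restrict_le (hT : T ∈ M.cells) : volume.restrict T ≤ volume.restrict P.Ω := by
  rw [← Measure.restrict_congr_set (S.polytope hT).interior_ae_eq]
  exact Measure.restrict_mono (M.interior_subset_domain S.adm.regular hT) le_rfl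

theorem ae_cell {p : Pt d → Prop} (h : ∀ᵐ x ∂(volume.restrict P.Ω), p x) (hT : T ∈ M.cells) :
    ∀ᵐ x ∂(volume.restrict T), p x :=
  (Measure.absolutelyContinuous_of_le (S.restrict_le hT)) h

theorem tendsto_K (hT : T ∈ M.cells) {x : Pt d} (hx : x ∈ T) :
    ∃ A, Filter.Tendsto P.K (nhdsWithin x (interior T)) (nhds A) := by
  obtain ⟨g, hg, hgK⟩ := S.contK T hT
  exact ⟨g x, ((hg x hx).mono interior_subset).congr' (by
    filter_upwards [self_mem_nhdsWithin] with y hy using (hgK hy).symm)⟩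

theorem continuousOn_Kon (hT : T ∈ M.cells) : ContinuousOn (P.Kon T) T :=
  continuousOn_extendFrom (S.polytope hT).closure_interior.superset fun _ hx => S.tendsto_K hT hx

theorem Kon_eq (hT : T ∈ M.cells) {x : Pt d} (hx : x ∈ interior T) : P.Kon T x = P.K x := by
  obtain ⟨g, hg, hgK⟩ := S.contK T hT
  rw [Problem.Kon]
  refine extendFrom_eq (_root_.subset_closure hx) ?_
  rw [hgK hx]
  exact ((hg x (interior_subset hx)).mono interior_subset).congr' (by
    filter_upwards [self_mem_nhdsWithin] with y hy using (hgK hy).symm)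

theorem K_ae_eq (hT : T ∈ M.cells) : ∀ᵐ x ∂(volume.restrict T), P.K x = P.Kon T x := by
  rw [← Measure.restrict_congr_set (S.polytope hT).interior_ae_eq]
  filter_upwards [ae_restrict_mem isOpen_interior.measurableSet] with x hx
  exact (S.Kon_eq hT hx).symm

/-- A set of full measure is dense in the element, so a closed condition valid almost everywhere
passes to the continuous extension at every point, including those on faces, which are null sets. -/
theorem Kon_mem {Q : Set (Pt d →L[ℝ] Pt d)} (hQ : IsClosed Q)
    (h : ∀ᵐ x ∂(volume.restrict P.Ω), P.K x ∈ Q) (hT : T ∈ M.cells) {x : Pt d} (hx : x ∈ T) :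
    P.Kon T x ∈ Q := by
  have hcl : x ∈ closure {y | y ∈ interior T ∧ P.K y ∈ Q} := by
    rw [mem_closure_iff]
    intro V hV hxV
    rw [← (S.polytope hT).closure_interior] at hx
    have hne := mem_closure_iff.1 hx V hV hxV
    have hpos := (hV.inter isOpen_interior).measure_pos volume hne
    by_contra hcon
    have h1 := S.ae_cell h hT
    rw [← Measure.restrict_congr_set (S.polytope hT).interior_ae_eq,
      ae_restrict_iff' isOpen_interior.measurableSet] at h1
    refine hpos.ne' (measure_mono_null (fun y hy => ?_) h1)
    intro hy'
    exact hcon ⟨y, hy.1, hy.2, hy' hy.2⟩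
  have h2 := ((S.continuousOn_Kon hT x hx).mono (s := {y | y ∈ interior T ∧ P.K y ∈ Q})
    (fun y hy => interior_subset hy.1)).mem_closure hcl
    (t := Q) (fun y hy => by rw [S.Kon_eq hT hy.1]; exact hy.2)
  rwa [hQ.closure_eq] at h2

theorem Kon_symm (hT : T ∈ M.cells) {x : Pt d} (hx : x ∈ T) (ξ ζ : Pt d) :
    (inner ℝ (P.Kon T x ξ) ζ : ℝ) = inner ℝ ξ (P.Kon T x ζ) := by
  have hQ : IsClosed {A : Pt d →L[ℝ] Pt d | ∀ ξ ζ, (inner ℝ (A ξ) ζ : ℝ) = inner ℝ ξ (A ζ)} := by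
    simp only [ofPred_forall]
    exact isClosed_iInter fun ξ => isClosed_iInter fun ζ => isClosed_eq (by fun_prop) (by fun_prop)
  exact S.Kon_mem hQ S.adm.K_symm hT hx ξ ζ

theorem Kon_lower {k₀ : ℝ}
    (hk : ∀ᵐ x ∂(volume.restrict P.Ω), ∀ ξ : Pt d, k₀ * ‖ξ‖ ^ 2 ≤ inner ℝ ξ (P.K x ξ))
    (hT : T ∈ M.cells) {x : Pt d} (hx : x ∈ T) (ξ : Pt d) :
    k₀ * ‖ξ‖ ^ 2 ≤ inner ℝ ξ (P.Kon T x ξ) := by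
  have hQ : IsClosed {A : Pt d →L[ℝ] Pt d | ∀ ξ, k₀ * ‖ξ‖ ^ 2 ≤ (inner ℝ ξ (A ξ) : ℝ)} := by
    simp only [ofPred_forall]
    exact isClosed_iInter fun ξ => isClosed_le (by fun_prop) (by fun_prop)
  exact S.Kon_mem hQ hk hT hx ξ

theorem Kon_nonneg (hT : T ∈ M.cells) {x : Pt d} (hx : x ∈ T) (ξ : Pt d) :
    0 ≤ (inner ℝ ξ (P.Kon T x ξ) : ℝ) := by
  obtain ⟨k₀, hk₀, hk⟩ := S.adm.K_pos
  exact le_trans (by positivity) (S.Kon_lower hk hT hx ξ)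

theorem norm_Kon_le (hT : T ∈ M.cells) {x : Pt d} (hx : x ∈ T) : ‖P.Kon T x‖ ≤ P.normK := by
  have hQ : IsClosed {A : Pt d →L[ℝ] Pt d | ‖A‖ ≤ P.normK} :=
    isClosed_le (by fun_prop) (by fun_prop)
  refine S.Kon_mem hQ ?_ hT hx
  have hfin := S.adm.K_mem.2
  rw [eLpNorm_exponent_top] at hfin
  filter_upwards [ae_le_eLpNormEssSup (f := P.K) (μ := volume.restrict P.Ω)] with y hy
  have h := ENNReal.toReal_mono hfin.ne hy
  change ‖P.K y‖ ≤ P.normK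
  rw [Problem.normK, eLpNorm_exponent_top]
  simpa using h

theorem abs_inner_Kon_le (hT : T ∈ M.cells) {x : Pt d} (hx : x ∈ T) {s : ℝ} (h_s : 0 < s)
    (ξ ζ : Pt d) : |(inner ℝ (P.Kon T x ξ) ζ : ℝ)| ≤
      s / 2 * inner ℝ ξ (P.Kon T x ξ) + P.normK / (2 * s) * ‖ζ‖ ^ 2 :=
  abs_inner_le_young (S.Kon_symm hT hx) (S.Kon_nonneg hT hx) (S.norm_Kon_le hT hx) h_s ξ ζ

theorem integral_K_eq (hT : T ∈ M.cells) (ξ ζ : Pt d → Pt d) :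
    ∫ x in T, (inner ℝ (ξ x) (P.K x (ζ x)) : ℝ) = ∫ x in T, inner ℝ (ξ x) (P.Kon T x (ζ x)) := by
  apply integral_congr_ae
  filter_upwards [S.K_ae_eq hT] with x hx
  rw [hx]

/-! ### Integrability -/

theorem isFiniteMeasure_restrict (hT : T ∈ M.cells) :
    IsFiniteMeasure (volume.restrict T) :=
  ⟨by rw [Measure.restrict_apply_univ]; exact (M.isPolytope T hT).isCompact.measure_lt_top⟩

theorem isFiniteMeasure_facet (hT : T ∈ M.cells) (hF : IsFacet T F) :
    IsFiniteMeasure ((surf d).restrict F) :=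
  ⟨by rw [Measure.restrict_apply_univ]; exact hF.surf_lt_top S.two_le (S.polytope hT)⟩

theorem integrableOn_of_memLp {E : Type*} [NormedAddCommGroup E] {f : Pt d → E} {p : ℝ≥0∞}
    (hp : 1 ≤ p) (hf : MemLp f p (volume.restrict P.Ω)) (hT : T ∈ M.cells) : IntegrableOn f T := by
  have := S.isFiniteMeasure_restrict hT
  exact (hf.mono_measure (S.restrict_le hT)).integrable hp

theorem integrableOn_divc (hT : T ∈ M.cells) : IntegrableOn P.divc T := by
  apply integrable_finsetSum
  intro j _
  exact S.integrableOn_of_memLp (by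
    rw [ENNReal.le_div_iff_mul_le (by simp) (by simp)]; norm_num) (S.adm.dc_mem j) hT

theorem integrableOn_inner_c (hT : T ∈ M.cells) {ξ : Pt d → Pt d} (hξ : ContinuousOn ξ T) :
    IntegrableOn (fun x => (inner ℝ (P.c x) (ξ x) : ℝ)) T := by
  have hc := S.integrableOn_of_memLp le_top S.adm.c_mem hT
  simp only [PiLp.inner_apply]
  apply integrable_finsetSum
  intro j _
  have h1 : IntegrableOn (fun x => P.c x j) T :=
    (EuclideanSpace.proj (𝕜 := ℝ) j : Pt d →L[ℝ] ℝ).integrable_comp hc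
  have h2 : ContinuousOn (fun x => ξ x j) T :=
    (EuclideanSpace.proj (𝕜 := ℝ) j : Pt d →L[ℝ] ℝ).continuous.comp_continuousOn hξ
  exact (IntegrableOn.continuousOn_mul h2 h1 (S.polytope hT).isCompact)

theorem integrableOn_mul (hT : T ∈ M.cells) {w φ : Pt d → ℝ}
    (hw : IntegrableOn w T) (hφ : ContinuousOn φ T) : IntegrableOn (fun x => w x * φ x) T :=
  hw.mul_continuousOn hφ (M.isPolytope T hT).isCompact

theorem integrableOn_facet_mul (hT : T ∈ M.cells) (hF : IsFacet T F) {w φ : Pt d → ℝ}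
    (hw : IntegrableOn w F (surf d)) (hφ : ContinuousOn φ F) :
    IntegrableOn (fun x => w x * φ x) F (surf d) :=
  hw.mul_continuousOn hφ (hF.isCompact S.two_le (S.polytope hT))

theorem continuousOn_Kon_apply (hT : T ∈ M.cells) {ξ ζ : Pt d → Pt d} (hξ : ContinuousOn ξ T)
    (hζ : ContinuousOn ζ T) : ContinuousOn (fun x => (inner ℝ (ξ x) (P.Kon T x (ζ x)) : ℝ)) T :=
  hξ.inner ((S.continuousOn_Kon hT).clm_apply hζ)

theorem integrableOn_inner_K (hT : T ∈ M.cells) {ξ ζ : Pt d → Pt d} (hξ : ContinuousOn ξ T)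
    (hζ : ContinuousOn ζ T) : IntegrableOn (fun x => (inner ℝ (ξ x) (P.K x (ζ x)) : ℝ)) T := by
  refine ((S.polytope hT).integrableOn (S.continuousOn_Kon_apply hT hξ hζ)).congr ?_
  filter_upwards [S.K_ae_eq hT] with x hx
  rw [hx]

theorem integrableOn_inner_Kon (hT : T ∈ M.cells) (hF : IsFacet T F) {ξ ζ : Pt d → Pt d}
    (hξ : Continuous ξ) (hζ : Continuous ζ) :
    IntegrableOn (fun x => (inner ℝ (ξ x) (P.Kon T x (ζ x)) : ℝ)) F (surf d) :=
  hF.integrableOn S.two_le (S.polytope hT)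
    ((S.continuousOn_Kon_apply hT hξ.continuousOn hζ.continuousOn).mono hF.subset)

theorem integrableOn_normal_c (hT : T ∈ M.cells) (hF : IsFacet T F) :
    IntegrableOn (fun x => (inner ℝ (outerNormal T F) (P.c x) : ℝ)) F (surf d) := by
  have := S.isFiniteMeasure_facet hT hF
  exact (S.traces.mem T hT F hF).integrable le_top

theorem memLp_facet {f : Pt d → ℝ} {p : ℝ≥0∞} {Γ : Set (Pt d)}
    (hf : MemLp f p ((surf d).restrict Γ)) (hF : F ∈ P.facesIn M Γ) :
    MemLp f p ((surf d).restrict F) := by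
  classical
  rw [Problem.facesIn, Finset.mem_filter] at hF
  refine hf.mono_measure ?_
  exact Measure.restrict_mono_ae (ae_le_set.2 hF.2)

theorem mem_bdry_of_facesIn {Γ : Set (Pt d)} (hF : F ∈ P.facesIn M Γ) :
    F ∈ M.bdryFaces := by
  classical
  rw [Problem.facesIn, Finset.mem_filter] at hF
  exact hF.1

theorem exists_adj (hF : F ∈ M.bdryFaces) :
    ∃ T : M.cells, IsFacet T.1 F ∧ M.adj F = {T} ∧ M.normal F = outerNormal T.1 F :=
  M.exists_adj_of_mem_bdryFaces S.two_le S.adm.regular hF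

theorem integrableOn_facet {f : Pt d → ℝ} {p : ℝ≥0∞} (hp : 1 ≤ p) {Γ : Set (Pt d)}
    (hf : MemLp f p ((surf d).restrict Γ)) (hF : F ∈ P.facesIn M Γ) :
    IntegrableOn f F (surf d) := by
  obtain ⟨T, hT, -, -⟩ := S.exists_adj (S.mem_bdry_of_facesIn hF)
  have := S.isFiniteMeasure_facet T.2 hT
  exact (S.memLp_facet hf hF).integrable hp

theorem surf_pos (hF : F ∈ M.faces) : 0 < surf d F := by
  obtain ⟨T, hT, hTF⟩ := (M.mem_faces F).1 hF
  exact hTF.surf_pos S.two_le (S.polytope hT)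

theorem measurableSet_face (hF : F ∈ M.faces) : MeasurableSet F := by
  obtain ⟨T, hT, hTF⟩ := (M.mem_faces F).1 hF
  exact (hTF.isClosed S.two_le (S.polytope hT)).measurableSet

theorem diam_pos (hF : F ∈ M.faces) : 0 < Metric.diam F := by
  obtain ⟨T, hT, hTF⟩ := (M.mem_faces F).1 hF
  exact hTF.diam_pos S.two_le (S.polytope hT)

theorem normK_nonneg : 0 ≤ P.normK := ENNReal.toReal_nonneg

end Setting

/-! ### The energy identity -/

namespace Mesh

variable {d : ℕ} {Ω : Set (Pt d)} (M : Mesh d Ω) {F : Set (Pt d)}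

theorem jump_of_adj_singleton {T : M.cells} (h : M.adj F = {T}) (v : M.Fn) (x : Pt d) :
    M.jump v F x = pval (v T) x • outerNormal T.1 F := by simp [jump, h]

theorem avg_of_adj_singleton {T : M.cells} (h : M.adj F = {T}) (v : M.Fn) (x : Pt d) :
    M.avg v F x = pval (v T) x := by simp [avg, h]

theorem continuous_jump (v : M.Fn) (F : Set (Pt d)) : Continuous (M.jump v F) := by
  unfold jump; fun_prop

theorem continuous_avg (v : M.Fn) (F : Set (Pt d)) : Continuous (M.avg v F) := by
  unfold avg; fun_prop

end Mesh

namespace Setting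

variable {d : ℕ} {P : Problem d} {M : Mesh d P.Ω} {F : Set (Pt d)}

variable (S : Setting P M)
include S

theorem face_cases (hF : F ∈ M.faces) :
    F ∈ M.intFaces ∨ (F ∈ M.bdryFaces ∧ (F ∈ P.faces₁ M ∨ F ∈ P.faces₂₁ M ∨ F ∈ P.faces₂₂ M ∨
      F ∈ P.faces₃ M)) := by
  classical
  by_cases h : F ⊆ frontier P.Ω
  · right
    have hb : F ∈ M.bdryFaces := by
      rw [Mesh.bdryFaces, Finset.mem_filter]; exact ⟨hF, h⟩
    refine ⟨hb, ?_⟩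
    rcases S.bdry.exhaust F hb with h1 | h2 | h3
    · exact Or.inl h1
    · rcases S.bdry.split₂ F h2 with h | h
      · exact Or.inr (Or.inl h)
      · exact Or.inr (Or.inr (Or.inl h))
    · exact Or.inr (Or.inr (Or.inr h3))
  · left
    rw [Mesh.intFaces, Finset.mem_filter]; exact ⟨hF, h⟩

theorem notMem_bdryFaces (hF : F ∈ M.intFaces) : F ∉ M.bdryFaces := by
  classical
  rw [Mesh.intFaces, Finset.mem_filter] at hF
  rw [Mesh.bdryFaces, Finset.mem_filter]
  exact fun h => hF.2 h.2

theorem faces₂₁_subset (hF : F ∈ P.faces₂₁ M) : F ∈ P.faces₂ M := by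
  classical
  rw [Problem.faces₂₁, Finset.mem_filter] at hF
  exact hF.1

theorem faces₂₂_subset (hF : F ∈ P.faces₂₂ M) : F ∈ P.faces₂ M := by
  classical
  rw [Problem.faces₂₂, Finset.mem_filter] at hF
  exact hF.1

theorem facesIn_subset {Γ : Set (Pt d)} (hF : F ∈ P.facesIn M Γ) : F ∈ M.faces :=
  M.mem_faces_of_mem_bdryFaces (S.mem_bdry_of_facesIn hF)

/-- The two almost-everywhere conditions contradict each other because a face has positive surface
measure. -/
theorem notMem_faces₂₁ (hF : F ∈ P.faces₂₂ M) : F ∉ P.faces₂₁ M := by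
  classical
  intro hF'
  have hf := S.facesIn_subset (S.faces₂₂_subset hF)
  rw [Problem.faces₂₂, Finset.mem_filter] at hF
  rw [Problem.faces₂₁, Finset.mem_filter] at hF'
  have h : ∀ᵐ _x ∂((surf d).restrict F), False := by
    filter_upwards [hF.2, hF'.2] with x h1 h2 using h1 h2
  rw [Filter.eventually_false_iff_eq_bot, ae_eq_bot, Measure.restrict_eq_zero] at h
  exact (S.surf_pos hf).ne' h

/-- The values of the normal component of `c` on a face, as seen from an adjacent element. -/
theorem integrableOn_normal_c_mul {T : M.cells} (hF : IsFacet T.1 F) {φ : Pt d → ℝ}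
    (hφ : Continuous φ) :
    IntegrableOn (fun x => (inner ℝ (outerNormal T.1 F) (P.c x) : ℝ) * φ x) F (surf d) :=
  S.integrableOn_facet_mul T.2 hF (S.integrableOn_normal_c T.2 hF) hφ.continuousOn

theorem integrableOn_abs_normal_c_mul {T : M.cells} (hF : IsFacet T.1 F) {φ : Pt d → ℝ}
    (hφ : Continuous φ) :
    IntegrableOn (fun x => |(inner ℝ (outerNormal T.1 F) (P.c x) : ℝ)| * φ x) F (surf d) :=
  S.integrableOn_facet_mul T.2 hF (S.integrableOn_normal_c T.2 hF).abs hφ.continuousOn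

/-- Green's formula for `v²/2` replaces `-(cv, ∇v)` by half the divergence term minus half the
boundary fluxes. -/
theorem cell_identity (v : M.Fn) (T : M.cells) :
    (∫ x in T.1, inner ℝ (P.K x (pgrad (v T) x) - pval (v T) x • P.c x) (pgrad (v T) x)) +
      (∫ x in T.1, P.r x * pval (v T) x * pval (v T) x) =
    (∫ x in T.1, inner ℝ (pgrad (v T) x) (P.K x (pgrad (v T) x))) +
      1 / 2 * (∫ x in T.1, (2 * P.r x + P.divc x) * pval (v T) x ^ 2) -
      1 / 2 * ∑ F ∈ M.faces with T ∈ M.adj F,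
        ∫ x in F, inner ℝ (outerNormal T.1 F) (P.c x) * pval (v T) x ^ 2 ∂(surf d) := by
  have hv : Continuous (pval (v T)) := by fun_prop
  have hg : Continuous (pgrad (v T)) := by fun_prop
  have i1 := S.integrableOn_inner_K T.2 hg.continuousOn hg.continuousOn
  have i2 := S.integrableOn_inner_c T.2 (ξ := fun x => pval (v T) x • pgrad (v T) x)
    (hv.smul hg).continuousOn
  have i3 := S.integrableOn_mul T.2 (S.integrableOn_of_memLp le_top S.adm.r_mem T.2)
    (φ := fun x => pval (v T) x ^ 2) (hv.pow 2).continuousOn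
  have i4 := S.integrableOn_mul T.2 (S.integrableOn_divc T.2)
    (φ := fun x => pval (v T) x ^ 2) (hv.pow 2).continuousOn
  have hgreen := S.traces.green T (fun y => pval (v T) y ^ 2 / 2)
    (((contDiff_pval _).pow 2).div_const 2)
  simp only [gradient_half_sq] at hgreen
  have e1 : ∫ x in T.1, (inner ℝ (P.c x) (pval (v T) x • pgrad (v T) x) +
      P.divc x * (pval (v T) x ^ 2 / 2) : ℝ) =
      (∫ x in T.1, inner ℝ (P.c x) (pval (v T) x • pgrad (v T) x)) +
      1 / 2 * ∫ x in T.1, P.divc x * pval (v T) x ^ 2 := by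
    rw [← integral_const_mul, ← integral_add i2 (i4.const_mul _)]
    congr 1; ext x; ring
  have e2 : ∀ F, ∫ x in F, (inner ℝ (outerNormal T.1 F) (P.c x) : ℝ) *
      (pval (v T) x ^ 2 / 2) ∂(surf d) =
      1 / 2 * ∫ x in F, inner ℝ (outerNormal T.1 F) (P.c x) * pval (v T) x ^ 2 ∂(surf d) := by
    intro F
    rw [← integral_const_mul]
    congr 1; ext x; ring
  have e3 : (∫ x in T.1, inner ℝ (P.K x (pgrad (v T) x) - pval (v T) x • P.c x)
      (pgrad (v T) x) : ℝ) = (∫ x in T.1, inner ℝ (pgrad (v T) x) (P.K x (pgrad (v T) x))) -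
      ∫ x in T.1, inner ℝ (P.c x) (pval (v T) x • pgrad (v T) x) := by
    rw [← integral_sub i1 i2]
    congr 1; ext x
    rw [inner_sub_left, real_inner_comm, real_inner_smul_left, real_inner_smul_right]
  have e4 : ∫ x in T.1, (2 * P.r x + P.divc x) * pval (v T) x ^ 2 =
      2 * (∫ x in T.1, P.r x * pval (v T) x ^ 2) + ∫ x in T.1, P.divc x * pval (v T) x ^ 2 := by
    rw [← integral_const_mul, ← integral_add (i3.const_mul _) i4]
    congr 1; ext x; ring
  have e5 : ∫ x in T.1, P.r x * pval (v T) x * pval (v T) x =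
      ∫ x in T.1, P.r x * pval (v T) x ^ 2 := by
    congr 1; ext x; ring
  simp only [e2, ← Finset.mul_sum] at hgreen
  rw [e1] at hgreen
  rw [e3, e4, e5]
  linarith

theorem abs_inner_normal (hF : F ∈ M.faces) {T : M.cells} (hT : IsFacet T.1 F) (x : Pt d) :
    |(inner ℝ (P.c x) (M.normal F) : ℝ)| = |(inner ℝ (outerNormal T.1 F) (P.c x) : ℝ)| := by
  obtain ⟨T', hT', h⟩ := M.exists_normal_eq hF
  rw [h, real_inner_comm]
  rcases outerNormal_eq_or_eq_neg hT hT' with h | h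
  · rw [h]
  · rw [h, inner_neg_left, abs_neg]

/-- With `β = c·n > 0`, upwinding gives `β v (v - v') - β (v² - v'²)/2 = β (v - v')²/2`; the
opposite sign is symmetric. -/
theorem interior_face_identity (hF : F ∈ M.intFaces) (v : M.Fn) :
    (∫ x in F, inner ℝ (P.upwind v F x) (M.jump v F x) ∂(surf d)) -
      1 / 2 * ∑ T ∈ M.adj F,
        ∫ x in F, inner ℝ (outerNormal T.1 F) (P.c x) * pval (v T) x ^ 2 ∂(surf d) =
    1 / 2 * ∫ x in F, |inner ℝ (P.c x) (M.normal F)| * ‖M.jump v F x‖ ^ 2 ∂(surf d) := by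
  obtain ⟨T, T', hne, hT, hT', hn, hsum, -⟩ := M.exists_adj_of_mem_intFaces S.two_le hF
  have hFf := M.mem_faces_of_mem_intFaces hF
  simp only [S.abs_inner_normal hFf hT, Problem.upwind, Mesh.jump, hsum, hn]
  set n := outerNormal T.1 F with hn_def
  have hn1 : ‖n‖ = 1 := norm_outerNormal hT
  have hnn : (inner ℝ n n : ℝ) = 1 := by rw [real_inner_self_eq_norm_sq, hn1]; norm_num
  have i1 := S.integrableOn_normal_c_mul hT (φ := fun x => pval (v T) x ^ 2) (by fun_prop)
  have i2 := S.integrableOn_normal_c_mul hT (φ := fun x => pval (v T') x ^ 2) (by fun_prop)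
  have i3 := S.integrableOn_abs_normal_c_mul hT
    (φ := fun x => (pval (v T) x - pval (v T') x) ^ 2) (by fun_prop)
  rw [← hn_def] at i1 i2 i3
  have hj : ∀ x, pval (v T) x • n + pval (v T') x • -n = (pval (v T) x - pval (v T') x) • n :=
    fun x => by module
  have e1 : ∀ x, ‖pval (v T) x • n + pval (v T') x • -n‖ ^ 2 =
      (pval (v T) x - pval (v T') x) ^ 2 := fun x => by
    rw [hj, norm_smul, hn1, mul_one, Real.norm_eq_abs, sq_abs]
  have e2 : ∀ x, (inner ℝ ((if 0 < (inner ℝ (P.c x) n : ℝ) then pval (v T) x • P.c x else 0) +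
      if 0 < (inner ℝ (P.c x) (-n) : ℝ) then pval (v T') x • P.c x else 0)
      (pval (v T) x • n + pval (v T') x • -n) : ℝ) =
      1 / 2 * (|inner ℝ n (P.c x)| * (pval (v T) x - pval (v T') x) ^ 2) +
      1 / 2 * (inner ℝ n (P.c x) * pval (v T) x ^ 2) -
      1 / 2 * (inner ℝ n (P.c x) * pval (v T') x ^ 2) := fun x => by
    rw [hj, inner_smul_right, inner_neg_right, real_inner_comm (P.c x) n]
    rcases lt_trichotomy 0 (inner ℝ (P.c x) n : ℝ) with h | h | h
    · rw [if_pos h, if_neg (by linarith), add_zero, abs_of_pos h, real_inner_smul_left]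
      ring
    · rw [← h]; simp
    · rw [if_neg (by linarith), if_pos (by linarith), zero_add, abs_of_neg h, real_inner_smul_left]
      ring
  simp only [e1, e2]
  have i4 : IntegrableOn (fun x => 1 / 2 * (|(inner ℝ n (P.c x) : ℝ)| *
      (pval (v T) x - pval (v T') x) ^ 2) + 1 / 2 * (inner ℝ n (P.c x) * pval (v T) x ^ 2))
      F (surf d) := (i3.const_mul _).add (i1.const_mul _)
  rw [integral_sub i4 (i2.const_mul _), integral_add (i3.const_mul _) (i1.const_mul _)]
  simp only [integral_const_mul, inner_neg_left, neg_mul, integral_neg]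
  ring

theorem outflow_face_identity (hF : F ∈ P.faces₂₁ M) (v : M.Fn) :
    (∫ x in F, inner ℝ (P.upwind v F x) (M.jump v F x) ∂(surf d)) -
      1 / 2 * ∑ T ∈ M.adj F,
        ∫ x in F, inner ℝ (outerNormal T.1 F) (P.c x) * pval (v T) x ^ 2 ∂(surf d) =
    1 / 2 * ∫ x in F, |inner ℝ (P.c x) (M.normal F)| * ‖M.jump v F x‖ ^ 2 ∂(surf d) := by
  have hb := S.mem_bdry_of_facesIn (S.faces₂₁_subset hF)
  obtain ⟨T, hT, hadj, hnormal⟩ := S.exists_adj hb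
  have hFf := M.mem_faces_of_mem_bdryFaces hb
  have hsign := S.sign.on₂₁ F hF
  rw [hnormal] at hsign
  simp only [S.abs_inner_normal hFf hT, Problem.upwind, Mesh.jump, hadj, Finset.sum_singleton]
  have hn1 : ‖outerNormal T.1 F‖ = 1 := norm_outerNormal hT
  set n := outerNormal T.1 F
  have e1 : ∫ x in F, (inner ℝ (if 0 < (inner ℝ (P.c x) n : ℝ) then pval (v T) x • P.c x else 0)
      (pval (v T) x • n) : ℝ) ∂(surf d) =
      ∫ x in F, inner ℝ n (P.c x) * pval (v T) x ^ 2 ∂(surf d) := by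
    apply integral_congr_ae
    filter_upwards [hsign] with x hx
    rw [inner_smul_right]
    rw [real_inner_comm] at hx ⊢
    split_ifs with h
    · rw [inner_smul_right, real_inner_comm]; ring
    · rw [real_inner_comm] at h
      rw [inner_zero_right, le_antisymm (not_lt.1 h) (by rwa [real_inner_comm])]
      ring
  have e2 : ∫ x in F, |(inner ℝ n (P.c x) : ℝ)| * ‖pval (v T) x • n‖ ^ 2 ∂(surf d) =
      ∫ x in F, inner ℝ n (P.c x) * pval (v T) x ^ 2 ∂(surf d) := by
    apply integral_congr_ae
    filter_upwards [hsign] with x hx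
    rw [norm_smul, hn1, mul_one, Real.norm_eq_abs, sq_abs, abs_of_nonneg hx]
  rw [e1, e2]
  ring

/-- These faces carry no upwind term in the method; the boundary flux from Green's formula already
has the good sign. -/
theorem inflow_face_identity (hF : F ∈ P.faces₁ M ∨ F ∈ P.faces₃ M) (v : M.Fn) :
    -(1 / 2 * ∑ T ∈ M.adj F,
        ∫ x in F, inner ℝ (outerNormal T.1 F) (P.c x) * pval (v T) x ^ 2 ∂(surf d)) =
    1 / 2 * ∫ x in F, |inner ℝ (P.c x) (M.normal F)| * ‖M.jump v F x‖ ^ 2 ∂(surf d) := by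
  have hb : F ∈ M.bdryFaces := hF.elim S.mem_bdry_of_facesIn S.mem_bdry_of_facesIn
  obtain ⟨T, hT, hadj, hnormal⟩ := S.exists_adj hb
  have hFf := M.mem_faces_of_mem_bdryFaces hb
  have hsign := hF.elim (S.sign.on₁ F) (S.sign.on₃ F)
  rw [hnormal] at hsign
  simp only [S.abs_inner_normal hFf hT, Mesh.jump, hadj, Finset.sum_singleton]
  have hn1 : ‖outerNormal T.1 F‖ = 1 := norm_outerNormal hT
  set n := outerNormal T.1 F
  have e2 : ∫ x in F, |(inner ℝ n (P.c x) : ℝ)| * ‖pval (v T) x • n‖ ^ 2 ∂(surf d) =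
      -∫ x in F, inner ℝ n (P.c x) * pval (v T) x ^ 2 ∂(surf d) := by
    rw [← integral_neg]
    apply integral_congr_ae
    filter_upwards [hsign] with x hx
    rw [norm_smul, hn1, mul_one, Real.norm_eq_abs, sq_abs, abs_of_nonpos hx]
    ring
  rw [e2]
  ring

theorem robin_face_identity (hF : F ∈ P.faces₂₂ M) (v : M.Fn) :
    (∫ x in F, P.α x * M.avg v F x * M.avg v F x ∂(surf d)) -
      1 / 2 * ∑ T ∈ M.adj F,
        ∫ x in F, inner ℝ (outerNormal T.1 F) (P.c x) * pval (v T) x ^ 2 ∂(surf d) =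
    1 / 2 * ∫ x in F, (2 * P.α x - inner ℝ (M.normal F) (P.c x)) * M.avg v F x ^ 2 ∂(surf d) := by
  have h2 := S.faces₂₂_subset hF
  obtain ⟨T, hT, hadj, hnormal⟩ := S.exists_adj (S.mem_bdry_of_facesIn h2)
  simp only [Mesh.avg_of_adj_singleton M hadj, hadj, hnormal, Finset.sum_singleton]
  have i1 := S.integrableOn_normal_c_mul hT (φ := fun x => pval (v T) x ^ 2) (by fun_prop)
  have i2 := S.integrableOn_facet_mul T.2 hT (S.integrableOn_facet le_top S.adm.α_mem h2)
    (φ := fun x => pval (v T) x ^ 2) (by fun_prop)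
  have e1 : ∫ x in F, P.α x * pval (v T) x * pval (v T) x ∂(surf d) =
      ∫ x in F, P.α x * pval (v T) x ^ 2 ∂(surf d) := by
    congr 1; ext x; ring
  have e2 : ∫ x in F, (2 * P.α x - inner ℝ (outerNormal T.1 F) (P.c x)) * pval (v T) x ^ 2
      ∂(surf d) = 2 * (∫ x in F, P.α x * pval (v T) x ^ 2 ∂(surf d)) -
      ∫ x in F, inner ℝ (outerNormal T.1 F) (P.c x) * pval (v T) x ^ 2 ∂(surf d) := by
    rw [← integral_const_mul, ← integral_sub (i2.const_mul _) i1]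
    congr 1; ext x; ring
  rw [e1, e2]
  ring

theorem integrableOn_avgFlux_jump (F : Set (Pt d)) (u v : M.Fn) :
    IntegrableOn (fun x => (inner ℝ (P.avgFlux u F x) (M.jump v F x) : ℝ)) F (surf d) := by
  simp only [Problem.avgFlux, real_inner_smul_left, sum_inner]
  apply Integrable.const_mul
  apply integrable_finsetSum
  intro T hT
  simp only [real_inner_comm]
  exact S.integrableOn_inner_Kon T.2 (M.mem_adj.1 hT) (M.continuous_jump v F) (continuous_pgrad _)

theorem integrableOn_face {f : Pt d → ℝ} (hF : F ∈ M.faces) (hf : Continuous f) :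
    IntegrableOn f F (surf d) := by
  obtain ⟨T, hT, hTF⟩ := (M.mem_faces F).1 hF
  exact hTF.integrableOn S.two_le (S.polytope hT) hf.continuousOn

theorem mem_faces_of_penalty (hF : F ∈ M.intFaces ∨ F ∈ P.faces₃ M) : F ∈ M.faces :=
  hF.elim M.mem_faces_of_mem_intFaces S.facesIn_subset

open scoped Classical in
/-- The bilinear form on the diagonal is the energy, up to the consistency terms. -/
theorem aForm_self (θ η : ℝ) (v : M.Fn) :
    P.aForm θ η v v = P.energySq η v - (1 - θ) * ∑ F ∈ M.intFaces ∪ P.faces₃ M,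
      ∫ x in F, inner ℝ (P.avgFlux v F x) (M.jump v F x) ∂(surf d) := by
  have h1 : ∀ F ∈ M.intFaces ∪ P.faces₃ M,
      ∫ x in F, (inner ℝ (P.avgFlux v F x - (η / Metric.diam F) • M.jump v F x)
        (M.jump v F x) : ℝ) ∂(surf d) =
      (∫ x in F, inner ℝ (P.avgFlux v F x) (M.jump v F x) ∂(surf d)) -
        η / Metric.diam F * ∫ x in F, ‖M.jump v F x‖ ^ 2 ∂(surf d) := by
    intro F hF
    have hFf := S.mem_faces_of_penalty (Finset.mem_union.1 hF)
    have hj := M.continuous_jump v F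
    have i1 := S.integrableOn_avgFlux_jump F v v
    have i2 := S.integrableOn_face hFf (f := fun x => ‖M.jump v F x‖ ^ 2) (by fun_prop)
    rw [← integral_const_mul, ← integral_sub i1 (i2.const_mul _)]
    congr 1; ext x
    rw [inner_sub_left, real_inner_smul_left, real_inner_self_eq_norm_sq]
  -- The boundary fluxes of the elements are regrouped by faces.
  have h2 : ∑ T : M.cells, ∑ F ∈ M.faces with T ∈ M.adj F,
      ∫ x in F, inner ℝ (outerNormal T.1 F) (P.c x) * pval (v T) x ^ 2 ∂(surf d) =
      ∑ F ∈ M.faces, ∑ T ∈ M.adj F,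
        ∫ x in F, inner ℝ (outerNormal T.1 F) (P.c x) * pval (v T) x ^ 2 ∂(surf d) :=
    Finset.sum_comm' fun T F => by simp [and_comm]
  have hsub1 : M.intFaces ∪ P.faces₂₁ M ⊆ M.faces := fun F hF =>
    (Finset.mem_union.1 hF).elim M.mem_faces_of_mem_intFaces
      fun h => S.facesIn_subset (S.faces₂₁_subset h)
  have hsub2 : P.faces₂₂ M ⊆ M.faces := fun F hF => S.facesIn_subset (S.faces₂₂_subset hF)
  have h3 : (∑ F ∈ M.intFaces ∪ P.faces₂₁ M,
        ∫ x in F, inner ℝ (P.upwind v F x) (M.jump v F x) ∂(surf d)) +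
      (∑ F ∈ P.faces₂₂ M, ∫ x in F, P.α x * M.avg v F x * M.avg v F x ∂(surf d)) -
      1 / 2 * (∑ F ∈ M.faces, ∑ T ∈ M.adj F,
        ∫ x in F, inner ℝ (outerNormal T.1 F) (P.c x) * pval (v T) x ^ 2 ∂(surf d)) =
      1 / 2 * (∑ F ∈ M.faces \ P.faces₂₂ M,
        ∫ x in F, |inner ℝ (P.c x) (M.normal F)| * ‖M.jump v F x‖ ^ 2 ∂(surf d)) +
      1 / 2 * ∑ F ∈ P.faces₂₂ M,
        ∫ x in F, (2 * P.α x - inner ℝ (M.normal F) (P.c x)) * M.avg v F x ^ 2 ∂(surf d) := by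
    -- All sums are extended by zero to the set of all faces, so that the identity can be checked on
    -- each face according to its type.
    rw [← Finset.inter_eq_right.2 hsub1, ← Finset.sum_ite_mem M.faces (M.intFaces ∪ _),
      ← Finset.inter_eq_right.2 hsub2, ← Finset.sum_ite_mem M.faces (P.faces₂₂ M),
      ← Finset.sum_ite_mem M.faces (P.faces₂₂ M), Finset.inter_eq_right.2 hsub2,
      Finset.sdiff_eq_filter, Finset.sum_filter, Finset.mul_sum, Finset.mul_sum, Finset.mul_sum,
      ← Finset.sum_add_distrib, ← Finset.sum_sub_distrib, ← Finset.sum_add_distrib]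
    refine Finset.sum_congr rfl fun F hF => ?_
    by_cases h22 : F ∈ P.faces₂₂ M
    · have hnot : F ∉ M.intFaces ∪ P.faces₂₁ M := fun h => (Finset.mem_union.1 h).elim
        (fun h => S.notMem_bdryFaces h (S.mem_bdry_of_facesIn (S.faces₂₂_subset h22)))
        (S.notMem_faces₂₁ h22)
      rw [if_neg hnot, if_pos h22, if_neg (not_not.2 h22), if_pos h22, zero_add, mul_zero, zero_add]
      exact S.robin_face_identity h22 v
    · rw [if_neg h22, if_pos h22, if_neg h22, add_zero, mul_zero, add_zero]
      by_cases hup : F ∈ M.intFaces ∪ P.faces₂₁ M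
      · rw [if_pos hup]
        exact (Finset.mem_union.1 hup).elim (fun h => S.interior_face_identity h v)
          (fun h => S.outflow_face_identity h v)
      · rw [if_neg hup, zero_sub]
        rw [Finset.mem_union, not_or] at hup
        apply S.inflow_face_identity
        rcases S.face_cases hF with h | ⟨-, h | h | h | h⟩
        · exact absurd h hup.1
        · exact Or.inl h
        · exact absurd h hup.2
        · exact absurd h h22
        · exact Or.inr h
  have h4 : ∑ F ∈ M.intFaces ∪ P.faces₃ M,
      (θ * (∫ x in F, inner ℝ (P.avgFlux v F x) (M.jump v F x) ∂(surf d)) -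
        ∫ x in F, inner ℝ (P.avgFlux v F x - (η / Metric.diam F) • M.jump v F x)
          (M.jump v F x) ∂(surf d)) =
      (∑ F ∈ M.intFaces ∪ P.faces₃ M,
        η / Metric.diam F * ∫ x in F, ‖M.jump v F x‖ ^ 2 ∂(surf d)) -
      (1 - θ) * ∑ F ∈ M.intFaces ∪ P.faces₃ M,
        ∫ x in F, inner ℝ (P.avgFlux v F x) (M.jump v F x) ∂(surf d) := by
    rw [Finset.mul_sum, ← Finset.sum_sub_distrib]
    refine Finset.sum_congr rfl fun F hF => ?_
    rw [h1 F hF]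
    ring
  rw [Problem.aForm, Problem.energySq, h4, Finset.sum_congr rfl fun T _ => S.cell_identity v T,
    Finset.sum_sub_distrib, Finset.sum_add_distrib, ← Finset.mul_sum, ← Finset.mul_sum]
  have h2' := h2
  rw [← h2'] at h3
  linarith

end Setting

/-! ### Weighted trace inequalities -/

/-- The trace inequality for gradients, weighted with a constant positive semidefinite matrix. -/
theorem trace_le_of_const {d : ℕ} (hd : 2 ≤ d) {κ : PolyKind} {k : ℕ} {T F : Set (Pt d)}
    (hT : IsPolytope T) (hF : IsFacet T F) {c : ℝ}
    (htr : ∀ p ∈ κ.space d k,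
      Metric.diam F * ∫ x in F, pval p x ^ 2 ∂(surf d) ≤ c * ∫ x in T, pval p x ^ 2)
    {A : Pt d →L[ℝ] Pt d} (hs : ∀ ξ ζ, (inner ℝ (A ξ) ζ : ℝ) = inner ℝ ξ (A ζ))
    (hp : ∀ ξ, 0 ≤ (inner ℝ ξ (A ξ) : ℝ)) {p : MvPolynomial (Fin d) ℝ} (hpk : p ∈ κ.space d k) :
    Metric.diam F * ∫ x in F, inner ℝ (pgrad p x) (A (pgrad p x)) ∂(surf d) ≤
      c * ∫ x in T, inner ℝ (pgrad p x) (A (pgrad p x)) := by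
  -- In an orthonormal eigenbasis `ξ·Aξ` is a sum of `λᵢ (eᵢ·ξ)²` with `λᵢ ≥ 0`, and every `eᵢ·∇p`
  -- is again a polynomial of the space.
  have hsym : A.toLinearMap.IsSymmetric := fun ξ ζ => hs ξ ζ
  let e := hsym.eigenvectorBasis (n := d) (by simp)
  let ev := hsym.eigenvalues (n := d) (by simp)
  have hev : ∀ i, A (e i) = ev i • e i := fun i => hsym.apply_eigenvectorBasis (by simp) i
  have hev0 : ∀ i, 0 ≤ ev i := fun i => by
    have h := hp (e i)
    rwa [hev, inner_smul_right, real_inner_self_eq_norm_sq, e.orthonormal.1 i, one_pow,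
      mul_one] at h
  let q : Fin d → MvPolynomial (Fin d) ℝ := fun i => ∑ j, e i j • MvPolynomial.pderiv j p
  have hq : ∀ i, q i ∈ κ.space d k := fun i =>
    Submodule.sum_mem _ fun j _ => Submodule.smul_mem _ _ (pderiv_mem_space hpk j)
  have hqv : ∀ i x, (inner ℝ (e i) (pgrad p x) : ℝ) = pval (q i) x := fun i x => by
    simp [q, PiLp.inner_apply, pgrad_apply, mul_comm]
  have hquad : ∀ x, (inner ℝ (pgrad p x) (A (pgrad p x)) : ℝ) = ∑ i, ev i * pval (q i) x ^ 2 := by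
    intro x
    rw [← e.sum_inner_mul_inner]
    refine Finset.sum_congr rfl fun i _ => ?_
    rw [← hs, hev, real_inner_smul_left, hqv, real_inner_comm, hqv]
    ring
  simp only [hquad]
  rw [integral_finsetSum _ fun i _ => (hF.integrableOn hd hT
      (g := fun x => pval (q i) x ^ 2) (by fun_prop)).const_mul _,
    integral_finsetSum _ fun i _ => (hT.integrableOn
      (g := fun x => pval (q i) x ^ 2) (by fun_prop)).const_mul _,
    Finset.mul_sum, Finset.mul_sum]
  refine Finset.sum_le_sum fun i _ => ?_
  rw [integral_const_mul, integral_const_mul]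
  nlinarith [mul_le_mul_of_nonneg_left (htr (q i) (hq i)) (hev0 i)]

namespace Setting

variable {d : ℕ} {P : Problem d} {M : Mesh d P.Ω} {T F : Set (Pt d)}

variable (S : Setting P M)
include S

/-- Replace `K` by the constant `A` on the face, apply the inequality with constant weight, and
return from `A` to `K` on the element. -/
theorem weighted_trace_of_comparable (hT : T ∈ M.cells) (hF : IsFacet T F) {κ : PolyKind} {k : ℕ}
    {c : ℝ} (hc : 0 ≤ c) (htr : ∀ p ∈ κ.space d k,
      Metric.diam F * ∫ x in F, pval p x ^ 2 ∂(surf d) ≤ c * ∫ x in T, pval p x ^ 2)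
    {A : Pt d →L[ℝ] Pt d} (hs : ∀ ξ ζ, (inner ℝ (A ξ) ζ : ℝ) = inner ℝ ξ (A ζ))
    (hp : ∀ ξ, 0 ≤ (inner ℝ ξ (A ξ) : ℝ)) {a₁ a₂ : ℝ} (ha₁ : 0 ≤ a₁)
    (h₁ : ∀ x ∈ T, ∀ ξ : Pt d, (inner ℝ ξ (P.Kon T x ξ) : ℝ) ≤ a₁ * inner ℝ ξ (A ξ))
    (h₂ : ∀ x ∈ T, ∀ ξ : Pt d, (inner ℝ ξ (A ξ) : ℝ) ≤ a₂ * inner ℝ ξ (P.Kon T x ξ))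
    {p : MvPolynomial (Fin d) ℝ} (hpk : p ∈ κ.space d k) :
    Metric.diam F * ∫ x in F, inner ℝ (pgrad p x) (P.Kon T x (pgrad p x)) ∂(surf d) ≤
      a₁ * a₂ * c * ∫ x in T, inner ℝ (pgrad p x) (P.K x (pgrad p x)) := by
  have hTp := S.polytope hT
  have hg : Continuous (pgrad p) := by fun_prop
  have hA : Continuous fun x => (inner ℝ (pgrad p x) (A (pgrad p x)) : ℝ) := by fun_prop
  have e1 : ∫ x in F, (inner ℝ (pgrad p x) (P.Kon T x (pgrad p x)) : ℝ) ∂(surf d) ≤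
      a₁ * ∫ x in F, inner ℝ (pgrad p x) (A (pgrad p x)) ∂(surf d) := by
    rw [← integral_const_mul]
    refine setIntegral_mono_on (S.integrableOn_inner_Kon hT hF hg hg)
      ((hF.integrableOn S.two_le hTp hA.continuousOn).const_mul _)
      (hF.isClosed S.two_le hTp).measurableSet fun x hx => h₁ x (hF.subset hx) _
  have e2 : ∫ x in T, (inner ℝ (pgrad p x) (A (pgrad p x)) : ℝ) ≤
      a₂ * ∫ x in T, inner ℝ (pgrad p x) (P.K x (pgrad p x)) := by
    rw [S.integral_K_eq hT, ← integral_const_mul]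
    exact setIntegral_mono_on (hTp.integrableOn hA.continuousOn)
      ((hTp.integrableOn (S.continuousOn_Kon_apply hT hg.continuousOn hg.continuousOn)).const_mul _)
      hTp.isClosed.measurableSet fun x hx => h₂ x hx _
  have e3 := trace_le_of_const S.two_le hTp hF htr hs hp hpk
  calc Metric.diam F * ∫ x in F, inner ℝ (pgrad p x) (P.Kon T x (pgrad p x)) ∂(surf d)
      ≤ Metric.diam F * (a₁ * ∫ x in F, inner ℝ (pgrad p x) (A (pgrad p x)) ∂(surf d)) := by
        gcongr
    _ = a₁ * (Metric.diam F * ∫ x in F, inner ℝ (pgrad p x) (A (pgrad p x)) ∂(surf d)) := by ring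
    _ ≤ a₁ * (c * (a₂ * ∫ x in T, inner ℝ (pgrad p x) (P.K x (pgrad p x)))) := by
        exact mul_le_mul_of_nonneg_left (e3.trans (mul_le_mul_of_nonneg_left e2 hc)) ha₁
    _ = _ := by ring

/-- Comparison with the identity, using `k₀ ≤ K ≤ ‖K‖_∞`. -/
theorem weighted_trace_of_trace {k₀ : ℝ} (hk₀ : 0 < k₀)
    (hk : ∀ᵐ x ∂(volume.restrict P.Ω), ∀ ξ : Pt d, k₀ * ‖ξ‖ ^ 2 ≤ inner ℝ ξ (P.K x ξ))
    (hT : T ∈ M.cells) (hF : IsFacet T F) {κ : PolyKind} {k : ℕ}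
    {c : ℝ} (hc : 0 ≤ c) (htr : ∀ p ∈ κ.space d k,
      Metric.diam F * ∫ x in F, pval p x ^ 2 ∂(surf d) ≤ c * ∫ x in T, pval p x ^ 2)
    {p : MvPolynomial (Fin d) ℝ} (hpk : p ∈ κ.space d k) :
    Metric.diam F * ∫ x in F, inner ℝ (pgrad p x) (P.Kon T x (pgrad p x)) ∂(surf d) ≤
      P.normK * k₀⁻¹ * c * ∫ x in T, inner ℝ (pgrad p x) (P.K x (pgrad p x)) := by
  refine S.weighted_trace_of_comparable hT hF hc htr (A := ContinuousLinearMap.id ℝ (Pt d))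
    (fun ξ ζ => rfl) (fun ξ => real_inner_self_nonneg) S.normK_nonneg (fun x hx ξ => ?_)
    (fun x hx ξ => ?_) hpk
  · rw [ContinuousLinearMap.id_apply, real_inner_self_eq_norm_sq]
    calc (inner ℝ ξ (P.Kon T x ξ) : ℝ) ≤ ‖ξ‖ * ‖P.Kon T x ξ‖ := real_inner_le_norm _ _
      _ ≤ ‖ξ‖ * (P.normK * ‖ξ‖) := by
        gcongr
        exact (P.Kon T x).le_of_opNorm_le (S.norm_Kon_le hT hx) ξ
      _ = _ := by ring
  · rw [ContinuousLinearMap.id_apply, real_inner_self_eq_norm_sq, ← div_eq_inv_mul,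
      le_div_iff₀ hk₀, mul_comm]
    exact S.Kon_lower hk hT hx ξ

/-- If `K` varies little on an element, the trace constant is almost a weighted one. -/
theorem weighted_trace_of_oscillation {k₀ t : ℝ} (ht : 0 ≤ t)
    (hk : ∀ᵐ x ∂(volume.restrict P.Ω), ∀ ξ : Pt d, k₀ * ‖ξ‖ ^ 2 ≤ inner ℝ ξ (P.K x ξ))
    (hT : T ∈ M.cells) (hF : IsFacet T F) {κ : PolyKind} {k : ℕ}
    {c : ℝ} (hc : 0 ≤ c) (htr : ∀ p ∈ κ.space d k,
      Metric.diam F * ∫ x in F, pval p x ^ 2 ∂(surf d) ≤ c * ∫ x in T, pval p x ^ 2)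
    {x₀ : Pt d} (hx₀ : x₀ ∈ interior T)
    (hosc : ∀ y ∈ interior T, ‖P.K y - P.K x₀‖ ≤ t * k₀)
    {p : MvPolynomial (Fin d) ℝ} (hpk : p ∈ κ.space d k) :
    Metric.diam F * ∫ x in F, inner ℝ (pgrad p x) (P.Kon T x (pgrad p x)) ∂(surf d) ≤
      (1 + t) ^ 2 * c * ∫ x in T, inner ℝ (pgrad p x) (P.K x (pgrad p x)) := by
  have hx₀T := interior_subset hx₀
  set A := P.Kon T x₀
  have hA : A = P.K x₀ := S.Kon_eq hT hx₀
  have hclose : ∀ y ∈ T, ‖P.Kon T y - A‖ ≤ t * k₀ := by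
    intro y hy
    have hcl : y ∈ closure (interior T) := by rwa [(S.polytope hT).closure_interior]
    have h := ((S.continuousOn_Kon hT y hy).mono interior_subset).mem_closure hcl
      (t := Metric.closedBall A (t * k₀)) (fun z hz => by
        rw [Metric.mem_closedBall, dist_eq_norm, S.Kon_eq hT hz, hA]
        exact hosc z hz)
    rwa [Metric.isClosed_closedBall.closure_eq, Metric.mem_closedBall, dist_eq_norm] at h
  -- By ellipticity of `B'`, a perturbation of size `t k₀` is at most `t` times the form of `B'`.
  -- Used in both directions, this yields the factor `(1 + t)²`.
  have hcmp : ∀ (B B' : Pt d →L[ℝ] Pt d), ‖B - B'‖ ≤ t * k₀ →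
      (∀ ξ : Pt d, k₀ * ‖ξ‖ ^ 2 ≤ inner ℝ ξ (B' ξ)) → ∀ ξ : Pt d,
      (inner ℝ ξ (B ξ) : ℝ) ≤ (1 + t) * inner ℝ ξ (B' ξ) := by
    intro B B' hBB hB' ξ
    have h1 : (inner ℝ ξ ((B - B') ξ) : ℝ) ≤ t * (k₀ * ‖ξ‖ ^ 2) :=
      calc (inner ℝ ξ ((B - B') ξ) : ℝ) ≤ ‖ξ‖ * ‖(B - B') ξ‖ := real_inner_le_norm _ _
        _ ≤ ‖ξ‖ * (t * k₀ * ‖ξ‖) := by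
          gcongr
          exact (B - B').le_of_opNorm_le hBB ξ
        _ = _ := by ring
    have h2 := mul_le_mul_of_nonneg_left (hB' ξ) ht
    have h3 : (inner ℝ ξ ((B - B') ξ) : ℝ) = inner ℝ ξ (B ξ) - inner ℝ ξ (B' ξ) := by
      rw [← inner_sub_right]; rfl
    linarith
  rw [pow_two]
  refine S.weighted_trace_of_comparable hT hF hc htr (S.Kon_symm hT hx₀T) (S.Kon_nonneg hT hx₀T)
    (by positivity) (fun x hx => ?_) (fun x hx => ?_) hpk
  · exact hcmp _ _ (hclose x hx) (S.Kon_lower hk hT hx₀T)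
  · refine hcmp _ _ ?_ (S.Kon_lower hk hT hx)
    rw [norm_sub_rev]
    exact hclose x hx

/-! ### Coercivity -/

theorem diffusion_nonneg (v : M.Fn) (T : M.cells) :
    0 ≤ ∫ x in T.1, (inner ℝ (pgrad (v T) x) (P.K x (pgrad (v T) x)) : ℝ) := by
  rw [S.integral_K_eq T.2]
  exact setIntegral_nonneg (S.polytope T.2).isClosed.measurableSet fun x hx =>
    S.Kon_nonneg T.2 hx _

theorem reaction_nonneg (v : M.Fn) (T : M.cells) :
    0 ≤ ∫ x in T.1, (2 * P.r x + P.divc x) * pval (v T) x ^ 2 := by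
  apply integral_nonneg_of_ae
  filter_upwards [S.ae_cell S.sign.reaction T.2] with x hx
  have : 0 ≤ 2 * P.r x + P.divc x := by linarith
  positivity

theorem penalty_nonneg {η : ℝ} (hη : 0 ≤ η) (v : M.Fn) (F : Set (Pt d)) :
    0 ≤ η / Metric.diam F * ∫ x in F, ‖M.jump v F x‖ ^ 2 ∂(surf d) :=
  mul_nonneg (div_nonneg hη Metric.diam_nonneg) (integral_nonneg fun _ => sq_nonneg _)

theorem convection_nonneg (v : M.Fn) (F : Set (Pt d)) :
    0 ≤ ∫ x in F, |(inner ℝ (P.c x) (M.normal F) : ℝ)| * ‖M.jump v F x‖ ^ 2 ∂(surf d) :=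
  integral_nonneg fun _ => by positivity

theorem robin_nonneg (v : M.Fn) (hF : F ∈ P.faces₂₂ M) :
    0 ≤ ∫ x in F, (2 * P.α x - inner ℝ (M.normal F) (P.c x)) * M.avg v F x ^ 2 ∂(surf d) := by
  apply integral_nonneg_of_ae
  filter_upwards [S.sign.on₂₂ F hF] with x hx
  have : 0 ≤ 2 * P.α x - inner ℝ (M.normal F) (P.c x) := by linarith
  positivity

open scoped Classical in
/-- The energy is the sum of the diffusive energy, the penalty and nonnegative terms. -/
theorem exists_energySq_eq (η : ℝ) (v : M.Fn) : ∃ R : ℝ, 0 ≤ R ∧ P.energySq η v =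
    (∑ T : M.cells, ∫ x in T.1, inner ℝ (pgrad (v T) x) (P.K x (pgrad (v T) x))) +
    (∑ F ∈ M.intFaces ∪ P.faces₃ M,
      η / Metric.diam F * ∫ x in F, ‖M.jump v F x‖ ^ 2 ∂(surf d)) + R := by
  refine ⟨1 / 2 * (∑ T : M.cells, ∫ x in T.1, (2 * P.r x + P.divc x) * pval (v T) x ^ 2) +
    1 / 2 * (∑ F ∈ M.faces \ P.faces₂₂ M,
      ∫ x in F, |inner ℝ (P.c x) (M.normal F)| * ‖M.jump v F x‖ ^ 2 ∂(surf d)) +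
    1 / 2 * ∑ F ∈ P.faces₂₂ M,
      ∫ x in F, (2 * P.α x - inner ℝ (M.normal F) (P.c x)) * M.avg v F x ^ 2 ∂(surf d), ?_, ?_⟩
  · have h1 := Finset.sum_nonneg fun T (_ : T ∈ (Finset.univ : Finset M.cells)) =>
      S.reaction_nonneg v T
    have h2 := Finset.sum_nonneg fun F (_ : F ∈ M.faces \ P.faces₂₂ M) => S.convection_nonneg v F
    have h3 := Finset.sum_nonneg fun F (hF : F ∈ P.faces₂₂ M) => S.robin_nonneg v hF
    linarith
  · rw [Problem.energySq]
    ring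

theorem energySq_nonneg {η : ℝ} (hη : 0 ≤ η) (v : M.Fn) : 0 ≤ P.energySq η v := by
  classical
  obtain ⟨R, hR, h⟩ := S.exists_energySq_eq η v
  rw [h]
  have h1 := Finset.sum_nonneg fun T (_ : T ∈ (Finset.univ : Finset M.cells)) =>
    S.diffusion_nonneg v T
  have h2 := Finset.sum_nonneg fun F (_ : F ∈ M.intFaces ∪ P.faces₃ M) => S.penalty_nonneg hη v F
  linarith

theorem energyNorm_sq {η : ℝ} (hη : 0 ≤ η) (v : M.Fn) :
    P.energyNorm η v ^ 2 = P.energySq η v := by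
  rw [Problem.energyNorm, Real.sq_sqrt (S.energySq_nonneg hη v)]

theorem card_adj_pos (hF : F ∈ M.faces) : 0 < ((M.adj F).card : ℝ) := by
  obtain ⟨T, hT, hTF⟩ := (M.mem_faces F).1 hF
  have : (⟨T, hT⟩ : M.cells) ∈ M.adj F := M.mem_adj.2 hTF
  exact_mod_cast Finset.card_pos.2 ⟨_, this⟩

/-- Young's inequality with `s = δ h_F / D` for each adjacent element: the trace inequality turns
the first part into `δ/2` times the energy of the element, and the second part carries exactly the
factor `1 / h_F` of the penalty. -/
theorem consistency_face_le (hF : F ∈ M.faces) (v : M.Fn) {D δ : ℝ} (hD : 0 < D) (hδ : 0 < δ)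
    (htr : ∀ T : M.cells, IsFacet T.1 F →
      Metric.diam F * ∫ x in F, inner ℝ (pgrad (v T) x) (P.Kon T.1 x (pgrad (v T) x)) ∂(surf d) ≤
        D * ∫ x in T.1, inner ℝ (pgrad (v T) x) (P.K x (pgrad (v T) x))) :
    |∫ x in F, (inner ℝ (P.avgFlux v F x) (M.jump v F x) : ℝ) ∂(surf d)| ≤
      (∑ T ∈ M.adj F, ((M.adj F).card : ℝ)⁻¹ *
        (δ / 2 * ∫ x in T.1, inner ℝ (pgrad (v T) x) (P.K x (pgrad (v T) x)))) +
      P.normK * D / (2 * δ) *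
        (1 / Metric.diam F * ∫ x in F, ‖M.jump v F x‖ ^ 2 ∂(surf d)) := by
  have hh := S.diam_pos hF
  have hcard := S.card_adj_pos hF
  set h := Metric.diam F
  set m := ((M.adj F).card : ℝ)
  set s := δ * h / D with hs_def
  have h_s : 0 < s := by positivity
  have hj := M.continuous_jump v F
  have iJ := S.integrableOn_face hF (f := fun x => ‖M.jump v F x‖ ^ 2) (by fun_prop)
  have iK : ∀ T ∈ M.adj F, IntegrableOn
      (fun x => (inner ℝ (pgrad (v T) x) (P.Kon T.1 x (pgrad (v T) x)) : ℝ)) F (surf d) :=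
    fun T hT => S.integrableOn_inner_Kon T.2 (M.mem_adj.1 hT) (continuous_pgrad _)
      (continuous_pgrad _)
  have iS : ∀ T ∈ M.adj F, IntegrableOn (fun x => m⁻¹ * (s / 2 *
      inner ℝ (pgrad (v T) x) (P.Kon T.1 x (pgrad (v T) x)) +
      P.normK / (2 * s) * ‖M.jump v F x‖ ^ 2)) F (surf d) :=
    fun T hT => (((iK T hT).const_mul _).add (iJ.const_mul _)).const_mul _
  have step1 : |∫ x in F, (inner ℝ (P.avgFlux v F x) (M.jump v F x) : ℝ) ∂(surf d)| ≤
      ∫ x in F, ∑ T ∈ M.adj F, m⁻¹ * (s / 2 *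
        inner ℝ (pgrad (v T) x) (P.Kon T.1 x (pgrad (v T) x)) +
        P.normK / (2 * s) * ‖M.jump v F x‖ ^ 2) ∂(surf d) := by
    refine (abs_integral_le_integral_abs).trans ?_
    refine setIntegral_mono_on (S.integrableOn_avgFlux_jump F v v).abs
      (integrable_finsetSum _ iS) (S.measurableSet_face hF) fun x hx => ?_
    rw [Problem.avgFlux, real_inner_smul_left, sum_inner, Finset.mul_sum]
    refine (Finset.abs_sum_le_sum_abs _ _).trans (Finset.sum_le_sum fun T hT => ?_)
    rw [abs_mul, abs_of_nonneg (by positivity : (0 : ℝ) ≤ ((M.adj F).card : ℝ)⁻¹)]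
    gcongr
    exact S.abs_inner_Kon_le T.2 ((M.mem_adj.1 hT).subset hx) h_s _ _
  refine step1.trans ?_
  rw [integral_finsetSum _ iS]
  have hconst : P.normK * D / (2 * δ) *
      (1 / h * ∫ x in F, ‖M.jump v F x‖ ^ 2 ∂(surf d)) =
      ∑ T ∈ M.adj F, m⁻¹ * (P.normK / (2 * s) * ∫ x in F, ‖M.jump v F x‖ ^ 2 ∂(surf d)) := by
    rw [Finset.sum_const, nsmul_eq_mul, mul_inv_cancel_left₀ hcard.ne', hs_def]
    field_simp
  rw [hconst, ← Finset.sum_add_distrib]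
  refine Finset.sum_le_sum fun T hT => ?_
  rw [integral_const_mul, integral_add ((iK T hT).const_mul _) (iJ.const_mul _),
    integral_const_mul, integral_const_mul, ← mul_add]
  refine mul_le_mul_of_nonneg_left (add_le_add_left ?_ _) (inv_nonneg.2 hcard.le)
  have h1 := htr T (M.mem_adj.1 hT)
  calc s / 2 * ∫ x in F, inner ℝ (pgrad (v T) x) (P.Kon T.1 x (pgrad (v T) x)) ∂(surf d)
      = δ / (2 * D) *
        (h * ∫ x in F, inner ℝ (pgrad (v T) x) (P.Kon T.1 x (pgrad (v T) x)) ∂(surf d)) := by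
        rw [hs_def]; field_simp
    _ ≤ δ / (2 * D) *
        (D * ∫ x in T.1, inner ℝ (pgrad (v T) x) (P.K x (pgrad (v T) x))) := by gcongr
    _ = _ := by field_simp

open scoped Classical in
theorem consistency_le {κ : PolyKind} (hN : M.HasElementsOf κ) (v : M.Fn) {D δ W : ℝ}
    (hD : 0 < D) (hδ : 0 < δ)
    (hW : ∀ F ∈ M.intFaces ∪ P.faces₃ M, ((M.adj F).card : ℝ)⁻¹ ≤ W)
    (hW0 : 0 ≤ W)
    (htr : ∀ (T : M.cells) F, IsFacet T.1 F →
      Metric.diam F * ∫ x in F, inner ℝ (pgrad (v T) x) (P.Kon T.1 x (pgrad (v T) x)) ∂(surf d) ≤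
        D * ∫ x in T.1, inner ℝ (pgrad (v T) x) (P.K x (pgrad (v T) x))) :
    ∑ F ∈ M.intFaces ∪ P.faces₃ M,
      ∫ x in F, (inner ℝ (P.avgFlux v F x) (M.jump v F x) : ℝ) ∂(surf d) ≤
      δ / 2 * W * κ.numFaces d *
        (∑ T : M.cells, ∫ x in T.1, inner ℝ (pgrad (v T) x) (P.K x (pgrad (v T) x))) +
      P.normK * D / (2 * δ) * ∑ F ∈ M.intFaces ∪ P.faces₃ M,
        1 / Metric.diam F * ∫ x in F, ‖M.jump v F x‖ ^ 2 ∂(surf d) := by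
  have hmem : ∀ F ∈ M.intFaces ∪ P.faces₃ M, F ∈ M.faces := fun F hF =>
    S.mem_faces_of_penalty (Finset.mem_union.1 hF)
  have hE := fun T => S.diffusion_nonneg v T
  set E : M.cells → ℝ := fun T => ∫ x in T.1, inner ℝ (pgrad (v T) x) (P.K x (pgrad (v T) x))
  have h1 : ∑ F ∈ M.intFaces ∪ P.faces₃ M, ∑ T ∈ M.adj F,
      ((M.adj F).card : ℝ)⁻¹ * (δ / 2 * E T) ≤ δ / 2 * W * κ.numFaces d * ∑ T, E T := by
    calc ∑ F ∈ M.intFaces ∪ P.faces₃ M, ∑ T ∈ M.adj F, ((M.adj F).card : ℝ)⁻¹ * (δ / 2 * E T)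
        ≤ ∑ F ∈ M.intFaces ∪ P.faces₃ M, ∑ T ∈ M.adj F, W * (δ / 2 * E T) := by
          refine Finset.sum_le_sum fun F hF => Finset.sum_le_sum fun T _ => ?_
          exact mul_le_mul_of_nonneg_right (hW F hF) (mul_nonneg (by positivity) (hE T))
      _ ≤ ∑ F ∈ M.faces, ∑ T ∈ M.adj F, W * (δ / 2 * E T) := by
          refine Finset.sum_le_sum_of_subset_of_nonneg hmem fun F _ _ =>
            Finset.sum_nonneg fun T _ => mul_nonneg hW0 (mul_nonneg (by positivity) (hE T))
      -- Counting by elements, each energy occurs once for each face of the element.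
      _ = ∑ T : M.cells, ∑ F ∈ M.faces with IsFacet T.1 F, W * (δ / 2 * E T) :=
          Finset.sum_comm' fun F T => by simp [M.mem_adj, and_comm]
      _ = ∑ T : M.cells, κ.numFaces d * (W * (δ / 2 * E T)) := by
          refine Finset.sum_congr rfl fun T _ => ?_
          rw [Finset.sum_const, hN T.1 T.2, nsmul_eq_mul]
      _ = _ := by
          rw [Finset.mul_sum]
          exact Finset.sum_congr rfl fun T _ => by ring
  calc ∑ F ∈ M.intFaces ∪ P.faces₃ M,
      ∫ x in F, (inner ℝ (P.avgFlux v F x) (M.jump v F x) : ℝ) ∂(surf d)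
      ≤ ∑ F ∈ M.intFaces ∪ P.faces₃ M, ((∑ T ∈ M.adj F, ((M.adj F).card : ℝ)⁻¹ * (δ / 2 * E T)) +
        P.normK * D / (2 * δ) *
          (1 / Metric.diam F * ∫ x in F, ‖M.jump v F x‖ ^ 2 ∂(surf d))) :=
        Finset.sum_le_sum fun F hF => (le_abs_self _).trans
          (S.consistency_face_le (hmem F hF) v hD hδ fun T hT => htr T F hT)
    _ ≤ _ := by
        rw [Finset.sum_add_distrib, ← Finset.mul_sum]
        gcongr

end Setting

/-- In the application `X = 1 - θ` and `B = ‖K‖_∞`. Choose `q < 1` with `X² W N D B ≤ 4 η q²` and `a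
= 1 - q`; then `δ = X B D / (2 η q)` makes the second inequality an equality, and the first becomes
the choice of `q`. -/
theorem exists_young_parameters {X W N B D η : ℝ} (hX : 0 ≤ X) (hW : 0 ≤ W) (hN : 0 ≤ N)
    (hB : 0 ≤ B) (hD : 0 < D) (hη : 0 < η) (h : X ^ 2 * W * N * D * B < 4 * η) :
    ∃ δ a : ℝ, 0 < δ ∧ 0 < a ∧ a ≤ 1 ∧ X * (δ / 2 * W * N) ≤ 1 - a ∧
      X * (B * D / (2 * δ)) ≤ (1 - a) * η := by
  -- `δ` is the geometric compromise between the two constraints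
  obtain ⟨q, hq0, hq1, hq⟩ : ∃ q : ℝ, 0 < q ∧ q < 1 ∧ X ^ 2 * W * N * D * B ≤ 4 * η * q ^ 2 := by
    have hc : Filter.Tendsto (fun q : ℝ => 4 * η * q ^ 2) (nhdsWithin 1 (Iio 1))
        (nhds (4 * η * 1 ^ 2)) :=
      ((by fun_prop : Continuous fun q : ℝ => 4 * η * q ^ 2).tendsto 1).mono_left
        nhdsWithin_le_nhds
    have h1 := hc.eventually (lt_mem_nhds (by linarith : X ^ 2 * W * N * D * B < 4 * η * 1 ^ 2))
    obtain ⟨q, h2, h3⟩ := (h1.and (Ioo_mem_nhdsLT (zero_lt_one (α := ℝ)))).exists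
    exact ⟨q, h3.1, h3.2, h2.le⟩
  -- Here the general `δ` would be zero, but the second constraint is void and `δ` only has to
  -- satisfy the first.
  by_cases hz : X * B = 0
  · by_cases hXWN : X * W * N = 0
    · refine ⟨1, 1, one_pos, one_pos, le_rfl, ?_, ?_⟩
      · rw [show X * (1 / 2 * W * N) = X * W * N / 2 by ring, hXWN]; simp
      · rw [show X * (B * D / (2 * 1)) = X * B * D / 2 by ring, hz]; simp
    · have hpos : 0 < X * W * N := lt_of_le_of_ne (by positivity) (Ne.symm hXWN)
      refine ⟨1 / (X * W * N), 1 / 2, by positivity, by norm_num, by norm_num, ?_, ?_⟩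
      · rw [show X * (1 / (X * W * N) / 2 * W * N) = 1 / (X * W * N) * (X * W * N) / 2 by ring,
          one_div_mul_cancel hpos.ne']
        norm_num
      · rw [show X * (B * D / (2 * (1 / (X * W * N)))) =
          X * B * (D / (2 * (1 / (X * W * N)))) by ring, hz, zero_mul]
        positivity
  · have hXB : 0 < X * B := lt_of_le_of_ne (by positivity) (Ne.symm hz)
    refine ⟨X * B * D / (2 * η * q), 1 - q, by positivity, by linarith, by linarith, ?_, ?_⟩
    · rw [show X * (X * B * D / (2 * η * q) / 2 * W * N) =
        X ^ 2 * W * N * D * B / (4 * η * q) by field_simp; ring, sub_sub_cancel,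
        div_le_iff₀ (by positivity)]
      linarith
    · apply le_of_eq
      have hX0 : X ≠ 0 := left_ne_zero_of_mul hz
      have hB0 : B ≠ 0 := right_ne_zero_of_mul hz
      field_simp
      ring

/-- The penalty condition, in terms of a bound `D` for the square of the trace constant. -/
def PenaltyBound {d : ℕ} (P : Problem d) (κ : PolyKind) (D θ η : ℝ) : Prop :=
  (1 - θ) ^ 2 * κ.numFaces d * D * P.normK < 4 * η ∨
    (P.Γ₃ = ∅ ∧ (1 - θ) * κ.numFaces d * D * P.normK < 4 * η)

/-- The constant is chosen before the partition, so uniformity in `h` reduces to a uniform bound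
`D`. The trace inequality is required only for the polynomials of the given `v`. -/
theorem exists_coercivity_const {d : ℕ} {P : Problem d} {κ : PolyKind} {D θ η : ℝ} (hD : 0 < D)
    (hθ : θ = 0 ∨ θ = 1 ∨ θ = -1) (hpen : PenaltyBound P κ D θ η) :
    ∃ a : ℝ, 0 < a ∧ ∀ (M : Mesh d P.Ω), Setting P M → M.HasElementsOf κ → ∀ v : M.Fn,
      (∀ (T : M.cells) F, IsFacet T.1 F →
        Metric.diam F *
          ∫ x in F, inner ℝ (pgrad (v T) x) (P.Kon T.1 x (pgrad (v T) x)) ∂(surf d) ≤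
        D * ∫ x in T.1, inner ℝ (pgrad (v T) x) (P.K x (pgrad (v T) x))) →
      a * P.energyNorm η v ^ 2 ≤ P.aForm θ η v v := by
  classical
  have hK : 0 ≤ P.normK := ENNReal.toReal_nonneg
  have hX : 0 ≤ 1 - θ := by rcases hθ with rfl | rfl | rfl <;> norm_num
  have hX2 : 1 - θ ≤ 2 := by rcases hθ with rfl | rfl | rfl <;> norm_num
  have hN : (0 : ℝ) ≤ κ.numFaces d := Nat.cast_nonneg _
  have hη : 0 < η := by
    rcases hpen with h | ⟨-, h⟩
    · have : 0 ≤ (1 - θ) ^ 2 * κ.numFaces d * D * P.normK := by positivity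
      linarith
    · have : 0 ≤ (1 - θ) * κ.numFaces d * D * P.normK := by positivity
      linarith
  -- In general `W = 1`. If `Γ₃ = ∅`, all penalized faces are interior and `W = 1/2`; since `1 - θ ≤
  -- 2`, then `(1 - θ)² W ≤ 1 - θ`.
  obtain ⟨W, hW0, hcond, hW⟩ : ∃ W : ℝ, 0 ≤ W ∧
      (1 - θ) ^ 2 * W * κ.numFaces d * D * P.normK < 4 * η ∧
      ∀ (M : Mesh d P.Ω), Setting P M →
        ∀ F ∈ M.intFaces ∪ P.faces₃ M, ((M.adj F).card : ℝ)⁻¹ ≤ W := by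
    rcases hpen with h | ⟨hΓ, h⟩
    · refine ⟨1, zero_le_one, by rwa [mul_one], fun M S F hF => ?_⟩
      have h1 := S.card_adj_pos (S.mem_faces_of_penalty (Finset.mem_union.1 hF))
      exact inv_le_one_of_one_le₀ (by exact_mod_cast h1)
    · refine ⟨1 / 2, by norm_num, ?_, fun M S F hF => ?_⟩
      · refine lt_of_le_of_lt ?_ h
        have h2 : (1 - θ) ^ 2 * (1 / 2) ≤ 1 - θ := by nlinarith
        gcongr
      · rcases Finset.mem_union.1 hF with h1 | h1
        · obtain ⟨-, -, -, -, -, -, -, hc⟩ := M.exists_adj_of_mem_intFaces S.two_le h1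
          rw [hc]; norm_num
        · exfalso
          have hf := S.facesIn_subset h1
          change F ∈ P.facesIn M P.Γ₃ at h1
          rw [Problem.facesIn, Finset.mem_filter, hΓ, sdiff_empty] at h1
          exact (S.surf_pos hf).ne' h1.2
  obtain ⟨δ, a, hδ, ha, ha1, h1, h2⟩ :=
    exists_young_parameters hX hW0 hN hK hD hη hcond
  refine ⟨a, ha, fun M S hMN v htr => ?_⟩
  have hcons := S.consistency_le hMN v hD hδ (hW M S) hW0 htr
  obtain ⟨R, hR, hen⟩ := S.exists_energySq_eq η v
  rw [S.energyNorm_sq hη.le, S.aForm_self]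
  have hE := Finset.sum_nonneg fun T (_ : T ∈ (Finset.univ : Finset M.cells)) =>
    S.diffusion_nonneg v T
  have hJ : 0 ≤ ∑ F ∈ M.intFaces ∪ P.faces₃ M,
      1 / Metric.diam F * ∫ x in F, ‖M.jump v F x‖ ^ 2 ∂(surf d) :=
    Finset.sum_nonneg fun F _ => S.penalty_nonneg zero_le_one v F
  have hJη : ∑ F ∈ M.intFaces ∪ P.faces₃ M,
      η / Metric.diam F * ∫ x in F, ‖M.jump v F x‖ ^ 2 ∂(surf d) =
      η * ∑ F ∈ M.intFaces ∪ P.faces₃ M,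
        1 / Metric.diam F * ∫ x in F, ‖M.jump v F x‖ ^ 2 ∂(surf d) := by
    rw [Finset.mul_sum]
    exact Finset.sum_congr rfl fun F _ => by ring
  rw [hJη] at hen
  rw [hen]
  set E := ∑ T : M.cells, ∫ x in T.1, (inner ℝ (pgrad (v T) x) (P.K x (pgrad (v T) x)) : ℝ)
  set J := ∑ F ∈ M.intFaces ∪ P.faces₃ M,
    1 / Metric.diam F * ∫ x in F, ‖M.jump v F x‖ ^ 2 ∂(surf d)
  have h3 := mul_le_mul_of_nonneg_left hcons hX
  have h4 := mul_le_mul_of_nonneg_right h1 hE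
  have h5 := mul_le_mul_of_nonneg_right h2 hJ
  have h6 : a * R ≤ R := mul_le_of_le_one_left hR ha1
  nlinarith

/-- The strict penalty condition survives a small enlargement of `C²`. The factor `(1 + t)²` leaves
room for the oscillation of `K`; the summand `t` keeps the bound positive even for `C = 0`. -/
theorem exists_penalty_margin {d : ℕ} {P : Problem d} {κ : PolyKind} {C θ η : ℝ}
    (h : P.PenaltyCondition κ C θ η) :
    ∃ t : ℝ, 0 < t ∧ PenaltyBound P κ ((1 + t) ^ 2 * C ^ 2 + t) θ η := by
  have key : ∀ X : ℝ, X * C ^ 2 * P.normK < 4 * η →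
      ∃ t : ℝ, 0 < t ∧ X * ((1 + t) ^ 2 * C ^ 2 + t) * P.normK < 4 * η := by
    intro X hX
    have hc : Filter.Tendsto (fun t : ℝ => X * ((1 + t) ^ 2 * C ^ 2 + t) * P.normK)
        (nhdsWithin 0 (Ioi 0)) (nhds (X * ((1 + 0) ^ 2 * C ^ 2 + 0) * P.normK)) :=
      ((by fun_prop : Continuous fun t : ℝ =>
        X * ((1 + t) ^ 2 * C ^ 2 + t) * P.normK).tendsto 0).mono_left nhdsWithin_le_nhds
    obtain ⟨t, h1, h2⟩ := ((hc.eventually (gt_mem_nhds (by simpa using hX))).and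
      self_mem_nhdsWithin).exists
    exact ⟨t, h2, h1⟩
  rcases h with h | ⟨hΓ, h⟩
  · obtain ⟨t, ht, h1⟩ := key _ h
    exact ⟨t, ht, Or.inl h1⟩
  · obtain ⟨t, ht, h1⟩ := key _ h
    exact ⟨t, ht, Or.inr ⟨hΓ, h1⟩⟩

/-! ### Oscillation of `K` on small elements -/

/-- Lebesgue outer measure is subadditive and bounded by the diameter, so the covering sets need not
be measurable. -/
theorem le_card_mul_of_Icc_subset {ι : Type*} (s : Finset ι) (A : ι → Set ℝ) {L e : ℝ} (he : 0 ≤ e)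
    (hcov : Icc 0 L ⊆ ⋃ i ∈ s, A i) (hA : ∀ i ∈ s, ∀ x ∈ A i, ∀ y ∈ A i, dist x y ≤ e) :
    L ≤ s.card * e := by
  have h1 : volume (Icc 0 L) ≤ ∑ i ∈ s, volume (A i) :=
    (measure_mono hcov).trans (measure_biUnion_finset_le s A)
  have h2 : ∑ i ∈ s, volume (A i) ≤ ∑ _i ∈ s, ENNReal.ofReal e :=
    Finset.sum_le_sum fun i hi => (Real.volume_le_diam _).trans (Metric.ediam_le fun x hx y hy => by
      rw [edist_dist]
      exact ENNReal.ofReal_le_ofReal (hA i hi x hx y hy))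
  have h3 := h1.trans h2
  rw [Real.volume_Icc, sub_zero, Finset.sum_const, nsmul_eq_mul, ← ENNReal.ofReal_natCast,
    ← ENNReal.ofReal_mul (Nat.cast_nonneg _)] at h3
  exact (ENNReal.ofReal_le_ofReal_iff (by positivity)).1 h3

namespace Setting

variable {d : ℕ} {P : Problem d}

/-- The extensions of `K` from the elements of two partitions agree on overlapping elements. -/
theorem Kon_eq_of_mem {M M₀ : Mesh d P.Ω} (S : Setting P M) (S₀ : Setting P M₀)
    {T T₀ : Set (Pt d)} (hT : T ∈ M.cells) (hT₀ : T₀ ∈ M₀.cells) {x : Pt d} (hx : x ∈ interior T)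
    (hx₀ : x ∈ T₀) : P.Kon T x = P.Kon T₀ x := by
  have hcl : x ∈ closure (interior T ∩ interior T₀) := by
    rw [← (S₀.polytope hT₀).closure_interior] at hx₀
    exact isOpen_interior.inter_closure ⟨hx, hx₀⟩
  have hne : (nhdsWithin x (interior T ∩ interior T₀)).NeBot := mem_closure_iff_nhdsWithin_neBot.1 hcl
  have hx₀' : x ∈ T₀ := hx₀
  have h1 : Filter.Tendsto (P.Kon T) (nhdsWithin x (interior T ∩ interior T₀))
      (nhds (P.Kon T x)) :=
    (S.continuousOn_Kon hT x (interior_subset hx)).mono (inter_subset_left.trans interior_subset)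
  have h2 : Filter.Tendsto (P.Kon T₀) (nhdsWithin x (interior T ∩ interior T₀))
      (nhds (P.Kon T₀ x)) :=
    (S₀.continuousOn_Kon hT₀ x hx₀').mono (inter_subset_right.trans interior_subset)
  refine tendsto_nhds_unique h1 (h2.congr' ?_)
  filter_upwards [self_mem_nhdsWithin] with y hy
  rw [S.Kon_eq hT hy.1, S₀.Kon_eq hT₀ hy.2]

/-- Continuity of `K` on the elements of one partition controls the oscillation on the small
elements of every other partition. -/
theorem exists_oscillation_bound {M₀ : Mesh d P.Ω} (S₀ : Setting P M₀) {ε : ℝ} (hε : 0 < ε) :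
    ∃ h₀ : ℝ, 0 < h₀ ∧ ∀ (M : Mesh d P.Ω), Setting P M → ∀ T ∈ M.cells, Metric.diam T ≤ h₀ →
      ∀ x ∈ interior T, ∀ y ∈ interior T, ‖P.K y - P.K x‖ ≤ ε := by
  classical
  -- The segment from `x` to `y` may pass through every element of the reference partition, each
  -- contributing at most `e`; the `+ 1` keeps the denominator positive.
  set e := ε / (M₀.cells.card + 1) with he_def
  have he : 0 < e := by positivity
  have huc : ∀ T₀ : M₀.cells, ∃ δ : ℝ, 0 < δ ∧ ∀ x ∈ T₀.1, ∀ y ∈ T₀.1, dist x y < δ →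
      dist (P.Kon T₀.1 x) (P.Kon T₀.1 y) < e := fun T₀ =>
    let ⟨δ, h1, h2⟩ := Metric.uniformContinuousOn_iff.1
      ((S₀.polytope T₀.2).isCompact.uniformContinuousOn_of_continuous
        (S₀.continuousOn_Kon T₀.2)) e he
    ⟨δ, h1, fun x hx y hy => h2 x hx y hy⟩
  choose δ hδ hδK using huc
  obtain ⟨h₀, hh₀, hle⟩ : ∃ h₀ : ℝ, 0 < h₀ ∧ ∀ T₀, h₀ < δ T₀ := by
    have h1 : ∀ᶠ h in nhdsWithin (0 : ℝ) (Ioi 0), ∀ T₀, h < δ T₀ :=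
      Filter.eventually_all.2 fun T₀ => nhdsWithin_le_nhds (gt_mem_nhds (hδ T₀))
    obtain ⟨h, h2, h3⟩ := (h1.and self_mem_nhdsWithin).exists
    exact ⟨h, h3, h2⟩
  refine ⟨h₀, hh₀, fun M S T hT hdiam x hx y hy => ?_⟩
  have hTp := S.polytope hT
  have hseg : ∀ t ∈ Icc (0 : ℝ) 1, AffineMap.lineMap x y t ∈ interior T := fun t ht =>
    hTp.convex.interior.lineMap_mem hx hy ht
  -- By the intermediate value theorem `f` attains all values between `0` and `f 1`. These values
  -- are sorted by reference elements, on each of which `f` varies by at most `e`; the order of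
  -- crossing is irrelevant.
  let f : ℝ → ℝ := fun t => dist (P.Kon T (AffineMap.lineMap x y t)) (P.Kon T x)
  have hf : ContinuousOn f (Icc 0 1) :=
    continuous_dist.comp_continuousOn (ContinuousOn.prodMk
      ((S.continuousOn_Kon hT).comp (AffineMap.lineMap_continuous (p := x) (q := y)).continuousOn
        fun t ht => interior_subset (hseg t ht)) continuousOn_const)
  have hf0 : f 0 = 0 := by simp [f]
  have hf1 : f 1 = ‖P.K y - P.K x‖ := by
    simp only [f, AffineMap.lineMap_apply_one, S.Kon_eq hT hx, S.Kon_eq hT hy, dist_eq_norm]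
  have hivt := intermediate_value_Icc zero_le_one hf
  rw [hf0] at hivt
  have hcov : Icc 0 (f 1) ⊆ ⋃ T₀ ∈ (Finset.univ : Finset M₀.cells),
      f '' {t | t ∈ Icc (0 : ℝ) 1 ∧ AffineMap.lineMap x y t ∈ T₀.1} := by
    intro z hz
    obtain ⟨t, ht, rfl⟩ := hivt hz
    have h1 : AffineMap.lineMap x y t ∈ closure P.Ω :=
      _root_.subset_closure (M.interior_subset_domain S.adm.regular hT (hseg t ht))
    rw [M₀.covers] at h1
    obtain ⟨T₀, hT₀, h2⟩ := mem_iUnion₂.1 h1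
    exact mem_iUnion₂.2 ⟨⟨T₀, hT₀⟩, Finset.mem_univ _, t, ⟨ht, h2⟩, rfl⟩
  have hdist : ∀ T₀ ∈ (Finset.univ : Finset M₀.cells),
      ∀ a ∈ f '' {t | t ∈ Icc (0 : ℝ) 1 ∧ AffineMap.lineMap x y t ∈ T₀.1},
      ∀ b ∈ f '' {t | t ∈ Icc (0 : ℝ) 1 ∧ AffineMap.lineMap x y t ∈ T₀.1}, dist a b ≤ e := by
    rintro T₀ - _ ⟨s, ⟨hs, hsT⟩, rfl⟩ _ ⟨t, ⟨ht, htT⟩, rfl⟩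
    refine (dist_dist_dist_le_left _ _ _).trans ?_
    rw [S.Kon_eq_of_mem S₀ hT T₀.2 (hseg s hs) hsT, S.Kon_eq_of_mem S₀ hT T₀.2 (hseg t ht) htT]
    refine (hδK T₀ _ hsT _ htT (lt_of_le_of_lt ?_ (hle T₀))).le
    exact (Metric.dist_le_diam_of_mem hTp.isCompact.isBounded (interior_subset (hseg s hs))
      (interior_subset (hseg t ht))).trans hdiam
  have h := le_card_mul_of_Icc_subset _ _ he.le hcov hdist
  rw [hf1] at h
  refine h.trans ?_
  rw [Finset.card_univ, Fintype.card_coe, he_def, mul_div_assoc', div_le_iff₀ (by positivity)]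
  nlinarith

end Setting

/-! ### Trace constants and uniform coercivity for families -/

section Family

variable {d : ℕ} {P : Problem d} {ι : Type*} {M : ι → Mesh d P.Ω} {κ : PolyKind} {k : ℕ}

theorem mem_space_of_mem_brokenPoly {M : Mesh d P.Ω} {v : M.Fn} (hv : v ∈ M.brokenPoly κ k)
    (T : M.cells) : v T ∈ κ.space d k := hv T (mem_univ T)

theorem exists_isWeightedTraceConst (S : ∀ i, Setting P (M i)) (hP : P.Admissible) {C : ℝ}
    (h : IsTraceConst M κ k C) : ∃ C' : ℝ, 0 < C' ∧ P.IsWeightedTraceConst M κ k C' := by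
  obtain ⟨k₀, hk₀, hk⟩ := hP.K_pos
  have hK : 0 ≤ P.normK := ENNReal.toReal_nonneg
  have h0 : 0 ≤ P.normK * k₀⁻¹ * C ^ 2 := by positivity
  refine ⟨√(P.normK * k₀⁻¹ * C ^ 2) + 1, by positivity, fun i T hT F hF p hp => ?_⟩
  refine ((S i).weighted_trace_of_trace hk₀ hk hT hF (sq_nonneg C) (h i T hT F hF) hp).trans ?_
  refine mul_le_mul_of_nonneg_right ?_ ((S i).diffusion_nonneg (fun _ => p) ⟨T, hT⟩)
  nlinarith [Real.sq_sqrt h0, Real.sqrt_nonneg (P.normK * k₀⁻¹ * C ^ 2)]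

theorem exists_coercivity_of_isWeightedTraceConst (S : ∀ i, Setting P (M i))
    (hkind : ∀ i, (M i).HasElementsOf κ) {C θ η : ℝ} (hC : P.IsWeightedTraceConst M κ k C)
    (hθ : θ = 0 ∨ θ = 1 ∨ θ = -1) (hpen : P.PenaltyCondition κ C θ η) :
    ∃ a : ℝ, 0 < a ∧ ∀ i, ∀ v ∈ (M i).brokenPoly κ k,
      a * P.energyNorm η v ^ 2 ≤ P.aForm θ η v v := by
  obtain ⟨t, ht, hb⟩ := exists_penalty_margin hpen
  obtain ⟨a, ha, h⟩ := exists_coercivity_const (by positivity) hθ hb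
  refine ⟨a, ha, fun i v hv => h (M i) (S i) (hkind i) v fun T F hF => ?_⟩
  refine (hC i T.1 T.2 F hF _ (mem_space_of_mem_brokenPoly hv T)).trans ?_
  refine mul_le_mul_of_nonneg_right ?_ ((S i).diffusion_nonneg v T)
  nlinarith [mul_nonneg ht.le (sq_nonneg C), mul_nonneg (sq_nonneg t) (sq_nonneg C)]

/-- The margin `t` of the penalty condition fixes the tolerated oscillation `t k₀`, and any member
of the family can act as the reference partition that determines `h₀`. For elementwise constant `K`
the oscillation vanishes. -/
theorem exists_coercivity_of_isTraceConst (S : ∀ i, Setting P (M i)) (hP : P.Admissible)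
    (hkind : ∀ i, (M i).HasElementsOf κ) {C θ η : ℝ} (hC : IsTraceConst M κ k C)
    (hθ : θ = 0 ∨ θ = 1 ∨ θ = -1) (hpen : P.PenaltyCondition κ C θ η) :
    ∃ a h₀ : ℝ, 0 < a ∧ 0 < h₀ ∧ ∀ i,
      ((∀ T ∈ (M i).cells, Metric.diam T ≤ h₀) ∨
        (∀ T ∈ (M i).cells, ∃ A : Pt d →L[ℝ] Pt d, ∀ x ∈ interior T, P.K x = A)) →
      ∀ v ∈ (M i).brokenPoly κ k, a * P.energyNorm η v ^ 2 ≤ P.aForm θ η v v := by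
  rcases isEmpty_or_nonempty ι with hι | ⟨⟨i₀⟩⟩
  · exact ⟨1, 1, one_pos, one_pos, fun i => hι.elim i⟩
  obtain ⟨k₀, hk₀, hk⟩ := hP.K_pos
  obtain ⟨t, ht, hb⟩ := exists_penalty_margin hpen
  obtain ⟨a, ha, h⟩ := exists_coercivity_const (by positivity) hθ hb
  obtain ⟨h₀, hh₀, hosc⟩ := (S i₀).exists_oscillation_bound (ε := t * k₀) (by positivity)
  refine ⟨a, h₀, ha, hh₀, fun i hi v hv => h (M i) (S i) (hkind i) v fun T F hF => ?_⟩
  obtain ⟨x₀, hx₀⟩ := ((S i).polytope T.2).2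
  have hK : ∀ y ∈ interior T.1, ‖P.K y - P.K x₀‖ ≤ t * k₀ := by
    intro y hy
    rcases hi with hi | hi
    · exact hosc (M i) (S i) T.1 T.2 (hi T.1 T.2) x₀ hx₀ y hy
    · obtain ⟨A, hA⟩ := hi T.1 T.2
      rw [hA y hy, hA x₀ hx₀, sub_self, norm_zero]
      positivity
  refine ((S i).weighted_trace_of_oscillation ht.le hk T.2 hF (sq_nonneg C)
    (hC i T.1 T.2 F hF) hx₀ hK (mem_space_of_mem_brokenPoly hv T)).trans ?_
  exact mul_le_mul_of_nonneg_right (by linarith) ((S i).diffusion_nonneg v T)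

end Family

/-! ### Definiteness of the energy -/

namespace Setting

variable {d : ℕ} {P : Problem d} {M : Mesh d P.Ω} {F : Set (Pt d)}

variable (S : Setting P M)
include S

-- The energy is a sum of nonnegative terms, so each of them vanishes with it.
open scoped Classical in
theorem terms_eq_zero_of_energySq_eq_zero {η : ℝ} (hη : 0 ≤ η) {v : M.Fn}
    (h : P.energySq η v = 0) :
    (∀ T : M.cells, ∫ x in T.1, (inner ℝ (pgrad (v T) x) (P.K x (pgrad (v T) x)) : ℝ) = 0) ∧
    (∀ F ∈ M.intFaces ∪ P.faces₃ M,
      η / Metric.diam F * ∫ x in F, ‖M.jump v F x‖ ^ 2 ∂(surf d) = 0) ∧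
    ∀ T : M.cells, ∫ x in T.1, (2 * P.r x + P.divc x) * pval (v T) x ^ 2 = 0 := by
  rw [Problem.energySq] at h
  have d1 := fun T (_ : T ∈ (Finset.univ : Finset M.cells)) => S.diffusion_nonneg v T
  have d2 := fun F (_ : F ∈ M.intFaces ∪ P.faces₃ M) => S.penalty_nonneg hη v F
  have d3 := fun T (_ : T ∈ (Finset.univ : Finset M.cells)) => S.reaction_nonneg v T
  have h1 := Finset.sum_nonneg d1
  have h2 := Finset.sum_nonneg d2
  have h3 := Finset.sum_nonneg d3
  have h4 := Finset.sum_nonneg fun F (_ : F ∈ M.faces \ P.faces₂₂ M) => S.convection_nonneg v F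
  have h5 := Finset.sum_nonneg fun F (hF : F ∈ P.faces₂₂ M) => S.robin_nonneg v hF
  refine ⟨fun T => ?_, fun F hF => ?_, fun T => ?_⟩
  · exact (Finset.sum_eq_zero_iff_of_nonneg d1).1 (by linarith) T (Finset.mem_univ T)
  · exact (Finset.sum_eq_zero_iff_of_nonneg d2).1 (by linarith) F hF
  · exact (Finset.sum_eq_zero_iff_of_nonneg d3).1 (by linarith) T (Finset.mem_univ T)

theorem exists_eq_C {v : M.Fn} {T : M.cells}
    (h : ∫ x in T.1, (inner ℝ (pgrad (v T) x) (P.K x (pgrad (v T) x)) : ℝ) = 0) :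
    ∃ a, v T = MvPolynomial.C a := by
  obtain ⟨k₀, hk₀, hk⟩ := S.adm.K_pos
  have hTp := S.polytope T.2
  have hg : Continuous (pgrad (v T)) := by fun_prop
  have hmeas := hTp.isClosed.measurableSet
  rw [S.integral_K_eq T.2, setIntegral_eq_zero_iff_of_nonneg_ae
    ((ae_restrict_mem hmeas).mono fun x hx => S.Kon_nonneg T.2 hx _)
    (hTp.integrableOn (S.continuousOn_Kon_apply T.2 hg.continuousOn hg.continuousOn))] at h
  have h1 : ∀ᵐ x ∂(volume.restrict T.1), pgrad (v T) x = 0 := by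
    filter_upwards [h, ae_restrict_mem hmeas] with x hx hxT
    have h2 := S.Kon_lower hk T.2 hxT (pgrad (v T) x)
    rw [hx, Pi.zero_apply] at h2
    have h3 : ‖pgrad (v T) x‖ ^ 2 ≤ 0 := by nlinarith [sq_nonneg ‖pgrad (v T) x‖]
    exact norm_eq_zero.1 (pow_eq_zero_iff two_ne_zero |>.1 (le_antisymm h3 (sq_nonneg _)))
  rw [← Measure.restrict_congr_set hTp.interior_ae_eq] at h1
  exact eq_C_of_pgrad_eq_zero isOpen_interior hTp.2
    (Measure.eqOn_open_of_ae_eq h1 isOpen_interior hg.continuousOn continuousOn_const)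

/-- One point is enough: the lemma is applied to elementwise constant functions, whose jump is
constant along a face. -/
theorem exists_jump_eq_zero {η : ℝ} (hη : 0 < η) {v : M.Fn} (hF : F ∈ M.faces)
    (h : η / Metric.diam F * ∫ x in F, ‖M.jump v F x‖ ^ 2 ∂(surf d) = 0) :
    ∃ x, M.jump v F x = 0 := by
  have hj := M.continuous_jump v F
  have h1 := (mul_eq_zero.1 h).resolve_left (div_pos hη (S.diam_pos hF)).ne'
  rw [setIntegral_eq_zero_iff_of_nonneg_ae (ae_of_all _ fun x => sq_nonneg _)
    (S.integrableOn_face hF (by fun_prop))] at h1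
  have : (ae ((surf d).restrict F)).NeBot := by
    rw [ae_neBot]
    exact fun h0 => (S.surf_pos hF).ne' (Measure.restrict_eq_zero.1 h0)
  obtain ⟨x, hx⟩ := h1.exists
  exact ⟨x, by simpa using hx⟩

/-- The diffusive part makes `v` elementwise constant. Either the reaction term annihilates each
constant, or one constant vanishes at a Dirichlet face and the vanishing jumps propagate this
through the connected partition. -/
theorem eq_zero_of_energySq_eq_zero
    (hpos : 0 < surf d P.Γ₃ ∨ ∃ r₀ : ℝ, 0 < r₀ ∧
      ∀ᵐ x ∂(volume.restrict P.Ω), r₀ ≤ P.r x + P.divc x / 2)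
    {η : ℝ} (hη : 0 < η) {v : M.Fn} (h : P.energySq η v = 0) : v = 0 := by
  classical
  obtain ⟨h1, h2, h3⟩ := S.terms_eq_zero_of_energySq_eq_zero hη.le h
  choose a ha using fun T => S.exists_eq_C (h1 T)
  suffices ∀ T, a T = 0 by
    ext1 T
    rw [ha, this, map_zero, Pi.zero_apply]
  rcases hpos with hΓ | ⟨r₀, hr₀, hr⟩
  · obtain ⟨F, hF⟩ : (P.faces₃ M).Nonempty := by
      by_contra hne
      have h4 := S.bdry.closure₃
      rw [Finset.not_nonempty_iff_eq_empty.1 hne] at h4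
      have h5 : P.Γ₃ = ∅ := by simpa using h4
      rw [h5, measure_empty] at hΓ
      exact hΓ.ne rfl
    obtain ⟨T₀, hT₀, hadj, -⟩ := S.exists_adj (S.mem_bdry_of_facesIn hF)
    refine M.cells_connected S.two_le S.adm.isOpen S.adm.isConnected.isPreconnected S.adm.regular
      {T | a T = 0} ⟨T₀, ?_⟩ ?_
    · obtain ⟨x, hx⟩ := S.exists_jump_eq_zero hη (S.facesIn_subset hF)
        (h2 F (Finset.mem_union_right _ hF))
      rw [M.jump_of_adj_singleton hadj, ha, pval_C, smul_eq_zero] at hx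
      refine hx.resolve_right fun h0 => ?_
      have := norm_outerNormal hT₀
      simp [h0] at this
    · intro T hT F hTF T' hTF'
      by_cases hTT : T' = T
      · rwa [hTT]
      have hFf : F ∈ M.faces := (M.mem_faces F).2 ⟨T.1, T.2, hTF⟩
      rcases S.face_cases hFf with hint | ⟨hb, -⟩
      · obtain ⟨A, B, hAB, hA, hB, hn, hsum, -⟩ := M.exists_adj_of_mem_intFaces S.two_le hint
        obtain ⟨x, hx⟩ := S.exists_jump_eq_zero hη hFf (h2 F (Finset.mem_union_left _ hint))
        rw [Mesh.jump, hsum, hn, ha, ha, pval_C, pval_C, smul_neg, ← sub_eq_add_neg, ← sub_smul,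
          smul_eq_zero] at hx
        have hab : a A = a B := sub_eq_zero.1 (hx.resolve_right fun h0 => by
          have := norm_outerNormal hA
          simp [h0] at this)
        -- Evaluating the sum formula on the indicator of `R` shows that `R` is one of the two
        -- adjacent elements.
        have hmem : ∀ R : M.cells, IsFacet R.1 F → a R = a A := by
          intro R hR
          by_contra hne
          have h5 := hsum (E := ℕ) fun Q => if Q = R then 1 else 0
          rw [Finset.sum_ite_eq' , if_pos (M.mem_adj.2 hR), if_neg, if_neg] at h5
          · simp at h5
          · rintro rfl; exact hne hab.symm
          · rintro rfl; exact hne rfl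
        change a T' = 0
        rw [hmem T' hTF', ← hmem T hTF]
        exact hT
      · obtain ⟨R, -, hadj', -⟩ := S.exists_adj hb
        have e1 : T ∈ M.adj F := M.mem_adj.2 hTF
        have e2 : T' ∈ M.adj F := M.mem_adj.2 hTF'
        rw [hadj', Finset.mem_singleton] at e1 e2
        exact absurd (e2.trans e1.symm) hTT
  · intro T
    have hTp := S.polytope T.2
    have h4 := h3 T
    have hv : Continuous (pval (v T)) := by fun_prop
    have i1 := S.integrableOn_mul T.2 (((S.integrableOn_of_memLp le_top S.adm.r_mem T.2).const_mul
      2).add (S.integrableOn_divc T.2)) (φ := fun x => pval (v T) x ^ 2) (hv.pow 2).continuousOn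
    have h6 : 0 ≤ᵐ[volume.restrict T.1] fun x => (2 * P.r x + P.divc x) * pval (v T) x ^ 2 := by
      filter_upwards [S.ae_cell S.sign.reaction T.2] with x hx
      have : 0 ≤ 2 * P.r x + P.divc x := by linarith
      simp only [Pi.zero_apply]
      positivity
    rw [setIntegral_eq_zero_iff_of_nonneg_ae h6 i1] at h4
    have : (ae (volume.restrict T.1)).NeBot := by
      rw [ae_neBot]
      intro h0
      have h5 := (isOpen_interior.measure_pos volume hTp.2).trans_le (measure_mono interior_subset)
      exact h5.ne' (Measure.restrict_eq_zero.1 h0)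
    obtain ⟨x, hx, hrx⟩ := (h4.and (S.ae_cell hr T.2)).exists
    simp only [ha, pval_C, Pi.zero_apply, mul_eq_zero] at hx
    exact pow_eq_zero_iff two_ne_zero |>.1 (hx.resolve_left (by linarith))

end Setting

/-! ### Bilinearity of the forms -/

section Closure

variable {E : Type*} [AddCommGroup E] [Module ℝ E] {α β : Type*}

theorem isBilinearMap_finsetSum {f : α → E → E → ℝ} (s : Finset α)
    (h : ∀ a ∈ s, IsBilinearMap ℝ (f a)) : IsBilinearMap ℝ fun u v => ∑ a ∈ s, f a u v where
  add_left u u' v := by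
    rw [← Finset.sum_add_distrib]; exact Finset.sum_congr rfl fun a ha => (h a ha).add_left u u' v
  smul_left c u v := by
    rw [Finset.smul_sum]; exact Finset.sum_congr rfl fun a ha => (h a ha).smul_left c u v
  add_right u v v' := by
    rw [← Finset.sum_add_distrib]; exact Finset.sum_congr rfl fun a ha => (h a ha).add_right u v v'
  smul_right c u v := by
    rw [Finset.smul_sum]; exact Finset.sum_congr rfl fun a ha => (h a ha).smul_right c u v

theorem _root_.IsBilinearMap.add {f g : E → E → ℝ} (hf : IsBilinearMap ℝ f) (hg : IsBilinearMap ℝ g) :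
    IsBilinearMap ℝ fun u v => f u v + g u v where
  add_left u u' v := by rw [hf.add_left, hg.add_left]; ring
  smul_left c u v := by rw [hf.smul_left, hg.smul_left, smul_add]
  add_right u v v' := by rw [hf.add_right, hg.add_right]; ring
  smul_right c u v := by rw [hf.smul_right, hg.smul_right, smul_add]

theorem _root_.IsBilinearMap.const_mul {f : E → E → ℝ} (a : ℝ) (hf : IsBilinearMap ℝ f) :
    IsBilinearMap ℝ fun u v => a * f u v where
  add_left u u' v := by rw [hf.add_left]; ring
  smul_left c u v := by rw [hf.smul_left, smul_eq_mul, smul_eq_mul]; ring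
  add_right u v v' := by rw [hf.add_right]; ring
  smul_right c u v := by rw [hf.smul_right, smul_eq_mul, smul_eq_mul]; ring

theorem _root_.IsBilinearMap.swap {f : E → E → ℝ} (hf : IsBilinearMap ℝ f) :
    IsBilinearMap ℝ fun u v => f v u :=
  ⟨fun u u' v => hf.add_right v u u', fun c u v => hf.smul_right c v u,
    fun u v v' => hf.add_left v v' u, fun c u v => hf.smul_left c v u⟩

theorem isBilinearMap_integral [MeasurableSpace β] {μ : Measure β} {f : E → E → β → ℝ}
    (h : ∀ x, IsBilinearMap ℝ fun u v => f u v x) (hi : ∀ u v, Integrable (f u v) μ) :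
    IsBilinearMap ℝ fun u v => ∫ x, f u v x ∂μ where
  add_left u u' v := by simp only [(h _).add_left]; exact integral_add (hi _ _) (hi _ _)
  smul_left c u v := by simp only [(h _).smul_left]; exact integral_smul c _
  add_right u v v' := by simp only [(h _).add_right]; exact integral_add (hi _ _) (hi _ _)
  smul_right c u v := by simp only [(h _).smul_right]; exact integral_smul c _

theorem isLinearMap_finsetSum {f : α → E → ℝ} (s : Finset α)
    (h : ∀ a ∈ s, IsLinearMap ℝ (f a)) : IsLinearMap ℝ fun v => ∑ a ∈ s, f a v where
  map_add u v := by
    rw [← Finset.sum_add_distrib]; exact Finset.sum_congr rfl fun a ha => (h a ha).map_add u v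
  map_smul c v := by
    rw [Finset.smul_sum]; exact Finset.sum_congr rfl fun a ha => (h a ha).map_smul c v

theorem _root_.IsLinearMap.add {f g : E → ℝ} (hf : IsLinearMap ℝ f) (hg : IsLinearMap ℝ g) :
    IsLinearMap ℝ fun v => f v + g v where
  map_add u v := by rw [hf.map_add, hg.map_add]; ring
  map_smul c v := by rw [hf.map_smul, hg.map_smul, smul_add]

theorem _root_.IsLinearMap.const_mul {f : E → ℝ} (a : ℝ) (hf : IsLinearMap ℝ f) :
    IsLinearMap ℝ fun v => a * f v where
  map_add u v := by rw [hf.map_add]; ring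
  map_smul c v := by rw [hf.map_smul, smul_eq_mul, smul_eq_mul]; ring

theorem isLinearMap_integral [MeasurableSpace β] {μ : Measure β} {f : E → β → ℝ}
    (h : ∀ x, IsLinearMap ℝ fun v => f v x) (hi : ∀ v, Integrable (f v) μ) :
    IsLinearMap ℝ fun v => ∫ x, f v x ∂μ where
  map_add u v := by simp only [(h _).map_add]; exact integral_add (hi _) (hi _)
  map_smul c v := by simp only [(h _).map_smul]; exact integral_smul c _

end Closure

/-! ### Linearity of jumps, averages, fluxes and upwind values. -/

section Traces

variable {d : ℕ} {P : Problem d} {M : Mesh d P.Ω}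

theorem jump_add (u v : M.Fn) (F : Set (Pt d)) (x : Pt d) :
    M.jump (u + v) F x = M.jump u F x + M.jump v F x := by
  simp [Mesh.jump, add_smul, Finset.sum_add_distrib]

theorem jump_smul (c : ℝ) (v : M.Fn) (F : Set (Pt d)) (x : Pt d) :
    M.jump (c • v) F x = c • M.jump v F x := by
  simp [Mesh.jump, mul_smul, Finset.smul_sum]

theorem avg_add (u v : M.Fn) (F : Set (Pt d)) (x : Pt d) :
    M.avg (u + v) F x = M.avg u F x + M.avg v F x := by
  simp [Mesh.avg, Finset.sum_add_distrib, mul_add]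

theorem avg_smul (c : ℝ) (v : M.Fn) (F : Set (Pt d)) (x : Pt d) :
    M.avg (c • v) F x = c * M.avg v F x := by
  simp [Mesh.avg, Finset.mul_sum, mul_left_comm]

theorem avgFlux_add (u v : M.Fn) (F : Set (Pt d)) (x : Pt d) :
    P.avgFlux (u + v) F x = P.avgFlux u F x + P.avgFlux v F x := by
  simp [Problem.avgFlux, Finset.sum_add_distrib]

theorem avgFlux_smul (c : ℝ) (v : M.Fn) (F : Set (Pt d)) (x : Pt d) :
    P.avgFlux (c • v) F x = c • P.avgFlux v F x := by
  simp [Problem.avgFlux, ← Finset.smul_sum, smul_comm c]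

theorem upwind_add (u v : M.Fn) (F : Set (Pt d)) (x : Pt d) :
    P.upwind (u + v) F x = P.upwind u F x + P.upwind v F x := by
  simp only [Problem.upwind, ← Finset.sum_add_distrib]
  refine Finset.sum_congr rfl fun T _ => ?_
  split_ifs <;> simp [add_smul]

theorem upwind_smul (c : ℝ) (v : M.Fn) (F : Set (Pt d)) (x : Pt d) :
    P.upwind (c • v) F x = c • P.upwind v F x := by
  simp only [Problem.upwind, Finset.smul_sum]
  refine Finset.sum_congr rfl fun T _ => ?_
  split_ifs <;> simp [mul_smul]

end Traces

/-! ### Integrability and bilinearity of the energy and of the method. -/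

namespace Setting

variable {d : ℕ} {P : Problem d} {M : Mesh d P.Ω} {F : Set (Pt d)}

variable (S : Setting P M)
include S

theorem integrableOn_abs_normal_mul (hF : F ∈ M.faces) {φ : Pt d → ℝ} (hφ : Continuous φ) :
    IntegrableOn (fun x => |(inner ℝ (P.c x) (M.normal F) : ℝ)| * φ x) F (surf d) := by
  obtain ⟨T, hT, -⟩ := M.exists_normal_eq hF
  simp only [S.abs_inner_normal hF hT]
  exact S.integrableOn_abs_normal_c_mul hT hφ

theorem integrableOn_robin (hF : F ∈ P.faces₂₂ M) {φ : Pt d → ℝ} (hφ : Continuous φ) :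
    IntegrableOn (fun x => (2 * P.α x - inner ℝ (M.normal F) (P.c x)) * φ x) F (surf d) := by
  have h2 := S.faces₂₂_subset hF
  obtain ⟨T, hT, hadj, hnormal⟩ := S.exists_adj (S.mem_bdry_of_facesIn h2)
  rw [hnormal]
  exact S.integrableOn_facet_mul T.2 hT (((S.integrableOn_facet le_top S.adm.α_mem h2).const_mul
    2).sub (S.integrableOn_normal_c T.2 hT)) hφ.continuousOn

theorem integrableOn_facesIn_mul {Γ : Set (Pt d)} (hF : F ∈ P.facesIn M Γ) {p : ℝ≥0∞} (hp : 1 ≤ p)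
    {f φ : Pt d → ℝ} (hf : MemLp f p ((surf d).restrict Γ)) (hφ : Continuous φ) :
    IntegrableOn (fun x => f x * φ x) F (surf d) := by
  obtain ⟨T, hT, -, -⟩ := S.exists_adj (S.mem_bdry_of_facesIn hF)
  exact S.integrableOn_facet_mul T.2 hT (S.integrableOn_facet hp hf hF) hφ.continuousOn

/-- On faces only the normal component of `c` is known to be bounded. As adjacent normals agree up
to sign, each product is a polynomial times the positive part of `c·ν`. -/
theorem integrableOn_upwind_jump (u v : M.Fn) (F : Set (Pt d)) :
    IntegrableOn (fun x => (inner ℝ (P.upwind u F x) (M.jump v F x) : ℝ)) F (surf d) := by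
  classical
  simp only [Problem.upwind, Mesh.jump, sum_inner, inner_sum]
  refine integrable_finsetSum _ fun T' hT' => integrable_finsetSum _ fun T hT => ?_
  have hTF := M.mem_adj.1 hT
  obtain ⟨s, hs⟩ : ∃ s : ℝ, outerNormal T'.1 F = s • outerNormal T.1 F := by
    rcases outerNormal_eq_or_eq_neg hTF (M.mem_adj.1 hT') with h | h
    · exact ⟨1, by rw [h, one_smul]⟩
    · exact ⟨-1, by rw [h, neg_one_smul]⟩
  have h1 := S.integrableOn_facet_mul T.2 hTF (S.integrableOn_normal_c T.2 hTF).pos_part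
    (φ := fun x => s * pval (u T) x * pval (v T') x) (by fun_prop)
  refine h1.congr (ae_of_all _ fun x => ?_)
  simp only [hs]
  rw [real_inner_comm (outerNormal T.1 F)]
  split_ifs with h
  · rw [max_eq_left h.le, real_inner_smul_left, real_inner_smul_right, real_inner_smul_right,
      real_inner_comm (outerNormal T.1 F)]
    ring
  · rw [max_eq_right (not_lt.1 h), inner_zero_left, zero_mul]

open scoped Classical in
/-- The energy is the quadratic form of a bilinear form. -/
theorem exists_isBilinearMap_energySq (η : ℝ) :
    ∃ b : M.Fn → M.Fn → ℝ, IsBilinearMap ℝ b ∧ ∀ v, b v v = P.energySq η v := by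
  refine ⟨fun u v =>
    (∑ T : M.cells, ∫ x in T.1, inner ℝ (pgrad (u T) x) (P.K x (pgrad (v T) x))) +
    (∑ F ∈ M.intFaces ∪ P.faces₃ M,
      η / Metric.diam F * ∫ x in F, inner ℝ (M.jump u F x) (M.jump v F x) ∂(surf d)) +
    1 / 2 * (∑ T : M.cells,
      ∫ x in T.1, (2 * P.r x + P.divc x) * (pval (u T) x * pval (v T) x)) +
    1 / 2 * (∑ F ∈ M.faces \ P.faces₂₂ M,
      ∫ x in F, |inner ℝ (P.c x) (M.normal F)| *
        (inner ℝ (M.jump u F x) (M.jump v F x) : ℝ) ∂(surf d)) +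
    1 / 2 * ∑ F ∈ P.faces₂₂ M,
      ∫ x in F, (2 * P.α x - inner ℝ (M.normal F) (P.c x)) * (M.avg u F x * M.avg v F x)
        ∂(surf d), ?_, fun v => ?_⟩
  · refine ((((isBilinearMap_finsetSum _ fun T _ => ?_).add (isBilinearMap_finsetSum _
      fun F hF => IsBilinearMap.const_mul _ ?_)).add (IsBilinearMap.const_mul _
      (isBilinearMap_finsetSum _ fun T _ => ?_))).add (IsBilinearMap.const_mul _
      (isBilinearMap_finsetSum _ fun F hF => ?_))).add (IsBilinearMap.const_mul _
      (isBilinearMap_finsetSum _ fun F hF => ?_))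
    · refine isBilinearMap_integral (fun x => ?_) fun u v => S.integrableOn_inner_K T.2
        (continuous_pgrad _).continuousOn (continuous_pgrad _).continuousOn
      constructor <;> intros <;> simp [inner_add_left, inner_add_right, real_inner_smul_left,
        real_inner_smul_right]
    · refine isBilinearMap_integral (fun x => ?_) fun u v =>
        S.integrableOn_face (S.mem_faces_of_penalty (Finset.mem_union.1 hF))
          ((M.continuous_jump u F).inner (M.continuous_jump v F))
      constructor <;> intros <;> simp [jump_add, jump_smul, inner_add_left, inner_add_right,
        real_inner_smul_left, real_inner_smul_right]
    · refine isBilinearMap_integral (fun x => ?_) fun u v => S.integrableOn_mul T.2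
        (((S.integrableOn_of_memLp le_top S.adm.r_mem T.2).const_mul 2).add
          (S.integrableOn_divc T.2)) (by fun_prop)
      constructor <;> intros <;> simp <;> ring
    · refine isBilinearMap_integral (fun x => ?_) fun u v =>
        S.integrableOn_abs_normal_mul (Finset.mem_sdiff.1 hF).1
          ((M.continuous_jump u F).inner (M.continuous_jump v F))
      constructor <;> intros <;> simp [jump_add, jump_smul, inner_add_left, inner_add_right,
        real_inner_smul_left, real_inner_smul_right] <;> ring
    · refine isBilinearMap_integral (fun x => ?_) fun u v =>
        S.integrableOn_robin hF ((M.continuous_avg u F).mul (M.continuous_avg v F))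
      constructor <;> intros <;> simp [avg_add, avg_smul] <;> ring
  · simp only [Problem.energySq, real_inner_self_eq_norm_sq, pow_two]

open scoped Classical in
theorem isBilinearMap_aForm (θ η : ℝ) :
    IsBilinearMap ℝ fun u v : M.Fn => P.aForm θ η u v := by
  have e1 : ∀ (F : Set (Pt d)) (u v : M.Fn),
      (θ * (∫ x in F, inner ℝ (P.avgFlux v F x) (M.jump u F x) ∂(surf d)) -
      ∫ x in F, inner ℝ (P.avgFlux u F x - (η / Metric.diam F) • M.jump u F x)
        (M.jump v F x) ∂(surf d)) =
      θ * (∫ x in F, inner ℝ (P.avgFlux v F x) (M.jump u F x) ∂(surf d)) +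
      (-1) * ∫ x in F, inner ℝ (P.avgFlux u F x - (η / Metric.diam F) • M.jump u F x)
        (M.jump v F x) ∂(surf d) := fun F u v => by ring
  simp only [Problem.aForm, e1]
  refine (((isBilinearMap_finsetSum _ fun T _ => IsBilinearMap.add ?_ ?_).add
    (isBilinearMap_finsetSum _ fun F hF => IsBilinearMap.add (IsBilinearMap.const_mul _
      -- The symmetrization term is the consistency form with its arguments exchanged.
      (IsBilinearMap.swap ?_)) (IsBilinearMap.const_mul _ ?_))).add
    (isBilinearMap_finsetSum _ fun F hF => ?_)).add (isBilinearMap_finsetSum _ fun F hF => ?_)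
  · refine isBilinearMap_integral (fun x => ?_) fun u v => ?_
    · constructor <;> intros <;> simp [inner_add_left, inner_add_right, inner_sub_left,
        real_inner_smul_left, real_inner_smul_right] <;> ring
    · have i1 := S.integrableOn_inner_K T.2 (continuous_pgrad (v T)).continuousOn
        (continuous_pgrad (u T)).continuousOn
      have i2 := S.integrableOn_inner_c T.2 (ξ := fun x => pval (u T) x • pgrad (v T) x)
        (by fun_prop)
      refine (i1.sub i2).congr (ae_of_all _ fun x => ?_)
      simp only [Pi.sub_apply, inner_sub_left, real_inner_smul_left, real_inner_smul_right]
      rw [real_inner_comm]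
  · refine isBilinearMap_integral (fun x => ?_) fun u v => ?_
    · constructor <;> intros <;> simp <;> ring
    · simp only [mul_assoc]
      exact S.integrableOn_mul T.2 (S.integrableOn_of_memLp le_top S.adm.r_mem T.2) (by fun_prop)
  · refine isBilinearMap_integral (fun x => ?_) fun u v => S.integrableOn_avgFlux_jump F u v
    constructor <;> intros <;> simp [jump_add, jump_smul, avgFlux_add, avgFlux_smul,
      inner_add_left, inner_add_right, real_inner_smul_left, real_inner_smul_right]
  · refine isBilinearMap_integral (fun x => ?_) fun u v => ?_
    · constructor <;> intros <;> simp [jump_add, jump_smul, avgFlux_add, avgFlux_smul,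
        inner_add_left, inner_add_right, inner_sub_left, real_inner_smul_left,
        real_inner_smul_right] <;> ring
    · have hFf := S.mem_faces_of_penalty (Finset.mem_union.1 hF)
      simp only [inner_sub_left, real_inner_smul_left]
      exact (S.integrableOn_avgFlux_jump F u v).sub ((S.integrableOn_face hFf
        ((M.continuous_jump u F).inner (M.continuous_jump v F))).const_mul _)
  · refine isBilinearMap_integral (fun x => ?_) fun u v => S.integrableOn_upwind_jump u v F
    constructor <;> intros <;> simp [jump_add, jump_smul, upwind_add, upwind_smul,
      inner_add_left, inner_add_right, real_inner_smul_left, real_inner_smul_right]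
  · refine isBilinearMap_integral (fun x => ?_) fun u v => ?_
    · constructor <;> intros <;> simp [avg_add, avg_smul] <;> ring
    · simp only [mul_assoc]
      exact S.integrableOn_facesIn_mul (S.faces₂₂_subset hF) le_top S.adm.α_mem
        ((M.continuous_avg u F).mul (M.continuous_avg v F))

/-- Pairing with the normal leaves the integrable `g₃` times a continuous function, and the product
of `g₃` with the bounded `c·ν`. -/
theorem integrableOn_dirichlet (hF : F ∈ P.faces₃ M) (θ : ℝ) (v : M.Fn) :
    IntegrableOn (fun x => (inner ℝ (θ • P.avgFlux v F x - M.avg v F x • P.c x)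
      (P.g₃ x • M.normal F) : ℝ)) F (surf d) := by
  obtain ⟨T, hT, hadj, hnormal⟩ := S.exists_adj (S.mem_bdry_of_facesIn hF)
  have := S.isFiniteMeasure_facet T.2 hT
  have hg := S.integrableOn_facet one_le_two S.adm.g₃_mem hF
  have i1 := S.integrableOn_facet_mul T.2 hT hg
    (φ := fun x => inner ℝ (outerNormal T.1 F) (P.Kon T.1 x (pgrad (v T) x)))
    ((S.continuousOn_Kon_apply T.2 continuousOn_const (continuous_pgrad _).continuousOn).mono
      hT.subset)
  have i2 : IntegrableOn (fun x => (inner ℝ (outerNormal T.1 F) (P.c x) : ℝ) * P.g₃ x) F (surf d) :=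
    hg.mul_of_top_right (S.traces.mem T.1 T.2 F hT)
  have i3 := S.integrableOn_facet_mul T.2 hT i2 (φ := pval (v T)) (by fun_prop)
  refine ((i1.const_mul θ).sub i3).congr (ae_of_all _ fun x => ?_)
  simp only [Pi.sub_apply, Problem.avgFlux, hadj, Finset.sum_singleton, Finset.card_singleton,
    M.avg_of_adj_singleton hadj, hnormal, inner_sub_left, real_inner_smul_left,
    real_inner_smul_right, Nat.cast_one, inv_one, one_smul]
  rw [real_inner_comm (outerNormal T.1 F), real_inner_comm (outerNormal T.1 F) (P.c x)]
  ring

theorem isLinearMap_lForm (θ η : ℝ) : IsLinearMap ℝ fun v : M.Fn => P.lForm θ η v := by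
  simp only [Problem.lForm]
  refine (((isLinearMap_finsetSum _ fun T _ => ?_).add (isLinearMap_finsetSum _
    fun F hF => ?_)).add (isLinearMap_finsetSum _ fun F hF => ?_)).add
    (isLinearMap_finsetSum _ fun F hF => (IsLinearMap.const_mul _ ?_).add ?_)
  · refine isLinearMap_integral (fun x => ?_) fun v => S.integrableOn_mul T.2
      (S.integrableOn_of_memLp one_le_two S.adm.f_mem T.2) (by fun_prop)
    constructor <;> intros <;> simp <;> ring
  · refine isLinearMap_integral (fun x => ?_) fun v =>
      S.integrableOn_facesIn_mul hF one_le_two S.adm.g₁_mem (M.continuous_avg v F)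
    constructor <;> intros <;> simp [avg_add, avg_smul] <;> ring
  · refine isLinearMap_integral (fun x => ?_) fun v =>
      S.integrableOn_facesIn_mul hF one_le_two S.adm.g₂_mem (M.continuous_avg v F)
    constructor <;> intros <;> simp [avg_add, avg_smul] <;> ring
  · refine isLinearMap_integral (fun x => ?_) fun v =>
      S.integrableOn_facesIn_mul hF one_le_two S.adm.g₃_mem (M.continuous_avg v F)
    constructor <;> intros <;> simp [avg_add, avg_smul] <;> ring
  · refine isLinearMap_integral (fun x => ?_) fun v => S.integrableOn_dirichlet hF θ v
    constructor <;> intros <;> simp [avg_add, avg_smul, avgFlux_add, avgFlux_smul, inner_add_left,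
      inner_sub_left, real_inner_smul_left, real_inner_smul_right] <;> ring

end Setting

/-! ### Boundedness of the forms -/

theorem finiteDimensional_space (κ : PolyKind) (d k : ℕ) : FiniteDimensional ℝ (κ.space d k) := by
  cases κ
  · exact inferInstanceAs (FiniteDimensional ℝ (MvPolynomial.restrictTotalDegree (Fin d) ℝ k))
  · exact inferInstanceAs (FiniteDimensional ℝ (MvPolynomial.restrictDegree (Fin d) ℝ k))

theorem finiteDimensional_brokenPoly {d : ℕ} {Ω : Set (Pt d)} (M : Mesh d Ω) (κ : PolyKind)
    (k : ℕ) : FiniteDimensional ℝ (M.brokenPoly κ k) := by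
  have := finiteDimensional_space κ d k
  let φ : M.brokenPoly κ k →ₗ[ℝ] M.cells → κ.space d k := LinearMap.pi fun T =>
    ((LinearMap.proj T).comp (M.brokenPoly κ k).subtype).codRestrict _
      fun v => v.2 T (mem_univ T)
  refine FiniteDimensional.of_injective φ fun u v h => ?_
  ext1
  funext T
  exact congrArg Subtype.val (congrFun h T)

/-- The energy is a positive definite form on the finite-dimensional space `V_h`, so linear and
bilinear forms are automatically bounded; the constants come from compactness and may depend on the
partition. -/
theorem Setting.exists_bounds {d : ℕ} {P : Problem d} {M : Mesh d P.Ω} (S : Setting P M)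
    (κ : PolyKind) (k : ℕ)
    (hpos : 0 < surf d P.Γ₃ ∨ ∃ r₀ : ℝ, 0 < r₀ ∧
      ∀ᵐ x ∂(volume.restrict P.Ω), r₀ ≤ P.r x + P.divc x / 2)
    (θ : ℝ) {η : ℝ} (hη : 0 < η) :
    (∃ L : ℝ, ∀ v ∈ M.brokenPoly κ k, |P.lForm θ η v| ≤ L * P.energyNorm η v) ∧
    ∃ B : ℝ, ∀ u ∈ M.brokenPoly κ k, ∀ v ∈ M.brokenPoly κ k,
      |P.aForm θ η u v| ≤ B * P.energyNorm η u * P.energyNorm η v := by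
  have := finiteDimensional_brokenPoly M κ k
  obtain ⟨b, hb, hbE⟩ := S.exists_isBilinearMap_energySq η
  let V := (M.brokenPoly κ k).subtype
  let b' := hb.toLinearMap.compl₁₂ V V
  have hb' : ∀ v, b' v v = P.energySq η v.1 := fun v => hbE v.1
  have hdef : ∀ v, v ≠ 0 → 0 < b' v v := fun v hv => by
    rw [hb']
    refine lt_of_le_of_ne (S.energySq_nonneg hη.le _) fun h => hv ?_
    exact Subtype.ext (S.eq_zero_of_energySq_eq_zero hpos hη h.symm)
  obtain ⟨L, hL⟩ := exists_linear_bound b' hdef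
    ((IsLinearMap.mk' _ (S.isLinearMap_lForm θ η)).comp V)
  obtain ⟨B, hB⟩ := exists_bilinear_bound b' hdef
    ((S.isBilinearMap_aForm θ η).toLinearMap.compl₁₂ V V)
  simp only [hb'] at hL hB
  exact ⟨⟨L, fun v hv => hL ⟨v, hv⟩⟩, B, fun u hu v hv => hB ⟨u, hu⟩ ⟨v, hv⟩⟩

end IPG

end

/-! ### Assembly of the five statements. -/

theorem mainTheorem9 (d : ℕ) (hd : d = 2 ∨ d = 3)
    (P : IPG.Problem d) (hP : P.Admissible)
    (κ : IPG.PolyKind) (k : ℕ)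
    (ι : Type*) (M : ι → IPG.Mesh d P.Ω)
    (hkind : ∀ i, (M i).HasElementsOf κ)
    (hreg : IPG.ShapeRegular M)
    (hbdry : ∀ i, P.BoundaryCompatible (M i))
    (htrace : ∀ i, P.HasNormalTraces (M i))
    (hsign : ∀ i, P.SignConditions (M i))
    (hK : ∀ i, P.PiecewiseContinuousK (M i)) :
    -- boundedness of the linear and the bilinear form, for each partition
    ((0 < IPG.surf d P.Γ₃ ∨
        ∃ r₀ : ℝ, 0 < r₀ ∧
          ∀ᵐ x ∂(MeasureTheory.volume.restrict P.Ω), r₀ ≤ P.r x + P.divc x / 2) →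
      ∀ θ η : ℝ, (θ = 0 ∨ θ = 1 ∨ θ = -1) → 0 < η → ∀ i,
        (∃ L : ℝ, ∀ v ∈ (M i).brokenPoly κ k, |P.lForm θ η v| ≤ L * P.energyNorm η v) ∧
        (∃ B : ℝ, ∀ u ∈ (M i).brokenPoly κ k, ∀ v ∈ (M i).brokenPoly κ k,
          |P.aForm θ η u v| ≤ B * P.energyNorm η u * P.energyNorm η v)) ∧
    -- the trace constants exist, independently of the partition
    ((∃ C : ℝ, 0 < C ∧ IPG.IsTraceConst M κ k C) ∧
      (∃ C : ℝ, 0 < C ∧ P.IsWeightedTraceConst M κ k C)) ∧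
    -- uniform coercivity on all partitions, with the constant of the weighted trace inequality
    (∀ C : ℝ, P.IsWeightedTraceConst M κ k C →
      ∀ θ η : ℝ, (θ = 0 ∨ θ = 1 ∨ θ = -1) → P.PenaltyCondition κ C θ η →
        ∃ a : ℝ, 0 < a ∧ ∀ i, ∀ v ∈ (M i).brokenPoly κ k,
          a * P.energyNorm η v ^ 2 ≤ P.aForm θ η v v) ∧
    -- uniform coercivity with the constant of the polynomial trace inequality, on all partitions
    -- on which `K` is elementwise constant and on all sufficiently fine partitions
    (∀ C : ℝ, IPG.IsTraceConst M κ k C →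
      ∀ θ η : ℝ, (θ = 0 ∨ θ = 1 ∨ θ = -1) → P.PenaltyCondition κ C θ η →
        ∃ a h₀ : ℝ, 0 < a ∧ 0 < h₀ ∧ ∀ i,
          ((∀ T ∈ (M i).cells, Metric.diam T ≤ h₀) ∨
            (∀ T ∈ (M i).cells, ∃ A : IPG.Pt d →L[ℝ] IPG.Pt d, ∀ x ∈ interior T, P.K x = A)) →
          ∀ v ∈ (M i).brokenPoly κ k, a * P.energyNorm η v ^ 2 ≤ P.aForm θ η v v) ∧
    -- the nonsymmetric method is coercive with constant one
    (∀ η : ℝ, 0 < η → ∀ i, ∀ v ∈ (M i).brokenPoly κ k,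
      P.energyNorm η v ^ 2 ≤ P.aForm 1 η v v) := by
  have S : ∀ i, IPG.Setting P (M i) := fun i =>
    ⟨by omega, hP, hbdry i, htrace i, hsign i, hK i⟩
  obtain ⟨C, hC, htr⟩ := IPG.exists_isTraceConst (by omega) hreg κ k
  exact ⟨fun hpos θ η _ hη i => (S i).exists_bounds κ k hpos θ hη,
    ⟨⟨C, hC, htr⟩, IPG.exists_isWeightedTraceConst S hP htr⟩,
    fun C hC θ η hθ hpen => IPG.exists_coercivity_of_isWeightedTraceConst S hkind hC hθ hpen,
    fun C hC θ η hθ hpen => IPG.exists_coercivity_of_isTraceConst S hP hkind hC hθ hpen,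
    -- For `θ = 1` the factor `1 - θ` removes the consistency terms, so equality holds.
    fun η hη i v _ => by rw [(S i).energyNorm_sq hη.le, (S i).aForm_self]; simp⟩
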